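/- Consider the class of two-dimensional shallow water systems \begin{gather*} \mathcal L_b:\quad u_t+uu_x+vu_y+h_x=b_x,\quad v_t+uv_x+vv_y+h_y=b_y,\quad h_t+(uh)_x+(vh)_y=0 \end{gather*} for the unknown functions $(u,v,h)$ of $(t,x,y)$, where the arbitrary element $b=b(x,y)$ runs through the smooth functions on open subsets of $\mathbb R^2$, and let $\mathcal E$ be the extended system for $(u,v,h,b)$ that consists of the same three equations and $b_t=0$. A point transformation with domain $U$ (open) is a smooth diffeomorphism from $U$ onto an open set. A first-order system is regarded as the set of first-order jets that satisfy it. A point transformation maps a system $\mathcal L$ to a system $\mathcal L'$ if its first prolongation, at all jets over $U$ at which it is defined, sends jets in $\mathcal L$ into $\mathcal L'$ and jets not in $\mathcal L$ outside $\mathcal L'$, and if it is generically defined on $\mathcal L$, i.e., over each nonempty open subset of $U$ there is a jet of $\mathcal L$ at which it is defined. A point symmetry of $\mathcal L$ is a point transformation that maps $\mathcal L$ to itself. A generalized equivalence transformation of the class is a point transformation $\Phi$ in the space with the coordinates $(t,x,y,u,v,h,b)$ such that for every smooth $b=b(x,y)$, locally near generic points, $\Phi$ takes $b$ to a smooth function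 $\tilde b=\tilde b(\tilde x,\tilde y)$, and the transformation of $(t,x,y,u,v,h)$ obtained from $\Phi$ by substituting $b=b(x,y)$ is a point transformation mapping $\mathcal L_b$ to $\mathcal L_{\tilde b}$. It is a usual equivalence transformation if, in addition, its $(t,x,y,u,v,h)$-components do not depend on $b$. Theorem. Let $U\subseteq\mathbb R^7$ be a nonempty connected open set in the space with the coordinates $(t,x,y,u,v,h,b)$. For a map $\Phi\colon U\to\mathbb R^7$ the following are equivalent: (i) $\Phi$ is a generalized equivalence transformation of the class of systems $\mathcal L_b$; (ii) $\Phi$ is a usual equivalence transformation of this class; (iii) $\Phi$ is a point symmetry of the extended system $\mathcal E$; (iv) $\Phi$ is the restriction to $U$ of a transformation of the form \begin{gather*} \tilde t=\delta_1t+\delta_2,\quad \tilde x=\delta_3x-\varepsilon\delta_4y+\delta_5,\quad \tilde y=\delta_4x+\varepsilon\delta_3y+\delta_6,\\ \tilde u=\frac{\delta_3}{\delta_1}u-\varepsilon\frac{\delta_4}{\delta_1}v,\quad \tilde v=\frac{\delta_4}{\delta_1}u+\varepsilon\frac{\delta_3}{\delta_1}v,\quad \tilde h=\frac{\delta_3^2+\delta_4^2}{\delta_1^2}h,\quad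 \tilde b=\frac{\delta_3^2+\delta_4^2}{\delta_1^2}b+\delta_7, \end{gather*} where $\varepsilon=\pm1$ and $\delta_1,\dots,\delta_7$ are real constants with $\delta_1(\delta_3^2+\delta_4^2)\ne0$. In particular, the bijections of $\mathbb R^7$ onto itself that are generalized equivalence transformations of the class form a group under composition (the generalized equivalence group $G^\sim$), which coincides with the usual equivalence group of the class and with the complete point symmetry group of $\mathcal E$, and consists of the transformations of the above form. -/

import Mathlib

open scoped ContDiff

namespace ShallowWater

/-! ### First-order jets, point transformations, prolongation -/

/-- The space of first-order jets of functions `X → W`: a point `(x, w)` of `X × W` together with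
the first derivative (a linear map `X → W`) at `x`. -/
abbrev Jet (X W : Type*) [NormedAddCommGroup X] [NormedSpace ℝ X]
    [NormedAddCommGroup W] [NormedSpace ℝ W] : Type _ :=
  (X × W) × (X →ₗ[ℝ] W)

/-- `φ` is a point transformation with domain `U`: a smooth diffeomorphism of the open set `U`
onto an open set. -/
structure IsPointTransformation {E : Type*} [NormedAddCommGroup E] [NormedSpace ℝ E]
    (φ : E → E) (U : Set E) : Prop where
  isOpen : IsOpen U
  smooth : ContDiffOn ℝ ∞ φ U
  injOn : Set.InjOn φ U
  regular : ∀ z ∈ U, Function.Bijective (fderiv ℝ φ z)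

/-- The first prolongation of `φ` is defined at the jet `(z, p)` and its value there is the jet
`(φ z, q)`. The jet `(z, p)` of a function `f` is the tangent space `{(ξ, p ξ)}` to the graph of `f`
at `z`; the differential of `φ` at `z` takes it to the tangent space `{(η, q η)}` to the graph of
the transformed function. -/
def Prolongs {X W : Type*} [NormedAddCommGroup X] [NormedSpace ℝ X]
    [NormedAddCommGroup W] [NormedSpace ℝ W]
    (φ : X × W → X × W) (z : X × W) (p q : X →ₗ[ℝ] W) : Prop :=
  Submodule.map (fderiv ℝ φ z : X × W →ₗ[ℝ] X × W) (LinearMap.graph p) = LinearMap.graph q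

/-- A system of first-order differential equations is identified with the set of jets that it
defines. The point transformation `φ` with domain `U` maps the system `L` to the system `L'` if

* its first prolongation maps the jets of `L` to jets of `L'`, and conversely only the jets
  of `L` are mapped to jets of `L'`;
* the first prolongation is generically defined on `L`: over each nonempty open part `V` of `U`
  there is a jet of `L` at which it is defined. (On a fibre of `L` which is an affine space of
  jets, being defined is a polynomial nonvanishing condition, so one jet of the fibre amounts to
  a dense open set of them. The condition excludes transformations that map no solution to the
  graph of a function, like the permutation of `t` and `b` for a system with `b_t = 0`.) -/
structure MapsSystem {X W : Type*} [NormedAddCommGroup X] [NormedSpace ℝ X]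
    [NormedAddCommGroup W] [NormedSpace ℝ W]
    (φ : X × W → X × W) (U : Set (X × W)) (L L' : Set (Jet X W)) : Prop where
  mem_iff : ∀ z ∈ U, ∀ p q : X →ₗ[ℝ] W, Prolongs φ z p q → ((z, p) ∈ L ↔ (φ z, q) ∈ L')
  generic : ∀ V ⊆ U, IsOpen V → V.Nonempty →
    ∃ z ∈ V, ∃ p q : X →ₗ[ℝ] W, (z, p) ∈ L ∧ Prolongs φ z p q

/-- Point symmetries, with domain `U`, of a system `L`. -/
def IsPointSymmetry {X W : Type*} [NormedAddCommGroup X] [NormedSpace ℝ X]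
    [NormedAddCommGroup W] [NormedSpace ℝ W]
    (L : Set (Jet X W)) (φ : X × W → X × W) (U : Set (X × W)) : Prop :=
  IsPointTransformation φ U ∧ MapsSystem φ U L L

/-! ### The shallow water equations -/

/-- The independent variables `(t, x, y)`. -/
abbrev Indep : Type := Fin 3 → ℝ

/-- The dependent variables `(u, v, h)`. -/
abbrev Dep : Type := Fin 3 → ℝ

/-- The space with the coordinates `(t, x, y, u, v, h, b)`, as `((t, x, y), ((u, v, h), b))`. -/
abbrev Space : Type := Indep × (Dep × ℝ)

/-- The projection of `(t, x, y)` to `(x, y)`. -/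
def horizontal (a : Indep) : ℝ × ℝ := (a 1, a 2)

/-- The system `u_t + u u_x + v u_y + h_x = b_x`, `v_t + u v_x + v v_y + h_y = b_y`,
`h_t + (u h)_x + (v h)_y = 0` with fixed bottom topography `b = b(x, y)`, `(x, y) ∈ Ω`.
The derivative of `w i` along the `j`th independent variable is `p (Pi.single j 1) i`. -/
def system (b : ℝ × ℝ → ℝ) (Ω : Set (ℝ × ℝ)) : Set (Jet Indep Dep) :=
  {j | let u := j.1.2 0
       let v := j.1.2 1
       let h := j.1.2 2
       let wt := j.2 (Pi.single 0 1)
       let wx := j.2 (Pi.single 1 1)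
       let wy := j.2 (Pi.single 2 1)
       horizontal j.1.1 ∈ Ω ∧
       wt 0 + u * wx 0 + v * wy 0 + wx 2 = fderiv ℝ b (horizontal j.1.1) (1, 0) ∧
       wt 1 + u * wx 1 + v * wy 1 + wy 2 = fderiv ℝ b (horizontal j.1.1) (0, 1) ∧
       wt 2 + (wx 0 * h + u * wx 2) + (wy 1 * h + v * wy 2) = 0}

/-- The extended system for the unknown functions `u, v, h, b` of `(t, x, y)`:
the shallow water equations together with `b_t = 0`. -/
def extendedSystem : Set (Jet Indep (Dep × ℝ)) :=
  {j | let u := j.1.2.1 0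
       let v := j.1.2.1 1
       let h := j.1.2.1 2
       let wt := j.2 (Pi.single 0 1)
       let wx := j.2 (Pi.single 1 1)
       let wy := j.2 (Pi.single 2 1)
       wt.1 0 + u * wx.1 0 + v * wy.1 0 + wx.1 2 = wx.2 ∧
       wt.1 1 + u * wx.1 1 + v * wy.1 1 + wy.1 2 = wy.2 ∧
       wt.1 2 + (wx.1 0 * h + u * wx.1 2) + (wy.1 1 * h + v * wy.1 2) = 0 ∧
       wt.2 = 0}

/-! ### Equivalence transformations of the class -/

/-- Substitution of a value `b = b(x, y)` of the arbitrary element: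
`(t, x, y, u, v, h) ↦ (t, x, y, u, v, h, b(x, y))`. -/
def lift (b : ℝ × ℝ → ℝ) (z : Indep × Dep) : Space := (z.1, (z.2, b (horizontal z.1)))

/-- The `(t, x, y, u, v, h)`-components of `Φ` as functions of `(t, x, y, u, v, h)`, for a fixed
value of the arbitrary element `b`. -/
def specialize (Φ : Space → Space) (b : ℝ × ℝ → ℝ) (z : Indep × Dep) : Indep × Dep :=
  ((Φ (lift b z)).1, (Φ (lift b z)).2.1)

/-- Generalized equivalence transformations, with domain `U`, of the class of shallow water
equations: point transformations `Φ` of the space with the coordinates `(t, x, y, u, v, h, b)` such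
that for every smooth value `b` of the arbitrary element, `Φ` transforms `b` to a value `b'` of the
arbitrary element, again a smooth function of `(x, y)` alone, and the transformation `φ` of
`(t, x, y, u, v, h)` that `Φ` gives for this `b` is a point transformation that maps the system
with `b` to the system with `b'`. All this is required locally, at generic points: each nonempty
open set `V` of points `z = (t, x, y, u, v, h)` with `(z, b(x, y)) ∈ U` contains a nonempty open
set `V'` where it holds. -/
def IsGeneralizedEquivalence (Φ : Space → Space) (U : Set Space) : Prop :=
  IsPointTransformation Φ U ∧
  ∀ (b : ℝ × ℝ → ℝ) (Ω : Set (ℝ × ℝ)), IsOpen Ω → ContDiffOn ℝ ∞ b Ω →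
    ∀ V : Set (Indep × Dep), IsOpen V → V.Nonempty →
      (∀ z ∈ V, horizontal z.1 ∈ Ω ∧ lift b z ∈ U) →
      ∃ V' ⊆ V, V'.Nonempty ∧
        ∃ (b' : ℝ × ℝ → ℝ) (Ω' : Set (ℝ × ℝ)), IsOpen Ω' ∧ ContDiffOn ℝ ∞ b' Ω' ∧
          (∀ z ∈ V', horizontal (specialize Φ b z).1 ∈ Ω' ∧
            (Φ (lift b z)).2.2 = b' (horizontal (specialize Φ b z).1)) ∧
          IsPointTransformation (specialize Φ b) V' ∧
          MapsSystem (specialize Φ b) V' (system b Ω) (system b' Ω')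

/-- Usual equivalence transformations of the class: the `(t, x, y, u, v, h)`-components of the
transformation do not depend on the arbitrary element `b`. -/
def IsUsualEquivalence (Φ : Space → Space) (U : Set Space) : Prop :=
  IsGeneralizedEquivalence Φ U ∧
  ∃ φ : Indep × Dep → Indep × Dep, ∀ z ∈ U, ((Φ z).1, (Φ z).2.1) = φ (z.1, z.2.1)

/-- The transformations of the explicit form. -/
noncomputable def explicitMap (ε δ₁ δ₂ δ₃ δ₄ δ₅ δ₆ δ₇ : ℝ) (z : Space) : Space :=
  let t := z.1 0
  let x := z.1 1
  let y := z.1 2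
  let u := z.2.1 0
  let v := z.2.1 1
  let h := z.2.1 2
  let b := z.2.2
  (![δ₁ * t + δ₂, δ₃ * x - ε * δ₄ * y + δ₅, δ₄ * x + ε * δ₃ * y + δ₆],
    (![δ₃ / δ₁ * u - ε * (δ₄ / δ₁) * v, δ₄ / δ₁ * u + ε * (δ₃ / δ₁) * v,
        (δ₃ ^ 2 + δ₄ ^ 2) / δ₁ ^ 2 * h],
      (δ₃ ^ 2 + δ₄ ^ 2) / δ₁ ^ 2 * b + δ₇))

/-- `Φ` has the explicit form on `U`, for some values of the parameters. -/
def IsExplicit (Φ : Space → Space) (U : Set Space) : Prop :=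
  ∃ ε δ₁ δ₂ δ₃ δ₄ δ₅ δ₆ δ₇ : ℝ, (ε = 1 ∨ ε = -1) ∧ δ₁ * (δ₃ ^ 2 + δ₄ ^ 2) ≠ 0 ∧
    Set.EqOn Φ (explicitMap ε δ₁ δ₂ δ₃ δ₄ δ₅ δ₆ δ₇) U

end ShallowWater

/-! A jet of the extended system at a point `z` is a three-dimensional subspace, a graph over the
independent variables, on which four alternating three-forms vanish; these are `form`, with
coefficients depending only on `u, v, h`. Prolonging `Φ` means applying its differential `T` to this
subspace. Hence, if jets of the system go to jets of the system, the pullbacks under `T` of the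
forms at `Φ z` vanish on every jet of the system on whose image `vol` is nonzero. The fibre is
parametrized freely by the `x`- and `y`-derivatives, and all values are polynomial along lines in
it, so one jet with nonzero `vol` yields vanishing on the whole fibre (`onJet_eq_zero_of_mul`);
density and continuity then give every point of `U`. Both symmetries and generalized equivalences
have this property, `PreservesJets`: the former directly, the latter by inserting affine
topographies through a prescribed point with a prescribed gradient
(`IsGeneralizedEquivalence.exists_jet`).

The consequences for `T` are linear algebra at a point where `u, v, h` and the new depth are
nonzero. A three-form vanishing on all jets is at most linear in the vertical directions
(`form_vertical_vertical`), and this forces `T` to preserve the vertical space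
(`map_vertical_of_form`): the new `t, x, y` depend on `t, x, y` only. The transformed equations are
then affine in the free derivatives and can be split. The equation `b_t = 0` isolates the topography
and the time direction (`bottom_row_of_jetPairing`), comparison of shear waves with gravity waves
shows that particle paths go to particle paths (`velocity_of_jetPairing`), and the remaining
coefficients make the spatial part conformal and fix the scale of the depth
(`conformal_of_jetPairing`). The resulting equalities, `Determining`, are closed conditions and
extend to all of `U`.

It remains to integrate. The new time depends on `t` alone, the new `x, y` on `x, y`, the new
topography on `x, y, b`, and the new velocity and depth are expressed by the first derivatives of
these. Substitution into the two `inertia` equations gives polynomials in `u, v, h` whose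
coefficients do not change with `u, v`. Splitting kills the second derivatives of the new `t, x, y`
and then the `x`- and `y`-derivatives of the new topography. On a connected `U` the map is therefore
affine, of the explicit form. Conversely, the explicit maps intertwine the equations solved for the
`t`-derivatives (`linDepProd_timeDeriv`). -/

namespace ShallowWater

/-! ### Coordinates -/

/-- The coordinates `(t, x, y, u, v, h, b)`. -/
noncomputable def coord : Fin 7 → Space →L[ℝ] ℝ :=
  let π₁ := ContinuousLinearMap.fst ℝ Indep (Dep × ℝ)
  let π₂ := (ContinuousLinearMap.fst ℝ Dep ℝ).comp (ContinuousLinearMap.snd ℝ Indep (Dep × ℝ))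
  ![(ContinuousLinearMap.proj 0).comp π₁, (ContinuousLinearMap.proj 1).comp π₁,
    (ContinuousLinearMap.proj 2).comp π₁, (ContinuousLinearMap.proj 0).comp π₂,
    (ContinuousLinearMap.proj 1).comp π₂, (ContinuousLinearMap.proj 2).comp π₂,
    (ContinuousLinearMap.snd ℝ Dep ℝ).comp (ContinuousLinearMap.snd ℝ Indep (Dep × ℝ))]

@[simp] lemma coord_zero (z : Space) : coord 0 z = z.1 0 := rfl
@[simp] lemma coord_one (z : Space) : coord 1 z = z.1 1 := rfl
@[simp] lemma coord_two (z : Space) : coord 2 z = z.1 2 := rfl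
@[simp] lemma coord_three (z : Space) : coord 3 z = z.2.1 0 := rfl
@[simp] lemma coord_four (z : Space) : coord 4 z = z.2.1 1 := rfl
@[simp] lemma coord_five (z : Space) : coord 5 z = z.2.1 2 := rfl
@[simp] lemma coord_six (z : Space) : coord 6 z = z.2.2 := rfl

lemma ext_coord {z w : Space} (h : ∀ i, coord i z = coord i w) : z = w := by
  refine Prod.ext (funext fun i => ?_) (Prod.ext (funext fun i => ?_) (h 6))
  · fin_cases i
    exacts [h 0, h 1, h 2]
  · fin_cases i
    exacts [h 3, h 4, h 5]

/-- The basis vectors of the space with the coordinates `(t, x, y, u, v, h, b)`. -/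
noncomputable def basisVec : Fin 7 → Space :=
  ![(Pi.single 0 1, 0), (Pi.single 1 1, 0), (Pi.single 2 1, 0), (0, (Pi.single 0 1, 0)),
    (0, (Pi.single 1 1, 0)), (0, (Pi.single 2 1, 0)), (0, (0, 1))]

lemma coord_basisVec (i j : Fin 7) : coord i (basisVec j) = if i = j then 1 else 0 := by
  fin_cases i <;> fin_cases j <;> simp [coord, basisVec]

lemma sum_coord (z : Space) : ∑ i, coord i z • basisVec i = z := by
  refine ext_coord fun i => ?_
  simp [coord_basisVec]

/-! ### Three-forms -/

section Forms

variable {E : Type*} [AddCommGroup E] [Module ℝ E]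

/-- The wedge product of three linear functionals. -/
noncomputable def wedge (a b c : E →ₗ[ℝ] ℝ) : E →ₗ[ℝ] E →ₗ[ℝ] E →ₗ[ℝ] ℝ :=
  a.smulRight (b.smulRight c) + b.smulRight (c.smulRight a) + c.smulRight (a.smulRight b)
    + (-1 : ℝ) • (a.smulRight (c.smulRight b) + b.smulRight (a.smulRight c)
      + c.smulRight (b.smulRight a))

@[simp] lemma wedge_apply (a b c : E →ₗ[ℝ] ℝ) (x y z : E) :
    wedge a b c x y z = a x * (b y * c z) - a x * (c y * b z) + b x * (c y * a z)
      - b x * (a y * c z) + c x * (a y * b z) - c x * (b y * a z) := by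
  simp [wedge]
  ring

/-- The interior product of the vector with the components `k, l, m` with the volume form
`dt ∧ dx ∧ dy`, multiplied by a linear functional from the left. -/
noncomputable def wedgeFlux (a t x y : E →ₗ[ℝ] ℝ) (k l m : ℝ) : E →ₗ[ℝ] E →ₗ[ℝ] E →ₗ[ℝ] ℝ :=
  k • wedge a x y + l • wedge a y t + m • wedge a t x

/-- The three-forms of the four equations, in general coordinates. -/
noncomputable def formOf (t x y a b c d : E →ₗ[ℝ] ℝ) (u v h : ℝ) :
    Fin 4 → E →ₗ[ℝ] E →ₗ[ℝ] E →ₗ[ℝ] ℝ :=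
  ![wedgeFlux a t x y 1 u v + wedgeFlux c t x y 0 1 0 + wedgeFlux d t x y 0 (-1) 0,
    wedgeFlux b t x y 1 u v + wedgeFlux c t x y 0 0 1 + wedgeFlux d t x y 0 0 (-1),
    wedgeFlux c t x y 1 u v + wedgeFlux a t x y 0 h 0 + wedgeFlux b t x y 0 0 h,
    wedge d x y]

end Forms

/-- The volume form of the space of the independent variables. -/
noncomputable def vol : Space →ₗ[ℝ] Space →ₗ[ℝ] Space →ₗ[ℝ] ℝ :=
  wedge (coord 0) (coord 1) (coord 2)

/-- The three-forms that represent the four equations of the extended system at the values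
`u, v, h` of the dependent variables. -/
noncomputable def form (u v h : ℝ) : Fin 4 → Space →ₗ[ℝ] Space →ₗ[ℝ] Space →ₗ[ℝ] ℝ :=
  formOf (coord 0) (coord 1) (coord 2) (coord 3) (coord 4) (coord 5) (coord 6) u v h

lemma form_zero (u v h : ℝ) (x y z : Space) : form u v h 0 x y z =
    wedge (coord 3 : Space →ₗ[ℝ] ℝ) (coord 1) (coord 2) x y z
    + u * wedge (coord 3 : Space →ₗ[ℝ] ℝ) (coord 2) (coord 0) x y z
    + v * wedge (coord 3 : Space →ₗ[ℝ] ℝ) (coord 0) (coord 1) x y z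
    + wedge (coord 5 : Space →ₗ[ℝ] ℝ) (coord 2) (coord 0) x y z
    - wedge (coord 6 : Space →ₗ[ℝ] ℝ) (coord 2) (coord 0) x y z := by
  simp [form, formOf, wedgeFlux]
  ring

lemma form_one (u v h : ℝ) (x y z : Space) : form u v h 1 x y z =
    wedge (coord 4 : Space →ₗ[ℝ] ℝ) (coord 1) (coord 2) x y z
    + u * wedge (coord 4 : Space →ₗ[ℝ] ℝ) (coord 2) (coord 0) x y z
    + v * wedge (coord 4 : Space →ₗ[ℝ] ℝ) (coord 0) (coord 1) x y z
    + wedge (coord 5 : Space →ₗ[ℝ] ℝ) (coord 0) (coord 1) x y z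
    - wedge (coord 6 : Space →ₗ[ℝ] ℝ) (coord 0) (coord 1) x y z := by
  simp [form, formOf, wedgeFlux]
  ring

lemma form_two (u v h : ℝ) (x y z : Space) : form u v h 2 x y z =
    wedge (coord 5 : Space →ₗ[ℝ] ℝ) (coord 1) (coord 2) x y z
    + u * wedge (coord 5 : Space →ₗ[ℝ] ℝ) (coord 2) (coord 0) x y z
    + v * wedge (coord 5 : Space →ₗ[ℝ] ℝ) (coord 0) (coord 1) x y z
    + h * wedge (coord 3 : Space →ₗ[ℝ] ℝ) (coord 2) (coord 0) x y z
    + h * wedge (coord 4 : Space →ₗ[ℝ] ℝ) (coord 0) (coord 1) x y z := by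
  simp [form, formOf, wedgeFlux]

lemma form_three (u v h : ℝ) (x y z : Space) : form u v h 3 x y z =
    wedge (coord 6 : Space →ₗ[ℝ] ℝ) (coord 1) (coord 2) x y z := by
  simp [form, formOf]

lemma form_alternating (u v h : ℝ) (k : Fin 4) (x y : Space) :
    form u v h k x x y = 0 ∧ form u v h k x y y = 0 ∧ form u v h k x y x = 0 := by
  fin_cases k
  · simp only [form_zero, Fin.zero_eta, wedge_apply]
    refine ⟨?_, ?_, ?_⟩ <;> ring
  · simp only [form_one, Fin.mk_one, wedge_apply]
    refine ⟨?_, ?_, ?_⟩ <;> ring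
  · simp only [form_two, Fin.reduceFinMk, wedge_apply]
    refine ⟨?_, ?_, ?_⟩ <;> ring
  · simp only [form_three, Fin.reduceFinMk, wedge_apply]
    refine ⟨?_, ?_, ?_⟩ <;> ring

/-- The value of the `t`-derivatives of the dependent variables of a jet of the extended system,
in terms of the values `p`, `q` of the `x`- and `y`-derivatives. -/
def timeDeriv (u v h : ℝ) (p q : Dep × ℝ) : Dep × ℝ :=
  (![p.2 - p.1 2 - u * p.1 0 - v * q.1 0, q.2 - q.1 2 - u * p.1 1 - v * q.1 1,
    -(h * (p.1 0 + q.1 1)) - u * p.1 2 - v * q.1 2], 0)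

lemma mem_extendedSystem_iff (z : Space) (P : Indep →ₗ[ℝ] Dep × ℝ) :
    ((z, P) : Jet Indep (Dep × ℝ)) ∈ extendedSystem ↔
      P (Pi.single 0 1) = timeDeriv (z.2.1 0) (z.2.1 1) (z.2.1 2)
        (P (Pi.single 1 1)) (P (Pi.single 2 1)) := by
  simp only [extendedSystem, Set.mem_ofPred_eq, timeDeriv, Prod.ext_iff]
  constructor
  · rintro ⟨h1, h2, h3, h4⟩
    refine ⟨funext fun i => ?_, h4⟩
    fin_cases i <;> simp <;> linarith
  · rintro ⟨h, h4⟩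
    have h1 := congrFun h 0
    have h2 := congrFun h 1
    have h3 := congrFun h 2
    simp at h1 h2 h3
    refine ⟨?_, ?_, ?_, h4⟩ <;> linarith

lemma mem_system_iff (b : ℝ × ℝ → ℝ) (Ω : Set (ℝ × ℝ)) (z : Indep × Dep) (p : Indep →ₗ[ℝ] Dep) :
    ((z, p) : Jet Indep Dep) ∈ system b Ω ↔ horizontal z.1 ∈ Ω ∧
      p (Pi.single 0 1) = (timeDeriv (z.2 0) (z.2 1) (z.2 2)
        (p (Pi.single 1 1), fderiv ℝ b (horizontal z.1) (1, 0))
        (p (Pi.single 2 1), fderiv ℝ b (horizontal z.1) (0, 1))).1 := by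
  simp only [system, Set.mem_ofPred_eq, timeDeriv]
  refine and_congr_right fun _ => ?_
  constructor
  · rintro ⟨h1, h2, h3⟩
    refine funext fun i => ?_
    fin_cases i <;> simp <;> linarith
  · intro h
    have h1 := congrFun h 0
    have h2 := congrFun h 1
    have h3 := congrFun h 2
    simp at h1 h2 h3
    refine ⟨?_, ?_, ?_⟩ <;> linarith

lemma indep_eq_sum (ξ : Indep) :
    ξ = ξ 0 • Pi.single 0 1 + ξ 1 • Pi.single 1 1 + ξ 2 • Pi.single 2 1 := by
  ext i
  fin_cases i <;> simp

lemma map_indep {W : Type*} [AddCommGroup W] [Module ℝ W] (P : Indep →ₗ[ℝ] W) (ξ : Indep) :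
    P ξ = ξ 0 • P (Pi.single 0 1) + ξ 1 • P (Pi.single 1 1) + ξ 2 • P (Pi.single 2 1) := by
  conv_lhs => rw [indep_eq_sum ξ]
  simp only [map_add, map_smul]

/-- The linear map with given values on the basis of the space of the independent variables. -/
noncomputable def ofColumns {W : Type*} [AddCommGroup W] [Module ℝ W] (a b c : W) :
    Indep →ₗ[ℝ] W :=
  (LinearMap.proj 0).smulRight a + (LinearMap.proj 1).smulRight b + (LinearMap.proj 2).smulRight c

lemma ofColumns_apply {W : Type*} [AddCommGroup W] [Module ℝ W] (a b c : W) (ξ : Indep) :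
    ofColumns a b c ξ = ξ 0 • a + ξ 1 • b + ξ 2 • c := by
  simp [ofColumns]

/-- On a jet of the system, the forms vanish. -/
lemma form_graph_eq_zero {z : Space} {Q : Indep →ₗ[ℝ] Dep × ℝ}
    (hQ : ((z, Q) : Jet Indep (Dep × ℝ)) ∈ extendedSystem) (k : Fin 4) (ξ₁ ξ₂ ξ₃ : Indep) :
    form (z.2.1 0) (z.2.1 1) (z.2.1 2) k (ξ₁, Q ξ₁) (ξ₂, Q ξ₂) (ξ₃, Q ξ₃) = 0 := by
  rw [mem_extendedSystem_iff] at hQ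
  rw [map_indep Q ξ₁, map_indep Q ξ₂, map_indep Q ξ₃, hQ]
  generalize Q (Pi.single 1 1) = p
  generalize Q (Pi.single 2 1) = q
  fin_cases k
  · simp [form_zero, timeDeriv, Matrix.vecHead, Matrix.vecTail]; ring
  · simp [form_one, timeDeriv, Matrix.vecHead, Matrix.vecTail]; ring
  · simp [form_two, timeDeriv, Matrix.vecHead, Matrix.vecTail]; ring
  · simp [form_three, timeDeriv]; ring

/-! ### Prolongation of linear maps -/

/-- Invert the induced map on the independent variables: the new derivative is the dependent part of
`T (ξ, p ξ)` composed with that inverse. So the prolongation is defined whenever the induced map is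
bijective. -/
lemma exists_map_graph_eq {X W : Type*} [AddCommGroup X] [Module ℝ X] [AddCommGroup W] [Module ℝ W]
    (T : X × W →ₗ[ℝ] X × W) (p : X →ₗ[ℝ] W)
    (h : Function.Bijective fun ξ => (T (ξ, p ξ)).1) :
    ∃ q : X →ₗ[ℝ] W, Submodule.map T p.graph = q.graph ∧
      ∀ ξ, (T (ξ, p ξ)).2 = q (T (ξ, p ξ)).1 := by
  let G : X →ₗ[ℝ] X × W := T ∘ₗ LinearMap.prod LinearMap.id p
  let N : X ≃ₗ[ℝ] X := LinearEquiv.ofBijective (LinearMap.fst ℝ X W ∘ₗ G) h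
  have hN (ξ : X) : N ξ = (T (ξ, p ξ)).1 := rfl
  have hq (ξ : X) : (T (ξ, p ξ)).2 = (LinearMap.snd ℝ X W ∘ₗ G ∘ₗ N.symm.toLinearMap)
      (T (ξ, p ξ)).1 := by
    rw [← hN]
    simp [G]
  refine ⟨_, ?_, hq⟩
  ext ⟨η, w⟩
  simp only [Submodule.mem_map, LinearMap.mem_graph_iff, Prod.exists]
  constructor
  · rintro ⟨ξ, _, rfl, h⟩
    have := hq ξ
    rw [h] at this
    exact this
  · intro hw
    refine ⟨N.symm η, _, rfl, ?_⟩
    have h1 : (T (N.symm η, p (N.symm η))).1 = η := by rw [← hN]; simp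
    refine Prod.ext h1 ?_
    have := hq (N.symm η)
    rw [h1] at this
    exact this.trans hw.symm

/-- The image can be a graph only if it projects onto the independent variables; by equality of
dimensions the projection is then bijective. This is the converse of `exists_map_graph_eq`. -/
lemma bijective_of_map_graph_eq {X W : Type*} [AddCommGroup X] [Module ℝ X] [Module.Finite ℝ X]
    [AddCommGroup W] [Module ℝ W]
    (T : X × W →ₗ[ℝ] X × W) (p q : X →ₗ[ℝ] W) (h : Submodule.map T p.graph = q.graph) :
    Function.Bijective fun ξ => (T (ξ, p ξ)).1 := by
  let N : X →ₗ[ℝ] X := LinearMap.fst ℝ X W ∘ₗ T ∘ₗ LinearMap.prod LinearMap.id p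
  have hs : Function.Surjective N := fun η => by
    have : ((η, q η) : X × W) ∈ Submodule.map T p.graph := by
      rw [h]; rfl
    obtain ⟨⟨ξ, w⟩, hw, e⟩ := this
    rw [SetLike.mem_coe, LinearMap.mem_graph_iff] at hw
    simp only at hw
    refine ⟨ξ, ?_⟩
    change (T (ξ, p ξ)).1 = η
    rw [← hw, e]
  exact ⟨LinearMap.injective_iff_surjective.2 hs, hs⟩

lemma vol_eq_det (N : Indep →ₗ[ℝ] Indep) (a b c : Dep × ℝ) :
    vol (N (Pi.single 0 1), a) (N (Pi.single 1 1), b) (N (Pi.single 2 1), c) =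
      LinearMap.det N := by
  rw [← LinearMap.det_toMatrix', Matrix.det_fin_three]
  simp [vol, LinearMap.toMatrix'_apply]
  ring

lemma bijective_iff_det_ne_zero (N : Indep →ₗ[ℝ] Indep) :
    Function.Bijective N ↔ LinearMap.det N ≠ 0 := by
  rw [← Module.End.isUnit_iff, LinearMap.isUnit_iff_isUnit_det, isUnit_iff_ne_zero]

/-- The value of `vol` on the image is the Jacobian of the new independent variables along the jet,
so this is the criterion for the prolongation to be defined. -/
lemma vol_ne_zero_iff (T : Space →ₗ[ℝ] Space) (P : Indep →ₗ[ℝ] Dep × ℝ) :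
    vol (T (Pi.single 0 1, P (Pi.single 0 1))) (T (Pi.single 1 1, P (Pi.single 1 1)))
      (T (Pi.single 2 1, P (Pi.single 2 1))) ≠ 0 ↔
      Function.Bijective fun ξ => (T (ξ, P ξ)).1 := by
  let N : Indep →ₗ[ℝ] Indep :=
    LinearMap.fst ℝ Indep (Dep × ℝ) ∘ₗ T ∘ₗ LinearMap.prod LinearMap.id P
  have h1 : (fun ξ => (T (ξ, P ξ)).1) = N := rfl
  rw [h1, bijective_iff_det_ne_zero, ← vol_eq_det N (T (Pi.single 0 1, P (Pi.single 0 1))).2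
    (T (Pi.single 1 1, P (Pi.single 1 1))).2 (T (Pi.single 2 1, P (Pi.single 2 1))).2]
  rfl

/-! ### Three-forms that vanish on the jets of the extended system -/

/-- The vertical vectors. -/
noncomputable def vert (a b c d : ℝ) : Space :=
  a • basisVec 3 + b • basisVec 4 + c • basisVec 5 + d • basisVec 6

lemma vert_eq (a b c d : ℝ) : vert a b c d = (0, (![a, b, c], d)) := by
  refine ext_coord fun i => ?_
  fin_cases i <;> simp [vert, basisVec]

section

variable {f : Space →ₗ[ℝ] Space →ₗ[ℝ] Space →ₗ[ℝ] ℝ} {u v h : ℝ}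

lemma alternating_swap (hf : ∀ x y, f x x y = 0 ∧ f x y y = 0 ∧ f x y x = 0) (x y z : Space) :
    f y x z = -f x y z ∧ f x z y = -f x y z := by
  constructor
  · have := (hf (x + y) z).1
    simp only [map_add, LinearMap.add_apply, (hf x z).1, (hf y z).1] at this
    linarith
  · have := (hf x (y + z)).2.1
    simp only [map_add, LinearMap.add_apply, (hf x y).2.1, (hf x z).2.1] at this
    linarith

/-- The homogeneous components of a form that vanishes on the jets. -/
lemma form_components (hf : ∀ x y, f x x y = 0 ∧ f x y y = 0 ∧ f x y x = 0)
    (h0 : ∀ p q : Dep × ℝ, f (Pi.single 0 1, timeDeriv u v h p q) (Pi.single 1 1, p)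
      (Pi.single 2 1, q) = 0) (a b c d a' b' c' d' : ℝ) :
    f (basisVec 0 + u • basisVec 1 + v • basisVec 2) (vert a b c d) (vert a' b' c' d') +
      f (vert (d - c) (d' - c') (-(h * (a + b'))) (u * d + v * d')) (basisVec 1)
        (vert a' b' c' d') +
      f (vert (d - c) (d' - c') (-(h * (a + b'))) (u * d + v * d')) (vert a b c d)
        (basisVec 2) = 0 ∧
    f (vert (d - c) (d' - c') (-(h * (a + b'))) (u * d + v * d')) (vert a b c d)
        (vert a' b' c' d') = 0 := by
  set D := basisVec 0 + u • basisVec 1 + v • basisVec 2 with hD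
  set M := vert (d - c) (d' - c') (-(h * (a + b'))) (u * d + v * d') with hM
  set p := vert a b c d with hp
  set q := vert a' b' c' d' with hq
  -- Scale the free derivatives by `s`. Modulo the other two tangent vectors, the one over `∂_t` may
  -- be replaced by the one over the transport direction `D`, since `f` is alternating. The result
  -- is cubic in `s`, and its values at `0, 1, -1, 2` isolate the coefficients of `s ^ 2` and `s ^
  -- 3`.
  have key (s : ℝ) : f (D + s • M) (basisVec 1 + s • p) (basisVec 2 + s • q) = 0 := by
    have e1 : ((Pi.single 1 1, s • p.2) : Space) = basisVec 1 + s • p := by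
      refine ext_coord fun i => ?_
      fin_cases i <;> simp [hp, vert_eq, basisVec]
    have e2 : ((Pi.single 2 1, s • q.2) : Space) = basisVec 2 + s • q := by
      refine ext_coord fun i => ?_
      fin_cases i <;> simp [hq, vert_eq, basisVec]
    have e0 : ((Pi.single 0 1, timeDeriv u v h (s • p.2) (s • q.2)) : Space) =
        (D + s • M) - u • (basisVec 1 + s • p) - v • (basisVec 2 + s • q) := by
      refine ext_coord fun i => ?_
      fin_cases i <;> simp [hD, hM, hp, hq, vert_eq, basisVec, timeDeriv] <;> ring
    have := h0 (s • p.2) (s • q.2)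
    rw [e0, e1, e2] at this
    simpa only [map_sub, map_smul, LinearMap.sub_apply, LinearMap.smul_apply, (hf _ _).1,
      (hf _ _).2.2, smul_zero, sub_zero] using this
  have k0 := key 0
  have k1 := key 1
  have k2 := key (-1)
  have k3 := key 2
  simp only [map_add, map_smul, LinearMap.add_apply, LinearMap.smul_apply, smul_eq_mul] at k0 k1 k2 k3
  constructor <;> linarith

/-- The hypothesis says that a skew form with the entries `x, y, z, s, t, r` (index pairs 34, 35,
36, 45, 46, 56) vanishes on each pair of `(0, d - c, -h b, v d)` and `(a, b, c, d)`. Unit vectors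
and sums of two of them isolate every entry, up to a factor `h` or `v`. -/
lemma quadratic_component_aux {x y z r s t v h : ℝ} (hv : v ≠ 0) (hh : h ≠ 0)
    (H : ∀ a b c d : ℝ, (d - c) * (-a * x + c * s + d * t) - h * b * (-a * y - b * s + d * r)
      + v * d * (-a * z - b * t - c * r) = 0) :
    x = 0 ∧ y = 0 ∧ z = 0 ∧ s = 0 ∧ t = 0 ∧ r = 0 := by
  have hs : s = 0 := by linarith [H 0 0 1 0]
  have ht : t = 0 := by linarith [H 0 0 0 1]
  have hx : x = 0 := by linarith [H 1 0 1 0]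
  have hy : h * y = 0 := by
    have := H 1 1 0 0
    rw [hs] at this
    linarith
  have hz : v * z = 0 := by
    have := H 1 0 0 1
    rw [ht] at this
    linarith
  have hr : h * r = 0 := by
    have := H 0 1 0 1
    rw [hs, ht] at this
    linarith
  exact ⟨hx, (mul_eq_zero.1 hy).resolve_left hh, (mul_eq_zero.1 hz).resolve_left hv, hs, ht,
    (mul_eq_zero.1 hr).resolve_left hh⟩

/-- For nonzero `u, v, h`, a three-form that vanishes on the jets of the extended system is of
degree at most one with respect to the vertical vectors. -/
lemma form_vertical_vertical (hf : ∀ x y, f x x y = 0 ∧ f x y y = 0 ∧ f x y x = 0)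
    (h0 : ∀ p q : Dep × ℝ, f (Pi.single 0 1, timeDeriv u v h p q) (Pi.single 1 1, p)
      (Pi.single 2 1, q) = 0) (hu : u ≠ 0) (hv : v ≠ 0) (hh : h ≠ 0) (w w' : Dep × ℝ) (X : Space) :
    f (0, w) (0, w') X = 0 := by
  have sw := alternating_swap hf
  have H2 a b c d a' b' c' d' := (form_components hf h0 a b c d a' b' c' d').1
  have H3 a b c d a' b' c' d' := (form_components hf h0 a b c d a' b' c' d').2
  have vz : vert 0 0 0 0 = 0 := by simp [vert]
  have s1 (i j k : Fin 7) := (sw (basisVec i) (basisVec j) (basisVec k)).1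
  have s2 (i j k : Fin 7) := (sw (basisVec i) (basisVec j) (basisVec k)).2
  have B : ∀ a b c d a' b' c' d', f (vert a b c d) (basisVec 1) (vert a' b' c' d') = 0 := by
    obtain ⟨b34, b35, b36, b45, b46, b56⟩ := quadratic_component_aux
      (x := f (basisVec 1) (basisVec 3) (basisVec 4)) (y := f (basisVec 1) (basisVec 3) (basisVec 5))
      (z := f (basisVec 1) (basisVec 3) (basisVec 6)) (s := f (basisVec 1) (basisVec 4) (basisVec 5))
      (t := f (basisVec 1) (basisVec 4) (basisVec 6)) (r := f (basisVec 1) (basisVec 5) (basisVec 6))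
      hv hh fun a b c d => by
        have := H2 0 0 0 0 a b c d
        rw [vz] at this
        simp only [vert, map_add, map_smul, LinearMap.add_apply, LinearMap.smul_apply, smul_eq_mul,
          map_zero, LinearMap.zero_apply, (hf _ _).2.2, s1 1, s2 1 3 4, s2 1 3 5, s2 1 3 6, s2 1 4 5,
          s2 1 4 6, s2 1 5 6] at this
        linarith
    intro a b c d a' b' c' d'
    simp only [vert, map_add, map_smul, LinearMap.add_apply, LinearMap.smul_apply, smul_eq_mul,
      (hf _ _).2.2, s1 1, s2 1 3 4, s2 1 3 5, s2 1 3 6, s2 1 4 5, s2 1 4 6, s2 1 5 6,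
      b34, b35, b36, b45, b46, b56]
    ring
  -- This is the preceding argument with `x` and `y` interchanged: `u` replaces `v`, the first two
  -- vertical directions are swapped, and the entry 34 changes sign.
  have C : ∀ a b c d a' b' c' d', f (vert a b c d) (vert a' b' c' d') (basisVec 2) = 0 := by
    obtain ⟨b34, b45, b46, b35, b36, b56⟩ := quadratic_component_aux
      (x := -f (basisVec 3) (basisVec 4) (basisVec 2))
      (s := f (basisVec 3) (basisVec 5) (basisVec 2))
      (t := f (basisVec 3) (basisVec 6) (basisVec 2)) (y := f (basisVec 4) (basisVec 5) (basisVec 2))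
      (z := f (basisVec 4) (basisVec 6) (basisVec 2)) (r := f (basisVec 5) (basisVec 6) (basisVec 2))
      hu hh fun b a c d => by
        have := H2 a b c d 0 0 0 0
        rw [vz] at this
        simp only [vert, map_add, map_smul, LinearMap.add_apply, LinearMap.smul_apply, smul_eq_mul,
          map_zero, (hf _ _).1, s1 3 4, s1 3 5, s1 3 6, s1 4 5, s1 4 6, s1 5 6] at this
        linarith
    rw [neg_eq_zero] at b34
    intro a b c d a' b' c' d'
    simp only [vert, map_add, map_smul, LinearMap.add_apply, LinearMap.smul_apply, smul_eq_mul,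
      (hf _ _).1, s1 3 4, s1 3 5, s1 3 6, s1 4 5, s1 4 6, s1 5 6, b34, b35, b36, b45, b46, b56]
    ring
  have D : ∀ a b c d a' b' c' d', f (basisVec 0 + u • basisVec 1 + v • basisVec 2) (vert a b c d)
      (vert a' b' c' d') = 0 := fun a b c d a' b' c' d' => by
    have := H2 a b c d a' b' c' d'
    rwa [B, C, add_zero, add_zero] at this
  -- Four choices of the derivatives in the cubic component give enough relations between the four
  -- entries 345, 346, 356, 456 to make them vanish.
  have F : ∀ a b c d a' b' c' d' a'' b'' c'' d'', f (vert a b c d) (vert a' b' c' d')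
      (vert a'' b'' c'' d'') = 0 := by
    have sc (i j k : Fin 7) : f (basisVec i) (basisVec j) (basisVec k) =
      f (basisVec j) (basisVec k) (basisVec i) := by linarith [s1 i j k, s2 j i k]
    have t1 := H3 1 0 0 0 0 1 0 0
    have t2 := H3 1 0 0 0 0 0 0 1
    have t3 := H3 0 0 0 1 0 1 0 0
    have t4 := H3 0 0 1 0 0 0 0 1
    simp only [vert, map_add, map_smul, LinearMap.add_apply, LinearMap.smul_apply, smul_eq_mul,
      (hf _ _).1, (hf _ _).2.1, (hf _ _).2.2, s1 3 4, s1 3 5, s1 3 6, s1 4 5, s1 4 6, s1 5 6,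
      s2 3 4 5, s2 3 4 6, s2 3 5 6, s2 4 5 6, sc 4 5 3, sc 4 6 3, sc 5 6 3, sc 5 6 4,
      mul_zero, zero_mul, add_zero, zero_add, one_mul, mul_one, sub_zero, zero_sub, neg_zero, sub_self]
      at t1 t2 t3 t4
    have e345 : f (basisVec 3) (basisVec 4) (basisVec 5) = 0 := by
      refine (mul_eq_zero.1 (?_ : h * _ = 0)).resolve_left hh
      linarith
    have e45 : f (basisVec 4) (basisVec 5) (basisVec 6) = f (basisVec 3) (basisVec 5) (basisVec 6) := by
      linarith
    have e456 : f (basisVec 4) (basisVec 5) (basisVec 6) = 0 := by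
      refine (mul_eq_zero.1 (?_ : h * _ = 0)).resolve_left hh
      rw [← e45] at t2
      linarith
    rw [e456] at e45 t3
    have e346 : f (basisVec 3) (basisVec 4) (basisVec 6) = 0 := by linarith
    have e356 := e45.symm
    intro a b c d a' b' c' d' a'' b'' c'' d''
    simp only [vert, map_add, map_smul, LinearMap.add_apply, LinearMap.smul_apply, smul_eq_mul,
      (hf _ _).1, (hf _ _).2.1, (hf _ _).2.2, s1 3 4, s1 3 5, s1 3 6, s1 4 5, s1 4 6, s1 5 6,
      s2 3 4 5, s2 3 4 6, s2 3 5 6, s2 4 5 6, sc 4 5 3, sc 4 6 3, sc 5 6 3, sc 5 6 4,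
      e345, e356, e346, e456]
    ring
  have hw (w : Dep × ℝ) : ((0, w) : Space) = vert (w.1 0) (w.1 1) (w.1 2) w.2 := by
    refine ext_coord fun i => ?_
    fin_cases i <;> simp [vert_eq]
  -- Relative to the transport direction, `∂_x`, `∂_y` and the vertical space, the four facts `D`,
  -- `B`, `C` and `F` cover all cases.
  have hX : X = X.1 0 • (basisVec 0 + u • basisVec 1 + v • basisVec 2)
      + (X.1 1 - u * X.1 0) • basisVec 1 + (X.1 2 - v * X.1 0) • basisVec 2 + (0, X.2) := by
    refine ext_coord fun i => ?_
    fin_cases i <;> simp [basisVec] <;> ring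
  have r (Y : Space) (p q : Space) : f p q Y = f Y p q := by linarith [(sw Y p q).1, (sw p Y q).2]
  have r' (Y : Space) (p q : Space) : f Y p q = -f p Y q := by linarith [(sw p Y q).1]
  rw [hX, hw w, hw w', hw X.2]
  simp only [map_add, map_smul, smul_eq_mul, F, C, r (basisVec 0), r (basisVec 1)]
  have := D (w.1 0) (w.1 1) (w.1 2) w.2 (w'.1 0) (w'.1 1) (w'.1 2) w'.2
  simp only [map_add, map_smul, LinearMap.add_apply, LinearMap.smul_apply, smul_eq_mul] at this
  rw [← r (basisVec 2), C] at this
  rw [r' (basisVec 1), B] at this ⊢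
  simp only [neg_zero, mul_zero, add_zero] at this ⊢
  rw [this, mul_zero]

end

/-! ### Projectability -/

section

variable {T : Space →ₗ[ℝ] Space} {u v h : ℝ}

/-- Contraction of the last form with `∂_b` leaves `dx ∧ dy`, and contraction of the first two with
`∂_h` leaves `dy ∧ dt` and `dt ∧ dx`. So the horizontal parts of `Y` and `Y'` are parallel. -/
lemma cross_eq_zero_of_form (Y Y' : Space) (hT : ∀ k Z, form u v h k Y Y' Z = 0) :
    Y.1 1 * Y'.1 2 - Y.1 2 * Y'.1 1 = 0 ∧ Y.1 2 * Y'.1 0 - Y.1 0 * Y'.1 2 = 0 ∧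
      Y.1 0 * Y'.1 1 - Y.1 1 * Y'.1 0 = 0 := by
  have h1 := hT 3 (basisVec 6)
  have h2 := hT 0 (basisVec 5)
  have h3 := hT 1 (basisVec 5)
  simp [form_three, form_zero, form_one, basisVec] at h1 h2 h3
  refine ⟨?_, ?_, ?_⟩ <;> linarith

/-- The momentum forms see `h` and `b` only through `h - b`. The conclusion says that `Y'` is a
multiple of `∂_h + ∂_b`, the vertical direction that changes neither the velocity nor `h - b`. -/
lemma vertical_of_form (hh : h ≠ 0) (Y Y' : Space) (hY : Y'.1 = 0) (h0 : Y.1 ≠ 0)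
    (hT : ∀ k Z, form u v h k Y Y' Z = 0) :
    Y' = Y'.2.2 • (0, (![0, 0, 1], 1)) := by
  have a0 := hT 0 (basisVec 0)
  have a1 := hT 0 (basisVec 1)
  have a2 := hT 0 (basisVec 2)
  have b0 := hT 1 (basisVec 0)
  have b1 := hT 1 (basisVec 1)
  have b2 := hT 1 (basisVec 2)
  have c0 := hT 2 (basisVec 0)
  have c1 := hT 2 (basisVec 1)
  have c2 := hT 2 (basisVec 2)
  obtain ⟨ξ, r, β⟩ := Y
  obtain ⟨ξ', r', β'⟩ := Y'
  simp only at hY h0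
  subst hY
  simp [form_zero, form_one, form_two, basisVec] at a0 a1 a2 b0 b1 b2 c0 c1 c2
  have key : r' 0 = 0 ∧ r' 1 = 0 ∧ r' 2 - β' = 0 := by
    generalize r' 0 = a at *
    generalize r' 1 = b at *
    generalize r' 2 = c at *
    -- Here `δ` is the component of `Y'` along `h - b`, and `ξ 1 - u * ξ 0`, `ξ 2 - v * ξ 0` are the
    -- components of `Y` relative to the flow. If `a`, `b` or `δ` were nonzero, the products below
    -- would make all components of `ξ` vanish.
    obtain ⟨δ, rfl⟩ : ∃ δ, c = β' + δ := ⟨c - β', by ring⟩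
    have e1 : a * (ξ 1 - u * ξ 0) = δ * ξ 0 := by linarith
    have e2 : a * (ξ 2 - v * ξ 0) = 0 := by linarith
    have e3 : b * (ξ 2 - v * ξ 0) = δ * ξ 0 := by linarith
    have e4 : b * (ξ 1 - u * ξ 0) = 0 := by linarith
    have e5 : (β' + δ) * (ξ 1 - u * ξ 0) = h * a * ξ 0 := by linarith
    have e6 : (β' + δ) * (ξ 2 - v * ξ 0) = h * b * ξ 0 := by linarith
    have e7 : δ * (ξ 2 - v * ξ 0) = 0 := by linear_combination -(a0 + u * a1 + v * a2)
    have e8 : δ * (ξ 1 - u * ξ 0) = 0 := by linear_combination b0 + u * b1 + v * b2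
    have hξ : ¬ (ξ 0 = 0 ∧ ξ 1 - u * ξ 0 = 0 ∧ ξ 2 - v * ξ 0 = 0) := fun ⟨h1, h2, h3⟩ => by
      rw [h1] at h2 h3
      refine h0 (funext fun i => ?_)
      fin_cases i <;> simp <;> linarith
    rw [add_sub_cancel_left]
    by_cases hd : δ = 0
    · subst hd
      rw [zero_mul] at e1 e3
      refine ⟨?_, ?_, rfl⟩ <;> by_contra hne
      · have f1 := (mul_eq_zero.1 e1).resolve_left hne
        have f2 := (mul_eq_zero.1 e2).resolve_left hne
        rw [f1, mul_zero] at e5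
        exact hξ ⟨by simpa [hh, hne] using e5.symm, f1, f2⟩
      · have f1 := (mul_eq_zero.1 e4).resolve_left hne
        have f2 := (mul_eq_zero.1 e3).resolve_left hne
        rw [f2, mul_zero] at e6
        exact hξ ⟨by simpa [hh, hne] using e6.symm, f1, f2⟩
    · have f1 := (mul_eq_zero.1 e8).resolve_left hd
      have f2 := (mul_eq_zero.1 e7).resolve_left hd
      rw [f1, mul_zero] at e1
      exact absurd ⟨(mul_eq_zero.1 e1.symm).resolve_left hd, f1, f2⟩ hξ
  obtain ⟨k1, k2, k3⟩ := key
  refine ext_coord fun i => ?_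
  fin_cases i <;> simp [k1, k2]
  linarith

/-- A linear isomorphism for which the pullbacks of the forms of the equations are of degree at
most one with respect to the vertical vectors preserves the vertical space. -/
lemma map_vertical_of_form (hh : h ≠ 0) (hT : Function.Bijective T)
    (H : ∀ k w w' X, form u v h k (T (0, w)) (T (0, w')) (T X) = 0) (w : Dep × ℝ) :
    (T (0, w)).1 = 0 := by
  have H' (w w' : Dep × ℝ) : ∀ k Z, form u v h k (T (0, w)) (T (0, w')) Z = 0 := fun k Z => by
    obtain ⟨X, rfl⟩ := hT.2 Z
    exact H k w w' X
  by_contra h0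
  -- If one vertical vector had a nonvertical image, every other image would be a multiple of it up
  -- to a vertical remainder, and that remainder lies on the line of `∂_h + ∂_b`. This would inject
  -- the four-dimensional vertical space into a space of dimension at most two.
  have hs (w' : Dep × ℝ) : T (0, w') ∈
      Submodule.span ℝ ({T (0, w), (0, (![0, 0, 1], 1))} : Set Space) := by
    obtain ⟨l, hl⟩ : ∃ l : ℝ, (T (0, w')).1 = l • (T (0, w)).1 := by
      obtain ⟨c0, c1, c2⟩ := cross_eq_zero_of_form _ _ (H' w w')
      obtain ⟨i, hi⟩ := Function.ne_iff.1 h0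
      refine ⟨(T (0, w')).1 i / (T (0, w)).1 i, ?_⟩
      have hi' : (T (0, w)).1 i ≠ 0 := hi
      ext j
      rw [Pi.smul_apply, smul_eq_mul, div_mul_eq_mul_div, eq_div_iff hi']
      fin_cases i <;> fin_cases j <;> simp <;> linarith
    have e : T (0, w') - l • T (0, w) = T (0, w' - l • w) := by
      rw [← map_smul, ← map_sub]
      simp
    have hv := vertical_of_form hh _ (T (0, w' - l • w)) (by rw [← e]; simp [hl]) h0 (H' _ _)
    rw [← e] at hv
    rw [Submodule.mem_span_pair]
    exact ⟨l, _, by rw [← hv]; abel⟩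
  let g : Dep × ℝ →ₗ[ℝ] Submodule.span ℝ ({T (0, w), (0, (![0, 0, 1], 1))} : Set Space) :=
    LinearMap.codRestrict _ (T ∘ₗ LinearMap.inr ℝ Indep (Dep × ℝ)) hs
  have hg : Function.Injective g := fun a b hab => by
    have : T (0, a) = T (0, b) := congrArg Subtype.val hab
    exact (Prod.ext_iff.1 (hT.1 this)).2
  have h1 := LinearMap.finrank_le_finrank_of_injective hg
  have h2 : Module.finrank ℝ (Submodule.span ℝ ({T (0, w), (0, (![0, 0, 1], 1))} : Set Space)) ≤ 2 := by
    classical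
    have := finrank_span_finset_le_card (R := ℝ) ({T (0, w), (0, (![0, 0, 1], 1))} : Finset Space)
    simp only [Finset.coe_insert, Finset.coe_singleton] at this
    exact this.trans Finset.card_le_two
  have h3 : Module.finrank ℝ (Dep × ℝ) = 4 := by simp
  omega

end

/-! ### The algebraic consequences for projectable transformations -/

/-- The value of the linear functional with the coefficients `k` on the derivative of a jet of the
extended system along `a₁ (∂_t + u ∂_x + v ∂_y) + a₂ ∂_x + a₃ ∂_y`; the arguments `p`, `q` are
the `x`- and `y`-derivatives. -/
def jetPairing (u v h : ℝ) (k : Fin 4 → ℝ) (a₁ a₂ a₃ : ℝ) (p q : Fin 4 → ℝ) : ℝ :=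
  a₁ * (k 0 * (p 3 - p 2) + k 1 * (q 3 - q 2) - k 2 * (h * (p 0 + q 1))
      + k 3 * (u * p 3 + v * q 3))
    + a₂ * (k 0 * p 0 + k 1 * p 1 + k 2 * p 2 + k 3 * p 3)
    + a₃ * (k 0 * q 0 + k 1 * q 1 + k 2 * q 2 + k 3 * q 3)

section

variable {u v h u' v' h' a₁ a₂ a₃ d₁ d₂ d₃ f₁ f₂ f₃ g₁ g₂ g₃ : ℝ} {α β η κ : Fin 4 → ℝ}

/-- This is the transformed equation `b_t = 0`: `κ` is the vertical part of the differential of the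
new topography and `(a₁, a₂, a₃)` the preimage of the new `∂_t` relative to the flow. All eight
coefficients of the free derivatives vanish. The last two conclusions say that this preimage is
parallel to `∂_t`. -/
lemma bottom_row_of_jetPairing (hh : h ≠ 0) (hκ : κ ≠ 0) (ha : ¬ (a₁ = 0 ∧ a₂ = 0 ∧ a₃ = 0))
    (H : ∀ p q, jetPairing u v h κ a₁ a₂ a₃ p q = 0) :
    κ 0 = 0 ∧ κ 1 = 0 ∧ κ 2 = 0 ∧ a₂ = -u * a₁ ∧ a₃ = -v * a₁ := by
  have p0 := H ![1, 0, 0, 0] 0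
  have p1 := H ![0, 1, 0, 0] 0
  have p2 := H ![0, 0, 1, 0] 0
  have p3 := H ![0, 0, 0, 1] 0
  have q0 := H 0 ![1, 0, 0, 0]
  have q1 := H 0 ![0, 1, 0, 0]
  have q2 := H 0 ![0, 0, 1, 0]
  have q3 := H 0 ![0, 0, 0, 1]
  simp [jetPairing] at p0 p1 p2 p3 q0 q1 q2 q3
  have h1 : a₁ ≠ 0 := by
    rintro rfl
    have e : ∀ i, a₂ * κ i = 0 ∧ a₃ * κ i = 0 := by
      intro i
      fin_cases i <;> constructor <;> simp <;> grind
    obtain ⟨i, hi⟩ := Function.ne_iff.1 hκ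
    exact ha ⟨rfl, (mul_eq_zero.1 (e i).1).resolve_right hi,
      (mul_eq_zero.1 (e i).2).resolve_right hi⟩
  have k2 : κ 2 = 0 := by
    by_contra hne
    have e0 : κ 0 = 0 := by
      rcases q0 with h | h
      · grind
      · exact h
    have e1 : κ 1 = 0 := by
      rcases p1 with h | h
      · grind
      · exact h
    grind
  have k0 : κ 0 = 0 := by grind
  have k1 : κ 1 = 0 := by grind
  have k3 : κ 3 ≠ 0 := fun h3 => hκ (funext fun i => by fin_cases i <;> simp [k0, k1, k2, h3])
  refine ⟨k0, k1, k2, mul_right_cancel₀ k3 ?_, mul_right_cancel₀ k3 ?_⟩ <;> grind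

/-- The vector `(d₁, d₂, d₃)` is the preimage of the new transport direction, relative to the old
flow. If `d₂` or `d₃` were nonzero, shear waves would become gravity waves for all directions not
annihilated by `(d₂, d₃)`. A quadratic dispersion relation cannot hold for so many directions unless
`f` and `g` are degenerate. -/
lemma velocity_of_jetPairing (hh' : h' ≠ 0)
    (hrow : ∀ w : Fin 4 → ℝ, α ⬝ᵥ w = 0 → β ⬝ᵥ w = 0 → η ⬝ᵥ w = 0 → κ ⬝ᵥ w = 0 → w = 0)
    (hdet : d₁ * (f₂ * g₃ - f₃ * g₂) - d₂ * (f₁ * g₃ - f₃ * g₁) + d₃ * (f₁ * g₂ - f₂ * g₁) ≠ 0)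
    (hκ : κ 0 = 0 ∧ κ 1 = 0 ∧ κ 2 = 0)
    (H₁ : ∀ p q, jetPairing u v h α d₁ d₂ d₃ p q + jetPairing u v h (η - κ) f₁ f₂ f₃ p q = 0)
    (H₂ : ∀ p q, jetPairing u v h β d₁ d₂ d₃ p q + jetPairing u v h (η - κ) g₁ g₂ g₃ p q = 0)
    (H₃ : ∀ p q, jetPairing u v h η d₁ d₂ d₃ p q + h' * (jetPairing u v h α f₁ f₂ f₃ p q
      + jetPairing u v h β g₁ g₂ g₃ p q) = 0) :
    d₂ = 0 ∧ d₃ = 0 := by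
  obtain ⟨k0, k1, k2⟩ := hκ
  have key (x y : ℝ) (hd : d₂ * x + d₃ * y ≠ 0) :
      (d₂ * x + d₃ * y) ^ 2 = h' * ((f₂ * x + f₃ * y) ^ 2 + (g₂ * x + g₃ * y) ^ 2) := by
    -- A shear wave: the velocity gradient is `(y, -x) ⊗ (x, y)`, which is divergence free, so the
    -- factor of `a₁` in `jetPairing` drops out. `A`, `B`, `C` are the resulting amplitudes of the
    -- new velocity and depth.
    have e1 := H₁ ![x * y, -(x * x), 0, 0] ![y * y, -(x * y), 0, 0]
    have e2 := H₂ ![x * y, -(x * x), 0, 0] ![y * y, -(x * y), 0, 0]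
    have e3 := H₃ ![x * y, -(x * x), 0, 0] ![y * y, -(x * y), 0, 0]
    simp [jetPairing, k0, k1] at e1 e2 e3
    set A := α 0 * y - α 1 * x with hA
    set B := β 0 * y - β 1 * x with hB
    set C := η 0 * y - η 1 * x with hC
    have e1' : A * (d₂ * x + d₃ * y) + C * (f₂ * x + f₃ * y) = 0 := by
      linear_combination e1
    have e2' : B * (d₂ * x + d₃ * y) + C * (g₂ * x + g₃ * y) = 0 := by
      linear_combination e2
    have e3' : C * (d₂ * x + d₃ * y)
        + h' * (A * (f₂ * x + f₃ * y) + B * (g₂ * x + g₃ * y)) = 0 := by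
      linear_combination e3
    have hC0 : C ≠ 0 := by
      intro hC0
      rw [hC0, zero_mul, add_zero] at e1' e2'
      have hA0 := (mul_eq_zero.1 e1').resolve_right hd
      have hB0 := (mul_eq_zero.1 e2').resolve_right hd
      have := hrow ![y, -x, 0, 0] (by simp [dotProduct, Fin.sum_univ_four]; linarith)
        (by simp [dotProduct, Fin.sum_univ_four]; linarith)
        (by simp [dotProduct, Fin.sum_univ_four]; linarith)
        (by simp [dotProduct, Fin.sum_univ_four, k0, k1])
      have hy : y = 0 := by simpa using congrFun this 0
      have hx : x = 0 := by simpa using congrFun this 1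
      exact hd (by rw [hx, hy]; ring)
    refine mul_left_cancel₀ hC0 ?_
    linear_combination (d₂ * x + d₃ * y) * e3' - h' * (f₂ * x + f₃ * y) * e1'
      - h' * (g₂ * x + g₃ * y) * e2'
  by_contra hne
  have hpos : d₂ * d₂ + d₃ * d₃ ≠ 0 := fun h0 => hne <| by
    constructor <;> nlinarith [mul_self_nonneg d₂, mul_self_nonneg d₃]
  -- On this line of directions the left-hand side of `key` is constant in `s`. The second
  -- difference at `0, 1, -1` then kills the leading coefficient of the right-hand side.
  have hs (s : ℝ) := key (d₂ - s * d₃) (d₃ + s * d₂) (by ring_nf; ring_nf at hpos; exact hpos)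
  have s0 := hs 0
  have s1 := hs 1
  have s2 := hs (-1)
  have hsum : h' * ((f₃ * d₂ - f₂ * d₃) ^ 2 + (g₃ * d₂ - g₂ * d₃) ^ 2) = 0 := by
    linear_combination s0 - (s1 + s2) / 2
  have hsum' := (mul_eq_zero.1 hsum).resolve_left hh'
  have hf : f₃ * d₂ - f₂ * d₃ = 0 := by
    nlinarith [sq_nonneg (f₃ * d₂ - f₂ * d₃), sq_nonneg (g₃ * d₂ - g₂ * d₃)]
  have hg : g₃ * d₂ - g₂ * d₃ = 0 := by
    nlinarith [sq_nonneg (f₃ * d₂ - f₂ * d₃), sq_nonneg (g₃ * d₂ - g₂ * d₃)]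
  have hm : f₂ * g₃ - f₃ * g₂ = 0 := by
    refine (mul_eq_zero.1 (?_ : (d₂ * d₂ + d₃ * d₃) * _ = 0)).resolve_left hpos
    linear_combination (d₂ * f₂ + d₃ * f₃) * hg - (d₂ * g₂ + d₃ * g₃) * hf
  exact hdet (by linear_combination d₁ * hm - f₁ * hg + g₁ * hf)

/-- Once transport goes to transport, splitting determines the rows `α`, `β` up to the factor `η 2 /
d₁` from `f` and `g`. The coefficients of the mass equation then become orthogonality and equality
of lengths, and `h * d₁ ^ 2 = h' * (f₂ ^ 2 + g₂ ^ 2)` matches the gravity wave speeds. -/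
lemma conformal_of_jetPairing (hu : u ≠ 0) (hh : h ≠ 0) (hh' : h' ≠ 0)
    (hrow : ∀ w : Fin 4 → ℝ, α ⬝ᵥ w = 0 → β ⬝ᵥ w = 0 → η ⬝ᵥ w = 0 → κ ⬝ᵥ w = 0 → w = 0)
    (hdet : d₁ * (f₂ * g₃ - f₃ * g₂) ≠ 0) (hκ : κ 0 = 0 ∧ κ 1 = 0 ∧ κ 2 = 0)
    (H₁ : ∀ p q, jetPairing u v h α d₁ 0 0 p q + jetPairing u v h (η - κ) f₁ f₂ f₃ p q = 0)
    (H₂ : ∀ p q, jetPairing u v h β d₁ 0 0 p q + jetPairing u v h (η - κ) g₁ g₂ g₃ p q = 0)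
    (H₃ : ∀ p q, jetPairing u v h η d₁ 0 0 p q + h' * (jetPairing u v h α f₁ f₂ f₃ p q
      + jetPairing u v h β g₁ g₂ g₃ p q) = 0) :
    f₁ = 0 ∧ g₁ = 0 ∧ f₂ * f₃ + g₂ * g₃ = 0 ∧ f₂ ^ 2 + g₂ ^ 2 = f₃ ^ 2 + g₃ ^ 2 ∧
      h * d₁ ^ 2 = h' * (f₂ ^ 2 + g₂ ^ 2) ∧ η 2 = κ 3 := by
  obtain ⟨k0, k1, k2⟩ := hκ
  have hd : d₁ ≠ 0 := left_ne_zero_of_mul hdet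
  have hm : f₂ * g₃ - f₃ * g₂ ≠ 0 := right_ne_zero_of_mul hdet
  have a0 := H₁ ![1, 0, 0, 0] 0
  have a1 := H₁ ![0, 1, 0, 0] 0
  have a2 := H₁ ![0, 0, 1, 0] 0
  have a3 := H₁ ![0, 0, 0, 1] 0
  have a4 := H₁ 0 ![1, 0, 0, 0]
  have a6 := H₁ 0 ![0, 0, 1, 0]
  have a7 := H₁ 0 ![0, 0, 0, 1]
  have b0 := H₂ ![1, 0, 0, 0] 0
  have b1 := H₂ ![0, 1, 0, 0] 0
  have b2 := H₂ ![0, 0, 1, 0] 0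
  have b3 := H₂ ![0, 0, 0, 1] 0
  have b4 := H₂ 0 ![1, 0, 0, 0]
  have b6 := H₂ 0 ![0, 0, 1, 0]
  have b7 := H₂ 0 ![0, 0, 0, 1]
  have c0 := H₃ ![1, 0, 0, 0] 0
  have c1 := H₃ ![0, 1, 0, 0] 0
  have c2 := H₃ ![0, 0, 1, 0] 0
  have c3 := H₃ ![0, 0, 0, 1] 0
  have c5 := H₃ 0 ![0, 1, 0, 0]
  have c6 := H₃ 0 ![0, 0, 1, 0]
  simp [jetPairing, k0, k1, k2] at a0 a1 a2 a3 a4 a6 a7 b0 b1 b2 b3 b4 b6 b7 c0 c1 c2 c3 c5 c6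
  have e1 : η 1 = 0 := by
    by_contra hne
    have hf := a1.resolve_right hne
    have hg := b1.resolve_right hne
    exact hm (by rw [hf, hg]; ring)
  have e0 : η 0 = 0 := by
    by_contra hne
    have hf := a4.resolve_right hne
    have hg := b4.resolve_right hne
    exact hm (by rw [hf, hg]; ring)
  simp only [e0, e1, mul_zero, zero_add, add_zero, neg_zero] at a0 a2 a3 a6 a7 b0 b2 b3 b6 b7
  simp only [e0, e1, mul_zero, zero_add, neg_zero] at c0 c2 c3 c5 c6
  replace c1 := c1.resolve_left hh'
  have α2 : d₁ * α 2 = -(f₁ * η 2) := mul_left_cancel₀ hh (by linarith)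
  have β2 : d₁ * β 2 = -(g₁ * η 2) := mul_left_cancel₀ hh (by linarith)
  have α0 : d₁ * α 0 = f₂ * η 2 := by linarith
  have β0 : d₁ * β 0 = g₂ * η 2 := by linarith
  have α1 : d₁ * α 1 = f₃ * η 2 := by linarith
  have β1 : d₁ * β 1 = g₃ * η 2 := by linarith
  have η2 : η 2 ≠ 0 := by
    intro h0
    rw [h0, mul_zero] at α0 β0
    have ha := (mul_eq_zero.1 α0).resolve_left hd
    have hb := (mul_eq_zero.1 β0).resolve_left hd
    have := hrow ![1, 0, 0, 0] (by simp [dotProduct, Fin.sum_univ_four, ha])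
      (by simp [dotProduct, Fin.sum_univ_four, hb]) (by simp [dotProduct, Fin.sum_univ_four, e0])
      (by simp [dotProduct, Fin.sum_univ_four, k0])
    exact one_ne_zero (congrFun this 0)
  have s1 : f₁ * f₂ + g₁ * g₂ = 0 := by
    refine (mul_eq_zero.1 (?_ : (h' * η 2) * _ = 0)).resolve_left (mul_ne_zero hh' η2)
    linear_combination (-d₁ / 2) * c2 - h' / 2 * (f₁ * α0 + g₁ * β0 - f₂ * α2 - g₂ * β2)
  have s2 : f₁ * f₃ + g₁ * g₃ = 0 := by
    refine (mul_eq_zero.1 (?_ : (h' * η 2) * _ = 0)).resolve_left (mul_ne_zero hh' η2)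
    linear_combination (-d₁ / 2) * c6 - h' / 2 * (f₁ * α1 + g₁ * β1 - f₃ * α2 - g₃ * β2)
  have f10 : f₁ = 0 := by
    refine (mul_eq_zero.1 (?_ : (f₂ * g₃ - f₃ * g₂) * f₁ = 0)).resolve_left hm
    linear_combination g₃ * s1 - g₂ * s2
  have g10 : g₁ = 0 := by
    refine (mul_eq_zero.1 (?_ : (f₂ * g₃ - f₃ * g₂) * g₁ = 0)).resolve_left hm
    linear_combination f₂ * s2 - f₃ * s1
  subst f10 g10
  simp only [zero_mul, neg_zero, mul_eq_zero, hd, false_or] at α2 β2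
  -- Multiplied by this number, `(f₂, f₃)` and `(g₂, g₃)` both become multiples of `(u, v)`, while
  -- their determinant is nonzero.
  have m0 : η 2 + (η 3 - κ 3) = 0 := by
    have : (f₂ * g₃ - f₃ * g₂) * (η 2 + (η 3 - κ 3)) ^ 2 = 0 := by
      have x1 : f₂ * (η 2 + (η 3 - κ 3)) = -(u * (d₁ * α 3)) := by linear_combination a3 - α0
      have x2 : f₃ * (η 2 + (η 3 - κ 3)) = -(v * (d₁ * α 3)) := by linear_combination a7 - α1
      have x3 : g₂ * (η 2 + (η 3 - κ 3)) = -(u * (d₁ * β 3)) := by linear_combination b3 - β0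
      have x4 : g₃ * (η 2 + (η 3 - κ 3)) = -(v * (d₁ * β 3)) := by linear_combination b7 - β1
      calc _ = (f₂ * (η 2 + (η 3 - κ 3))) * (g₃ * (η 2 + (η 3 - κ 3)))
            - (f₃ * (η 2 + (η 3 - κ 3))) * (g₂ * (η 2 + (η 3 - κ 3))) := by ring
        _ = 0 := by rw [x1, x2, x3, x4]; ring
    exact pow_eq_zero_iff two_ne_zero |>.1 ((mul_eq_zero.1 this).resolve_left hm)
  have a30 : α 3 = 0 := by
    refine (mul_eq_zero.1 (?_ : (d₁ * u) * _ = 0)).resolve_left (mul_ne_zero hd hu)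
    linear_combination a3 - α0 - f₂ * m0
  have b30 : β 3 = 0 := by
    refine (mul_eq_zero.1 (?_ : (d₁ * u) * _ = 0)).resolve_left (mul_ne_zero hd hu)
    linear_combination b3 - β0 - g₂ * m0
  have e3 : η 3 = 0 := by
    refine (mul_eq_zero.1 (?_ : (d₁ * u) * _ = 0)).resolve_left (mul_ne_zero hd hu)
    rw [a30, b30] at c3
    linear_combination c3
  have c : h * d₁ ^ 2 = h' * (f₂ ^ 2 + g₂ ^ 2) := by
    refine mul_left_cancel₀ η2 ?_
    linear_combination -d₁ * c0 + h' * (f₂ * α0 + g₂ * β0) - d₁ * h' * h * (0 * α2)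
  have c' : h * d₁ ^ 2 = h' * (f₃ ^ 2 + g₃ ^ 2) := by
    refine mul_left_cancel₀ η2 ?_
    linear_combination -d₁ * c5 + h' * (f₃ * α1 + g₃ * β1)
  refine ⟨rfl, rfl, ?_, mul_left_cancel₀ hh' (c.symm.trans c'), c, by linarith⟩
  refine (mul_eq_zero.1 (?_ : η 2 * _ = 0)).resolve_left η2
  linear_combination d₁ * c1 - f₂ * α1 - g₂ * β1

end

/-- The matrix entries of a linear transformation of the space with the coordinates
`(t, x, y, u, v, h, b)`. -/
noncomputable def entry (T : Space →ₗ[ℝ] Space) (i j : Fin 7) : ℝ := coord i (T (basisVec j))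

/-- The first-order conditions on the differential of a point symmetry at a point. -/
structure Determining (T : Space →ₗ[ℝ] Space) (u v h u' v' h' : ℝ) : Prop where
  vertical : ∀ i j : Fin 7, i < 3 → 3 ≤ j → entry T i j = 0
  tx : entry T 0 1 = 0
  ty : entry T 0 2 = 0
  xt : entry T 1 0 = 0
  yt : entry T 2 0 = 0
  bt : entry T 6 0 = 0
  bu : entry T 6 3 = 0
  bv : entry T 6 4 = 0
  bh : entry T 6 5 = 0
  orthogonal : entry T 1 1 * entry T 1 2 + entry T 2 1 * entry T 2 2 = 0
  conformal : entry T 1 1 ^ 2 + entry T 2 1 ^ 2 = entry T 1 2 ^ 2 + entry T 2 2 ^ 2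
  velocity₁ : u' * entry T 0 0 = entry T 1 1 * u + entry T 1 2 * v
  velocity₂ : v' * entry T 0 0 = entry T 2 1 * u + entry T 2 2 * v
  depth : h' * entry T 0 0 ^ 2 = (entry T 1 1 ^ 2 + entry T 2 1 ^ 2) * h
  bottom : entry T 5 5 = entry T 6 6
  inertia₁ : (entry T 1 1 ^ 2 + entry T 2 1 ^ 2) * (entry T 3 0 + u * entry T 3 1 + v * entry T 3 2)
    + entry T 0 0 * (entry T 1 1 * (entry T 5 1 - entry T 6 1)
      + entry T 1 2 * (entry T 5 2 - entry T 6 2)) = 0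
  inertia₂ : (entry T 1 1 ^ 2 + entry T 2 1 ^ 2) * (entry T 4 0 + u * entry T 4 1 + v * entry T 4 2)
    + entry T 0 0 * (entry T 2 1 * (entry T 5 1 - entry T 6 1)
      + entry T 2 2 * (entry T 5 2 - entry T 6 2)) = 0

/-- The value on three combinations is a determinant times `f X Y Z`. This allows the basis of a jet
to be exchanged for the one lying over the new coordinate directions. -/
lemma alternating_on_span {f : Space →ₗ[ℝ] Space →ₗ[ℝ] Space →ₗ[ℝ] ℝ}
    (hf : ∀ x y, f x x y = 0 ∧ f x y y = 0 ∧ f x y x = 0) {X Y Z : Space} (h : f X Y Z = 0)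
    (a b c : Indep) :
    f (a 0 • X + a 1 • Y + a 2 • Z) (b 0 • X + b 1 • Y + b 2 • Z)
      (c 0 • X + c 1 • Y + c 2 • Z) = 0 := by
  have sw := alternating_swap hf
  have h1 : f X Z Y = 0 := by rw [(sw X Y Z).2, h, neg_zero]
  have h2 : f Y X Z = 0 := by rw [(sw X Y Z).1, h, neg_zero]
  have h3 : f Y Z X = 0 := by rw [(sw Y X Z).2, h2, neg_zero]
  have h4 : f Z X Y = 0 := by rw [(sw X Z Y).1, h1, neg_zero]
  have h5 : f Z Y X = 0 := by rw [(sw Y Z X).1, h3, neg_zero]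
  simp only [map_add, map_smul, LinearMap.add_apply, LinearMap.smul_apply, (hf _ _).1, (hf _ _).2.1,
    (hf _ _).2.2, h, h1, h2, h3, h4, h5, smul_zero, add_zero]

section

variable {T : Space →ₗ[ℝ] Space} {u v h u' v' h' : ℝ}

lemma coord_apply (T : Space →ₗ[ℝ] Space) (i : Fin 7) (z : Space) :
    coord i (T z) = ∑ j, entry T i j * coord j z := by
  conv_lhs => rw [← sum_coord z]
  simp [map_sum, entry, mul_comm]

/-- The equations for a jet that is transformed by a projectable transformation. -/
lemma form_of_preimages (hB : ∀ w, (T (0, w)).1 = 0)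
    (H : ∀ k p q, form u' v' h' k (T (Pi.single 0 1, timeDeriv u v h p q)) (T (Pi.single 1 1, p))
      (T (Pi.single 2 1, q)) = 0) {a f g : Indep} (ha : (T (a, 0)).1 = Pi.single 0 1)
    (hf : (T (f, 0)).1 = Pi.single 1 1) (hg : (T (g, 0)).1 = Pi.single 2 1) (p q : Fin 4 → ℝ) :
    let R (i : Fin 7) (ξ : Indep) : ℝ := coord i (T (ξ, 0))
      + jetPairing u v h ![entry T i 3, entry T i 4, entry T i 5, entry T i 6] (ξ 0)
        (ξ 1 - u * ξ 0) (ξ 2 - v * ξ 0) p q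
    R 3 a + u' * R 3 f + v' * R 3 g + R 5 f - R 6 f = 0 ∧
    R 4 a + u' * R 4 f + v' * R 4 g + R 5 g - R 6 g = 0 ∧
    R 5 a + u' * R 5 f + v' * R 5 g + h' * (R 3 f + R 4 g) = 0 ∧ R 6 a = 0 := by
  intro R
  set p' : Dep × ℝ := (![p 0, p 1, p 2], p 3) with hp
  set q' : Dep × ℝ := (![q 0, q 1, q 2], q 3) with hq
  set P := ofColumns (timeDeriv u v h p' q') p' q' with hP
  have e (ξ : Indep) : T (ξ, P ξ) = ξ 0 • T (Pi.single 0 1, timeDeriv u v h p' q')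
      + ξ 1 • T (Pi.single 1 1, p') + ξ 2 • T (Pi.single 2 1, q') := by
    simp only [← map_smul, ← map_add]
    congr 1
    refine Prod.ext (indep_eq_sum ξ) ?_
    rw [hP, ofColumns_apply]
    rfl
  have hR (ξ : Indep) (i : Fin 7) : coord i (T (ξ, P ξ)) = R i ξ := by
    have : ((ξ, P ξ) : Space) = (ξ, 0) + (0, P ξ) := by simp
    rw [this, map_add, map_add, coord_apply T i (0, P ξ)]
    simp only [R, jetPairing, add_right_inj]
    rw [Fin.sum_univ_seven, hP, ofColumns_apply]
    simp [timeDeriv, hp, hq]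
    ring
  have hX {ξ η : Indep} (h : (T (ξ, 0)).1 = η) : (T (ξ, P ξ)).1 = η := by
    have : ((ξ, P ξ) : Space) = (ξ, 0) + (0, P ξ) := by simp
    rw [this, map_add, Prod.fst_add, hB, h, add_zero]
  -- Over `a`, `f`, `g` the image vectors project to the new `∂_t`, `∂_x`, `∂_y`, so the values of
  -- the forms are the left-hand sides of the equations, with `R` the new derivatives.
  have hz (k : Fin 4) : form u' v' h' k (T (a, P a)) (T (f, P f)) (T (g, P g)) = 0 := by
    rw [e, e, e]
    exact alternating_on_span (form_alternating u' v' h' k) (H k p' q') a f g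
  have z0 := hz 0
  have z1 := hz 1
  have z2 := hz 2
  have z3 := hz 3
  simp only [form_zero, form_one, form_two, form_three, wedge_apply,
    ContinuousLinearMap.coe_coe, hR] at z0 z1 z2 z3
  have c0 : R 0 a = 1 ∧ R 1 a = 0 ∧ R 2 a = 0 := by
    refine ⟨?_, ?_, ?_⟩ <;> rw [← hR] <;> simp [hX ha]
  have c1 : R 0 f = 0 ∧ R 1 f = 1 ∧ R 2 f = 0 := by
    refine ⟨?_, ?_, ?_⟩ <;> rw [← hR] <;> simp [hX hf]
  have c2 : R 0 g = 0 ∧ R 1 g = 0 ∧ R 2 g = 1 := by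
    refine ⟨?_, ?_, ?_⟩ <;> rw [← hR] <;> simp [hX hg]
  obtain ⟨c00, c01, c02⟩ := c0
  obtain ⟨c10, c11, c12⟩ := c1
  obtain ⟨c20, c21, c22⟩ := c2
  rw [c00, c01, c02, c10, c11, c12, c20, c21, c22] at z0 z1 z2
  rw [c01, c02, c11, c12, c21, c22] at z3
  refine ⟨?_, ?_, ?_, ?_⟩ <;> linarith

/-- The algebra gives conditions on the inverse of the horizontal block, with columns `F`, `G`. By
conformality its spatial part is `σ` times the transpose of `J`, and this translates everything into
conditions on `J` and `τ` themselves. -/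
lemma determining_aux {τ a m n J₁₁ J₁₂ J₂₁ J₂₂ F₁ F₂ G₁ G₂ X₁ X₂ Y₁ Y₂ : ℝ}
    (hτ : τ * a = 1) (f₀ : m * F₁ + n * F₂ = 0) (g₀ : m * G₁ + n * G₂ = 0)
    (f₁ : J₁₁ * F₁ + J₁₂ * F₂ = 1) (f₂ : J₂₁ * F₁ + J₂₂ * F₂ = 0)
    (g₁ : J₁₁ * G₁ + J₁₂ * G₂ = 0) (g₂ : J₂₁ * G₁ + J₂₂ * G₂ = 1)
    (ho : F₁ * F₂ + G₁ * G₂ = 0) (hc : F₁ ^ 2 + G₁ ^ 2 = F₂ ^ 2 + G₂ ^ 2)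
    (d₁ : u' * F₁ + v' * G₁ - u * a = 0) (d₂ : u' * F₂ + v' * G₂ - v * a = 0)
    (hd : h * a ^ 2 = h' * (F₁ ^ 2 + G₁ ^ 2))
    (C₁ : X₁ * a + F₁ * Y₁ + F₂ * Y₂ = 0) (C₂ : X₂ * a + G₁ * Y₁ + G₂ * Y₂ = 0) :
    m = 0 ∧ n = 0 ∧ J₁₁ * J₁₂ + J₂₁ * J₂₂ = 0 ∧ J₁₁ ^ 2 + J₂₁ ^ 2 = J₁₂ ^ 2 + J₂₂ ^ 2 ∧
      u' * τ = J₁₁ * u + J₁₂ * v ∧ v' * τ = J₂₁ * u + J₂₂ * v ∧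
      h' * τ ^ 2 = (J₁₁ ^ 2 + J₂₁ ^ 2) * h ∧
      (J₁₁ ^ 2 + J₂₁ ^ 2) * X₁ + τ * (J₁₁ * Y₁ + J₁₂ * Y₂) = 0 ∧
      (J₁₁ ^ 2 + J₂₁ ^ 2) * X₂ + τ * (J₂₁ * Y₁ + J₂₂ * Y₂) = 0 := by
  have ha : a ≠ 0 := right_ne_zero_of_mul_eq_one hτ
  have hm : F₁ * G₂ - F₂ * G₁ ≠ 0 := by
    intro h0
    have : (J₁₁ * J₂₂ - J₁₂ * J₂₁) * (F₁ * G₂ - F₂ * G₁) = 1 := by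
      linear_combination (J₂₁ * G₁ + J₂₂ * G₂) * f₁ + g₂ - (J₁₁ * G₁ + J₁₂ * G₂) * f₂
    rw [h0, mul_zero] at this
    exact zero_ne_one this
  set σ := F₁ ^ 2 + G₁ ^ 2 with hσd
  have hσ : σ ≠ 0 := by
    intro h0
    rw [h0] at hc
    have x1 : F₁ = 0 := by nlinarith [sq_nonneg F₁, sq_nonneg G₁]
    have x2 : G₁ = 0 := by nlinarith [sq_nonneg F₁, sq_nonneg G₁]
    exact hm (by rw [x1, x2]; ring)
  have j₁₁ : J₁₁ * σ = F₁ := by linear_combination F₁ * f₁ + G₁ * g₁ - J₁₂ * ho + J₁₁ * hσd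
  have j₁₂ : J₁₂ * σ = F₂ := by linear_combination J₁₂ * hc + F₂ * f₁ + G₂ * g₁ - J₁₁ * ho
  have j₂₁ : J₂₁ * σ = G₁ := by linear_combination F₁ * f₂ + G₁ * g₂ - J₂₂ * ho + J₂₁ * hσd
  have j₂₂ : J₂₂ * σ = G₂ := by linear_combination J₂₂ * hc + F₂ * f₂ + G₂ * g₂ - J₂₁ * ho
  have hs : (J₁₁ ^ 2 + J₂₁ ^ 2) * σ = 1 := by
    refine mul_right_cancel₀ hσ ?_
    linear_combination (J₁₁ * σ + F₁) * j₁₁ + (J₂₁ * σ + G₁) * j₂₁ - hσd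
  refine ⟨?_, ?_, ?_, ?_, ?_, ?_, ?_, ?_, ?_⟩
  · refine (mul_eq_zero.1 (?_ : (F₁ * G₂ - F₂ * G₁) * _ = 0)).resolve_left hm
    linear_combination G₂ * f₀ - F₂ * g₀
  · refine (mul_eq_zero.1 (?_ : (F₁ * G₂ - F₂ * G₁) * _ = 0)).resolve_left hm
    linear_combination F₁ * g₀ - G₁ * f₀
  · refine (mul_eq_zero.1 (?_ : σ ^ 2 * _ = 0)).resolve_left (pow_ne_zero 2 hσ)
    calc _ = (J₁₁ * σ) * (J₁₂ * σ) + (J₂₁ * σ) * (J₂₂ * σ) := by ring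
      _ = 0 := by rw [j₁₁, j₁₂, j₂₁, j₂₂, ho]
  · refine mul_left_cancel₀ (pow_ne_zero 2 hσ) ?_
    calc _ = (J₁₁ * σ) ^ 2 + (J₂₁ * σ) ^ 2 := by ring
      _ = (J₁₂ * σ) ^ 2 + (J₂₂ * σ) ^ 2 := by rw [j₁₁, j₁₂, j₂₁, j₂₂, ← hσd, hc]
      _ = _ := by ring
  · refine mul_right_cancel₀ ha ?_
    linear_combination u' * hτ + J₁₁ * d₁ + J₁₂ * d₂ - u' * f₁ - v' * g₁
  · refine mul_right_cancel₀ ha ?_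
    linear_combination v' * hτ + J₂₁ * d₁ + J₂₂ * d₂ - u' * f₂ - v' * g₂
  · refine mul_right_cancel₀ (mul_ne_zero hσ (pow_ne_zero 2 ha)) ?_
    linear_combination (h' * σ) * (τ * a + 1) * hτ - h * a ^ 2 * hs - hd
  · refine (mul_eq_zero.1 (?_ : (σ * a) * _ = 0)).resolve_left (mul_ne_zero hσ ha)
    linear_combination C₁ + a * X₁ * hs + (Y₁ * j₁₁ + Y₂ * j₁₂)
      + σ * (J₁₁ * Y₁ + J₁₂ * Y₂) * hτ
  · refine (mul_eq_zero.1 (?_ : (σ * a) * _ = 0)).resolve_left (mul_ne_zero hσ ha)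
    linear_combination C₂ + a * X₂ * hs + (Y₁ * j₂₁ + Y₂ * j₂₂)
      + σ * (J₂₁ * Y₁ + J₂₂ * Y₂) * hτ

lemma determining_of_form (hT : Function.Bijective T) (hB : ∀ w, (T (0, w)).1 = 0)
    (hu : u ≠ 0) (hh : h ≠ 0) (hh' : h' ≠ 0)
    (H : ∀ k p q, form u' v' h' k (T (Pi.single 0 1, timeDeriv u v h p q)) (T (Pi.single 1 1, p))
      (T (Pi.single 2 1, q)) = 0) :
    Determining T u v h u' v' h' := by
  have hv : ∀ i j : Fin 7, i < 3 → 3 ≤ j → entry T i j = 0 := by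
    intro i j hi hj
    obtain ⟨w, hw⟩ : ∃ w, basisVec j = (0, w) := by
      fin_cases j
      all_goals first | (exact absurd hj (by decide)) | exact ⟨_, rfl⟩
    have := hB w
    fin_cases i
    all_goals first | (exact absurd hi (by decide)) | simp [entry, hw, this]
  have hs (η : Indep) : ∃ ξ : Indep, (T (ξ, 0)).1 = η := by
    obtain ⟨⟨ξ, w⟩, e⟩ := hT.2 (η, 0)
    refine ⟨ξ, ?_⟩
    have : ((ξ, w) : Space) = (ξ, 0) + (0, w) := by simp
    rw [this, map_add] at e
    simpa [hB] using congrArg Prod.fst e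
  obtain ⟨a, ha⟩ := hs (Pi.single 0 1)
  obtain ⟨f, hf⟩ := hs (Pi.single 1 1)
  obtain ⟨g, hg⟩ := hs (Pi.single 2 1)
  have E := form_of_preimages hB H ha hf hg
  simp only at E
  -- The part free of `p` and `q` later yields `bt` and the `inertia` equations; its removal leaves
  -- the linear parts, to which the splitting lemmas apply.
  have E0 := E 0 0
  have jz (k : Fin 4 → ℝ) (a b c : ℝ) : jetPairing u v h k a b c 0 0 = 0 := by simp [jetPairing]
  simp only [jz, add_zero] at E0
  obtain ⟨C1, C2, C3, C4⟩ := E0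
  -- the linear independence of the preimages
  have en (i : Fin 7) (ξ : Indep) : coord i (T (ξ, 0)) =
      entry T i 0 * ξ 0 + entry T i 1 * ξ 1 + entry T i 2 * ξ 2 := by
    rw [coord_apply, Fin.sum_univ_seven]
    simp
  have ea (i : Fin 7) := en i a
  have ef (i : Fin 7) := en i f
  have eg (i : Fin 7) := en i g
  have a0 := ea 0
  have a1 := ea 1
  have a2 := ea 2
  have f0 := ef 0
  have f1 := ef 1
  have f2 := ef 2
  have g0 := eg 0
  have g1 := eg 1
  have g2 := eg 2
  simp only [coord_zero, coord_one, coord_two, ha, hf, hg] at a0 a1 a2 f0 f1 f2 g0 g1 g2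
  simp at a0 a1 a2 f0 f1 f2 g0 g1 g2
  have hdet : a 0 * (f 1 * g 2 - f 2 * g 1) - a 1 * (f 0 * g 2 - f 2 * g 0)
      + a 2 * (f 0 * g 1 - f 1 * g 0) ≠ 0 := by
    let M : Matrix (Fin 3) (Fin 3) ℝ := !![entry T 0 0, entry T 0 1, entry T 0 2;
      entry T 1 0, entry T 1 1, entry T 1 2; entry T 2 0, entry T 2 1, entry T 2 2]
    let N : Matrix (Fin 3) (Fin 3) ℝ := !![a 0, f 0, g 0; a 1, f 1, g 1; a 2, f 2, g 2]
    have hMN : M * N = 1 := by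
      ext i j
      fin_cases i <;> fin_cases j <;> simp [M, N, Matrix.mul_apply, Fin.sum_univ_three] <;> linarith
    have hd := congrArg Matrix.det hMN
    rw [Matrix.det_mul, Matrix.det_one] at hd
    have hN : N.det ≠ 0 := right_ne_zero_of_mul_eq_one hd
    simp only [Matrix.det_fin_three, N] at hN
    simp at hN
    contrapose! hN
    linarith
  set α : Fin 4 → ℝ := ![entry T 3 3, entry T 3 4, entry T 3 5, entry T 3 6] with hα
  set β : Fin 4 → ℝ := ![entry T 4 3, entry T 4 4, entry T 4 5, entry T 4 6] with hβ
  set η : Fin 4 → ℝ := ![entry T 5 3, entry T 5 4, entry T 5 5, entry T 5 6] with hη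
  set κ : Fin 4 → ℝ := ![entry T 6 3, entry T 6 4, entry T 6 5, entry T 6 6] with hκ
  have hrow : ∀ w : Fin 4 → ℝ, α ⬝ᵥ w = 0 → β ⬝ᵥ w = 0 → η ⬝ᵥ w = 0 → κ ⬝ᵥ w = 0 → w = 0 := by
    intro w h1 h2 h3 h4
    have : T (0, (![w 0, w 1, w 2], w 3)) = T 0 := by
      rw [map_zero]
      refine ext_coord fun i => ?_
      rw [coord_apply, Fin.sum_univ_seven]
      fin_cases i
      · simp [hv 0]
      · simp [hv 1]
      · simp [hv 2]
      all_goals simp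
      · simpa [hα, dotProduct, Fin.sum_univ_four] using h1
      · simpa [hβ, dotProduct, Fin.sum_univ_four] using h2
      · simpa [hη, dotProduct, Fin.sum_univ_four] using h3
      · simpa [hκ, dotProduct, Fin.sum_univ_four] using h4
    have hw := (Prod.ext_iff.1 (hT.1 this)).2
    have hw1 := (Prod.ext_iff.1 hw).1
    have hw2 : w 3 = 0 := (Prod.ext_iff.1 hw).2
    have e0 : w 0 = 0 := congrFun hw1 0
    have e1 : w 1 = 0 := congrFun hw1 1
    have e2 : w 2 = 0 := congrFun hw1 2
    ext i
    fin_cases i <;> assumption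
  have hκ0 : κ ≠ 0 := by
    intro h0
    obtain ⟨⟨ξ, w⟩, e⟩ := hT.2 (basisVec 6)
    have hinj : Function.Injective
        (LinearMap.fst ℝ Indep (Dep × ℝ) ∘ₗ T ∘ₗ LinearMap.inl ℝ Indep (Dep × ℝ)) :=
      LinearMap.injective_iff_surjective.2 hs
    have e' : ((ξ, w) : Space) = (ξ, 0) + (0, w) := by simp
    have hξ : ξ = 0 := by
      apply hinj
      rw [map_zero]
      change (T (ξ, 0)).1 = 0
      rw [e', map_add] at e
      have := congrArg Prod.fst e
      rw [Prod.fst_add, hB, add_zero] at this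
      rw [this]
      rfl
    subst hξ
    have := congrArg (coord 6) e
    rw [coord_apply, Fin.sum_univ_seven] at this
    have h3 := congrFun h0 0
    have h4 := congrFun h0 1
    have h5 := congrFun h0 2
    have h6 := congrFun h0 3
    simp [hκ] at h3 h4 h5 h6
    simp [h3, h4, h5, h6, basisVec] at this
  obtain ⟨k0, k1, k2, a1', a2'⟩ := bottom_row_of_jetPairing hh hκ0
    (a₁ := a 0) (a₂ := a 1 - u * a 0) (a₃ := a 2 - v * a 0) (u := u) (v := v)
    (by
      rintro ⟨h0, h1, h2⟩
      rw [h0] at h1 h2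
      apply hdet
      rw [h0, show a 1 = 0 by linarith, show a 2 = 0 by linarith]
      ring)
    (fun p q => by linarith [(E p q).2.2.2])
  replace a1' : a 1 = 0 := by linarith
  replace a2' : a 2 = 0 := by linarith
  -- The combination `a + u' f + v' g` is the preimage of the new transport direction; subtracting
  -- `u` and `v` times its time component gives its components relative to the old flow.
  have H₁ : ∀ p q, jetPairing u v h α (a 0 + u' * f 0 + v' * g 0)
      ((u' * f 1 + v' * g 1) - u * (a 0 + u' * f 0 + v' * g 0))
      ((u' * f 2 + v' * g 2) - v * (a 0 + u' * f 0 + v' * g 0)) p q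
      + jetPairing u v h (η - κ) (f 0) (f 1 - u * f 0) (f 2 - v * f 0) p q = 0 := fun p q => by
    have := (E p q).1
    simp only [jetPairing, Pi.sub_apply] at this ⊢
    rw [a1', a2'] at this
    linear_combination this - C1
  have H₂ : ∀ p q, jetPairing u v h β (a 0 + u' * f 0 + v' * g 0)
      ((u' * f 1 + v' * g 1) - u * (a 0 + u' * f 0 + v' * g 0))
      ((u' * f 2 + v' * g 2) - v * (a 0 + u' * f 0 + v' * g 0)) p q
      + jetPairing u v h (η - κ) (g 0) (g 1 - u * g 0) (g 2 - v * g 0) p q = 0 := fun p q => by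
    have := (E p q).2.1
    simp only [jetPairing, Pi.sub_apply] at this ⊢
    rw [a1', a2'] at this
    linear_combination this - C2
  have H₃ : ∀ p q, jetPairing u v h η (a 0 + u' * f 0 + v' * g 0)
      ((u' * f 1 + v' * g 1) - u * (a 0 + u' * f 0 + v' * g 0))
      ((u' * f 2 + v' * g 2) - v * (a 0 + u' * f 0 + v' * g 0)) p q
      + h' * (jetPairing u v h α (f 0) (f 1 - u * f 0) (f 2 - v * f 0) p q
        + jetPairing u v h β (g 0) (g 1 - u * g 0) (g 2 - v * g 0) p q) = 0 := fun p q => by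
    have := (E p q).2.2.1
    simp only [jetPairing] at this ⊢
    rw [a1', a2'] at this
    linear_combination this - C3
  have hdet' : a 0 * (f 1 * g 2 - f 2 * g 1) ≠ 0 := by
    rw [a1', a2'] at hdet
    simpa using hdet
  obtain ⟨d2, d3⟩ := velocity_of_jetPairing hh' hrow (by
    contrapose! hdet'
    linear_combination hdet') ⟨k0, k1, k2⟩ H₁ H₂ H₃
  rw [d2, d3] at H₁ H₂ H₃
  have hd1 : (a 0 + u' * f 0 + v' * g 0) * ((f 1 - u * f 0) * (g 2 - v * g 0)
      - (f 2 - v * f 0) * (g 1 - u * g 0)) ≠ 0 := by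
    contrapose! hdet'
    linear_combination hdet' - (f 0 * (g 2 - v * g 0) - (f 2 - v * f 0) * g 0) * d2
      + (f 0 * (g 1 - u * g 0) - (f 1 - u * f 0) * g 0) * d3
  obtain ⟨f00, g00, hfg, hfg', hd, hηκ⟩ :=
    conformal_of_jetPairing hu hh hh' hrow hd1 ⟨k0, k1, k2⟩ H₁ H₂ H₃
  rw [f00, g00] at hfg hfg' hd d2 d3
  simp only [f00, g00, a1', a2', mul_zero, add_zero, zero_add] at a0 a1 a2 f0 f1 f2 g0
  simp only [g00, mul_zero, add_zero, zero_add, sub_zero] at g1 g2 d2 d3 hfg hfg' hd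
  simp only [ea, ef, eg, f00, g00, a1', a2', mul_zero, add_zero, zero_add] at C1 C2 C4
  have ha0 : a 0 ≠ 0 := left_ne_zero_of_mul hdet'
  obtain ⟨r₁, r₂, r₃, r₄, r₅, r₆, r₇, r₈, r₉⟩ := determining_aux
    (X₁ := entry T 3 0 + u * entry T 3 1 + v * entry T 3 2)
    (X₂ := entry T 4 0 + u * entry T 4 1 + v * entry T 4 2)
    (Y₁ := entry T 5 1 - entry T 6 1) (Y₂ := entry T 5 2 - entry T 6 2)
    a0.symm f0.symm g0.symm f1.symm f2.symm g1.symm g2.symm hfg hfg' d2 d3 hd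
    (by linear_combination C1 - entry T 3 1 * d2 - entry T 3 2 * d3)
    (by linear_combination C2 - entry T 4 1 * d2 - entry T 4 2 * d3)
  exact ⟨hv, r₁, r₂, (mul_eq_zero.1 a1.symm).resolve_right ha0,
    (mul_eq_zero.1 a2.symm).resolve_right ha0, (mul_eq_zero.1 C4).resolve_right ha0,
    k0, k1, k2, r₃, r₄, r₅, r₆, r₇, hηκ, r₈, r₉⟩

end

/-! ### From prolongations to the determining equations -/

lemma exists_polynomial_form (f : Space →ₗ[ℝ] Space →ₗ[ℝ] Space →ₗ[ℝ] ℝ)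
    (X Y Z X' Y' Z' : Space) :
    ∃ P : Polynomial ℝ, ∀ s : ℝ, P.eval s = f (X + s • X') (Y + s • Y') (Z + s • Z') := by
  refine ⟨.C (f X Y Z) + .X * .C (f X' Y Z + f X Y' Z + f X Y Z')
    + .X ^ 2 * .C (f X' Y' Z + f X' Y Z' + f X Y' Z') + .X ^ 3 * .C (f X' Y' Z'), fun s => ?_⟩
  simp
  ring

/-- The trilinear form on the jet of the extended system at `z` with the `x`- and `y`-derivatives
`p`, `q` after the application of a linear map. -/
noncomputable def onJet (f : Space →ₗ[ℝ] Space →ₗ[ℝ] Space →ₗ[ℝ] ℝ) (T : Space →ₗ[ℝ] Space)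
    (z : Space) (p q : Dep × ℝ) : ℝ :=
  f (T (Pi.single 0 1, timeDeriv (z.2.1 0) (z.2.1 1) (z.2.1 2) p q)) (T (Pi.single 1 1, p))
    (T (Pi.single 2 1, q))

lemma timeDeriv_line (u v h : ℝ) (p q p' q' : Dep × ℝ) (s : ℝ) :
    timeDeriv u v h (p + s • p') (q + s • q') = timeDeriv u v h p q + s • timeDeriv u v h p' q' := by
  refine Prod.ext (funext fun i => ?_) ?_
  · fin_cases i <;> simp [timeDeriv] <;> ring
  · simp [timeDeriv]

lemma exists_polynomial_onJet (f : Space →ₗ[ℝ] Space →ₗ[ℝ] Space →ₗ[ℝ] ℝ) (T : Space →ₗ[ℝ] Space)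
    (z : Space) (p q p' q' : Dep × ℝ) :
    ∃ P : Polynomial ℝ, ∀ s : ℝ, P.eval s = onJet f T z (p + s • p') (q + s • q') := by
  have e (η : Indep) (w w' : Dep × ℝ) (s : ℝ) :
      T (η, w + s • w') = T (η, w) + s • T (0, w') := by
    rw [← map_smul, ← map_add]
    simp
  obtain ⟨P, hP⟩ := exists_polynomial_form f
    (T (Pi.single 0 1, timeDeriv (z.2.1 0) (z.2.1 1) (z.2.1 2) p q)) (T (Pi.single 1 1, p))
    (T (Pi.single 2 1, q)) (T (0, timeDeriv (z.2.1 0) (z.2.1 1) (z.2.1 2) p' q'))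
    (T (0, p')) (T (0, q'))
  refine ⟨P, fun s => ?_⟩
  rw [hP, onJet, timeDeriv_line, e, e, e]

/-- If the product of two trilinear forms vanishes on all jets and the first form does not vanish on
one of them, then the second form vanishes on all jets. -/
lemma onJet_eq_zero_of_mul {f g : Space →ₗ[ℝ] Space →ₗ[ℝ] Space →ₗ[ℝ] ℝ} {T : Space →ₗ[ℝ] Space}
    {z : Space} (h : ∀ p q, onJet f T z p q * onJet g T z p q = 0) {p₀ q₀ : Dep × ℝ}
    (h₀ : onJet f T z p₀ q₀ ≠ 0) (p q : Dep × ℝ) : onJet g T z p q = 0 := by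
  obtain ⟨P, hP⟩ := exists_polynomial_onJet f T z p₀ q₀ (p - p₀) (q - q₀)
  obtain ⟨Q, hQ⟩ := exists_polynomial_onJet g T z p₀ q₀ (p - p₀) (q - q₀)
  have hPQ : P * Q = 0 := Polynomial.funext fun s => by
    rw [Polynomial.eval_mul, hP, hQ, h, Polynomial.eval_zero]
  have hP0 : P ≠ 0 := fun h0 => h₀ <| by
    have := hP 0
    simpa [h0] using this.symm
  have := hQ 1
  rw [(mul_eq_zero.1 hPQ).resolve_left hP0] at this
  simpa using this.symm

/-- The forms of the equations at the point `z`. -/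
noncomputable abbrev formAt (z : Space) (k : Fin 4) : Space →ₗ[ℝ] Space →ₗ[ℝ] Space →ₗ[ℝ] ℝ :=
  form (z.2.1 0) (z.2.1 1) (z.2.1 2) k

/-- The common consequence of the definitions of point symmetries of the extended system and of
generalized equivalence transformations: the prolongation is generically defined and sends jets of
the extended system to jets of the extended system. -/
structure PreservesJets (Φ : Space → Space) (U : Set Space) : Prop where
  mul_form : ∀ z ∈ U, ∀ (p q : Dep × ℝ) (k : Fin 4),
    onJet vol (fderiv ℝ Φ z) z p q * onJet (formAt (Φ z) k) (fderiv ℝ Φ z) z p q = 0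
  generic : ∀ V ⊆ U, IsOpen V → V.Nonempty →
    ∃ z ∈ V, ∃ p q, onJet vol (fderiv ℝ Φ z) z p q ≠ 0

lemma eq_zero_of_dense {E : Type*} [TopologicalSpace E] {U : Set E} (hU : IsOpen U) {F : E → ℝ}
    (hF : ContinuousOn F U) (h : ∀ V ⊆ U, IsOpen V → V.Nonempty → ∃ z ∈ V, F z = 0) :
    ∀ z ∈ U, F z = 0 := by
  intro z hz
  by_contra h0
  obtain ⟨w, hw, e⟩ := h (U ∩ F ⁻¹' {0}ᶜ) Set.inter_subset_left
    (hF.isOpen_inter_preimage hU isOpen_compl_singleton) ⟨z, hz, h0⟩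
  exact hw.2 e

/-! ### Passage from generic points to all points -/

section

variable {Φ : Space → Space} {U : Set Space}

lemma IsPointTransformation.differentiableAt (h : IsPointTransformation Φ U) {z : Space}
    (hz : z ∈ U) : DifferentiableAt ℝ Φ z :=
  (h.smooth.contDiffAt (h.isOpen.mem_nhds hz)).differentiableAt (by simp)

lemma IsPointTransformation.contDiffOn_fderiv (h : IsPointTransformation Φ U) :
    ContDiffOn ℝ ∞ (fderiv ℝ Φ) U :=
  h.smooth.fderiv_of_isOpen h.isOpen (by simp)

lemma continuousOn_wedge {a b c : Space →L[ℝ] ℝ} {X Y Z : Space → Space} (hX : ContinuousOn X U)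
    (hY : ContinuousOn Y U) (hZ : ContinuousOn Z U) :
    ContinuousOn (fun z => wedge (a : Space →ₗ[ℝ] ℝ) b c (X z) (Y z) (Z z)) U := by
  simp only [wedge_apply, ContinuousLinearMap.coe_coe]
  fun_prop

lemma continuousOn_form {X Y Z : Space → Space} {u v h : Space → ℝ} (hX : ContinuousOn X U)
    (hY : ContinuousOn Y U) (hZ : ContinuousOn Z U) (hu : ContinuousOn u U) (hv : ContinuousOn v U)
    (hh : ContinuousOn h U) (k : Fin 4) :
    ContinuousOn (fun z => form (u z) (v z) (h z) k (X z) (Y z) (Z z)) U := by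
  have hw (a b c : Space →L[ℝ] ℝ) := continuousOn_wedge (a := a) (b := b) (c := c) hX hY hZ
  fin_cases k
  · simp only [Fin.zero_eta, form_zero]
    exact ((((hw _ _ _).add (hu.mul (hw _ _ _))).add (hv.mul (hw _ _ _))).add (hw _ _ _)).sub
      (hw _ _ _)
  · simp only [Fin.mk_one, form_one]
    exact ((((hw _ _ _).add (hu.mul (hw _ _ _))).add (hv.mul (hw _ _ _))).add (hw _ _ _)).sub
      (hw _ _ _)
  · simp only [Fin.reduceFinMk, form_two]
    exact ((((hw _ _ _).add (hu.mul (hw _ _ _))).add (hv.mul (hw _ _ _))).add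
      (hh.mul (hw _ _ _))).add (hh.mul (hw _ _ _))
  · simp only [Fin.reduceFinMk, form_three]
    exact hw _ _ _

lemma continuous_timeDeriv (p q : Dep × ℝ) :
    Continuous fun z : Space => timeDeriv (z.2.1 0) (z.2.1 1) (z.2.1 2) p q := by
  refine Continuous.prodMk (continuous_pi fun i => ?_) continuous_const
  fin_cases i <;> simp <;> fun_prop

lemma IsPointTransformation.continuousOn_jet (h : IsPointTransformation Φ U) (p q : Dep × ℝ) :
    ContinuousOn (fun z => fderiv ℝ Φ z (Pi.single 0 1, timeDeriv (z.2.1 0) (z.2.1 1) (z.2.1 2) p q))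
      U :=
  h.contDiffOn_fderiv.continuousOn.clm_apply
    (continuous_const.prodMk (continuous_timeDeriv p q)).continuousOn

lemma IsPointTransformation.continuousOn_vol (h : IsPointTransformation Φ U) (p q : Dep × ℝ) :
    ContinuousOn (fun z => onJet vol (fderiv ℝ Φ z) z p q) U :=
  continuousOn_wedge (h.continuousOn_jet p q)
    (h.contDiffOn_fderiv.continuousOn.clm_apply continuousOn_const)
    (h.contDiffOn_fderiv.continuousOn.clm_apply continuousOn_const)

lemma IsPointTransformation.continuousOn_form (h : IsPointTransformation Φ U) (p q : Dep × ℝ)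
    (k : Fin 4) : ContinuousOn (fun z => onJet (formAt (Φ z) k) (fderiv ℝ Φ z) z p q) U := by
  have hΦ := h.smooth.continuousOn
  exact ShallowWater.continuousOn_form (h.continuousOn_jet p q)
    (h.contDiffOn_fderiv.continuousOn.clm_apply continuousOn_const)
    (h.contDiffOn_fderiv.continuousOn.clm_apply continuousOn_const)
    (u := fun z => (Φ z).2.1 0) (v := fun z => (Φ z).2.1 1) (h := fun z => (Φ z).2.1 2)
    (by fun_prop) (by fun_prop) (by fun_prop) k

/-- At a point with one jet of nonzero `vol`, the product condition forces the form to vanish on the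
whole fibre. Such points are dense, and for fixed `p`, `q` the value of the form is continuous in
`z`. -/
lemma PreservesJets.form_eq_zero (hΦ : IsPointTransformation Φ U) (h : PreservesJets Φ U)
    (p q : Dep × ℝ) (k : Fin 4) :
    ∀ z ∈ U, onJet (formAt (Φ z) k) (fderiv ℝ Φ z) z p q = 0 := by
  refine eq_zero_of_dense hΦ.isOpen (hΦ.continuousOn_form p q k) fun V hV hVo hVn => ?_
  obtain ⟨z, hz, p₀, q₀, h₀⟩ := h.generic V hV hVo hVn
  exact ⟨z, hz, onJet_eq_zero_of_mul (fun p q => h.mul_form z (hV hz) p q k) h₀ p q⟩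

/-- A function vanishing on all of `V` would have zero derivative there. -/
lemma exists_open_ne_zero {V : Set Space} (hV : IsOpen V) (hn : V.Nonempty) {φ : Space → ℝ}
    (hφ : ContinuousOn φ V) (h : ∀ z ∈ V, fderiv ℝ φ z ≠ 0) :
    ∃ V' ⊆ V, IsOpen V' ∧ V'.Nonempty ∧ ∀ z ∈ V', φ z ≠ 0 := by
  refine ⟨V ∩ φ ⁻¹' {0}ᶜ, Set.inter_subset_left,
    hφ.isOpen_inter_preimage hV isOpen_compl_singleton, ?_, fun z hz => hz.2⟩
  by_contra hne
  rw [Set.not_nonempty_iff_eq_empty] at hne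
  obtain ⟨z, hz⟩ := hn
  refine h z hz ?_
  have : φ =ᶠ[nhds z] fun _ => 0 := by
    filter_upwards [hV.mem_nhds hz] with w hw
    by_contra h0
    exact Set.notMem_empty w (hne ▸ ⟨hw, h0⟩)
  rw [this.fderiv_eq]
  simp

/-- Each of the four functions has nonzero differential, the last because the differential of `Φ` is
surjective, so their zero sets can be avoided one after another. -/
lemma IsPointTransformation.exists_generic (hΦ : IsPointTransformation Φ U) {V : Set Space}
    (hVU : V ⊆ U) (hV : IsOpen V) (hn : V.Nonempty) :
    ∃ z ∈ V, z.2.1 0 ≠ 0 ∧ z.2.1 1 ≠ 0 ∧ z.2.1 2 ≠ 0 ∧ (Φ z).2.1 2 ≠ 0 := by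
  have hc (i : Fin 7) (z : Space) : fderiv ℝ (coord i) z ≠ 0 := fun h0 => by
    have := congrArg (fun l : Space →L[ℝ] ℝ => l (basisVec i)) h0
    rw [ContinuousLinearMap.fderiv] at this
    simp [coord_basisVec] at this
  obtain ⟨V₁, s₁, o₁, n₁, e₁⟩ := exists_open_ne_zero hV hn (coord 3).continuous.continuousOn
    fun z _ => hc 3 z
  obtain ⟨V₂, s₂, o₂, n₂, e₂⟩ := exists_open_ne_zero o₁ n₁ (coord 4).continuous.continuousOn
    fun z _ => hc 4 z
  obtain ⟨V₃, s₃, o₃, n₃, e₃⟩ := exists_open_ne_zero o₂ n₂ (coord 5).continuous.continuousOn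
    fun z _ => hc 5 z
  have s : V₃ ⊆ U := s₃.trans (s₂.trans (s₁.trans hVU))
  obtain ⟨V₄, s₄, o₄, ⟨z, hz⟩, e₄⟩ := exists_open_ne_zero o₃ n₃ (φ := coord 5 ∘ Φ)
    ((coord 5).continuous.comp_continuousOn (hΦ.smooth.continuousOn.mono s)) fun z hz h0 => by
      obtain ⟨X, hX⟩ := (hΦ.regular z (s hz)).2 (basisVec 5)
      have := congrArg (fun l : Space →L[ℝ] ℝ => l X) h0
      rw [((coord 5).hasFDerivAt.comp z (hΦ.differentiableAt (s hz)).hasFDerivAt).fderiv] at this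
      simp [hX, basisVec] at this
  have hz₃ := s₄ hz
  have hz₂ := s₃ hz₃
  have hz₁ := s₂ hz₂
  exact ⟨z, s₁ hz₁, e₁ z hz₁, e₂ z hz₂, e₃ z hz₃, e₄ z hz⟩

lemma PreservesJets.determining_of_generic (hΦ : IsPointTransformation Φ U)
    (h : PreservesJets Φ U) {z : Space} (hz : z ∈ U) (hu : z.2.1 0 ≠ 0) (hv : z.2.1 1 ≠ 0)
    (hh : z.2.1 2 ≠ 0) (hh' : (Φ z).2.1 2 ≠ 0) :
    Determining (fderiv ℝ Φ z : Space →ₗ[ℝ] Space) (z.2.1 0) (z.2.1 1) (z.2.1 2) ((Φ z).2.1 0)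
      ((Φ z).2.1 1) ((Φ z).2.1 2) := by
  set T : Space →ₗ[ℝ] Space := (fderiv ℝ Φ z : Space →ₗ[ℝ] Space) with hT
  have hbij : Function.Bijective T := hΦ.regular z hz
  have H (k : Fin 4) (p q : Dep × ℝ) := h.form_eq_zero hΦ p q k z hz
  refine determining_of_form hbij (map_vertical_of_form (u := (Φ z).2.1 0)
    (v := (Φ z).2.1 1) hh' hbij fun k w w' X => ?_) hu hh hh' H
  -- The pullback of the `k`th form at `Φ z` under `T`.
  let f : Space →ₗ[ℝ] Space →ₗ[ℝ] Space →ₗ[ℝ] ℝ :=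
    ((formAt (Φ z) k).compl₁₂ T T).compr₂ (LinearMap.lcomp ℝ ℝ T)
  exact form_vertical_vertical (f := f) (fun x y => form_alternating _ _ _ k (T x) (T y))
    (fun p q => H k p q) hu hv hh w w' X

lemma IsPointTransformation.continuousOn_entry (hΦ : IsPointTransformation Φ U) (i j : Fin 7) :
    ContinuousOn (fun z => entry (fderiv ℝ Φ z) i j) U :=
  (coord i).continuous.comp_continuousOn
    (hΦ.contDiffOn_fderiv.continuousOn.clm_apply continuousOn_const)

/-- The determining equations hold everywhere. -/
lemma PreservesJets.determining (hΦ : IsPointTransformation Φ U) (h : PreservesJets Φ U) {z : Space}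
    (hz : z ∈ U) :
    Determining (fderiv ℝ Φ z : Space →ₗ[ℝ] Space) (z.2.1 0) (z.2.1 1) (z.2.1 2) ((Φ z).2.1 0)
      ((Φ z).2.1 1) ((Φ z).2.1 2) := by
  have hc := hΦ.continuousOn_entry
  have hΦc := hΦ.smooth.continuousOn
  -- Every field of `Determining` is an equality of continuous functions of the point, so it extends
  -- from the dense set of generic points.
  have key {F G : Space → ℝ} (hF : ContinuousOn F U) (hG : ContinuousOn G U)
      (e : ∀ z, Determining (fderiv ℝ Φ z : Space →ₗ[ℝ] Space) (z.2.1 0) (z.2.1 1) (z.2.1 2)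
        ((Φ z).2.1 0) ((Φ z).2.1 1) ((Φ z).2.1 2) → F z = G z) : F z = G z := by
    refine sub_eq_zero.1 (eq_zero_of_dense hΦ.isOpen (hF.sub hG) (fun V hV hVo hVn => ?_) z hz)
    obtain ⟨w, hw, h₁, h₂, h₃, h₄⟩ := hΦ.exists_generic hV hVo hVn
    exact ⟨w, hw, sub_eq_zero.2 (e w (h.determining_of_generic hΦ (hV hw) h₁ h₂ h₃ h₄))⟩
  constructor
  · exact fun i j hi hj => key (hc i j) continuousOn_const fun w hw => hw.vertical i j hi hj
  · exact key (hc _ _) continuousOn_const fun w hw => hw.tx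
  · exact key (hc _ _) continuousOn_const fun w hw => hw.ty
  · exact key (hc _ _) continuousOn_const fun w hw => hw.xt
  · exact key (hc _ _) continuousOn_const fun w hw => hw.yt
  · exact key (hc _ _) continuousOn_const fun w hw => hw.bt
  · exact key (hc _ _) continuousOn_const fun w hw => hw.bu
  · exact key (hc _ _) continuousOn_const fun w hw => hw.bv
  · exact key (hc _ _) continuousOn_const fun w hw => hw.bh
  · exact key (by fun_prop) (by fun_prop) fun w hw => hw.orthogonal
  · exact key (by fun_prop) (by fun_prop) fun w hw => hw.conformal
  · exact key (by fun_prop) (by fun_prop) fun w hw => hw.velocity₁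
  · exact key (by fun_prop) (by fun_prop) fun w hw => hw.velocity₂
  · exact key (by fun_prop) (by fun_prop) fun w hw => hw.depth
  · exact key (by fun_prop) (by fun_prop) fun w hw => hw.bottom
  · exact key (by fun_prop) (by fun_prop) fun w hw => hw.inertia₁
  · exact key (by fun_prop) (by fun_prop) fun w hw => hw.inertia₂

end

/-! ### Integration of the determining equations -/

/-- `F` is invariant under one and the same short shift `s • w` at all points near `z`, so the shift
preserves the differential of `F` at `z` as well. -/
lemma eventually_const_of_fderiv_eq_zero {E : Type*} [NormedAddCommGroup E] [NormedSpace ℝ E]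
    {U : Set E} (hU : IsOpen U) {F : E → ℝ} (hF : DifferentiableOn ℝ F U) {w : E}
    (h : ∀ z ∈ U, fderiv ℝ F z w = 0) {z : E} (hz : z ∈ U) :
    ∀ᶠ s in nhds (0 : ℝ), z + s • w ∈ U ∧ F (z + s • w) = F z ∧
      fderiv ℝ F (z + s • w) = fderiv ℝ F z := by
  obtain ⟨r, hr, hrU⟩ := Metric.isOpen_iff.1 hU z hz
  have hw : 0 < ‖w‖ + 1 := by positivity
  have hδ : 0 < r / 2 / (‖w‖ + 1) := by positivity
  have hmem {y : E} (hy : y ∈ Metric.ball z (r / 2)) {s : ℝ}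
      (hs : s ∈ Metric.ball (0 : ℝ) (r / 2 / (‖w‖ + 1))) : y + s • w ∈ U := by
    apply hrU
    rw [mem_ball_zero_iff, Real.norm_eq_abs, lt_div_iff₀ hw] at hs
    rw [mem_ball_iff_norm] at hy ⊢
    calc ‖y + s • w - z‖ = ‖(y - z) + s • w‖ := by congr 1; abel
      _ ≤ ‖y - z‖ + ‖s • w‖ := norm_add_le _ _
      _ = ‖y - z‖ + |s| * ‖w‖ := by rw [norm_smul, Real.norm_eq_abs]
      _ < r := by nlinarith [abs_nonneg s, norm_nonneg w]
  have hconst {y : E} (hy : y ∈ Metric.ball z (r / 2)) {s : ℝ}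
      (hs : s ∈ Metric.ball (0 : ℝ) (r / 2 / (‖w‖ + 1))) : F (y + s • w) = F y := by
    have hd : ∀ t ∈ Metric.ball (0 : ℝ) (r / 2 / (‖w‖ + 1)),
        HasDerivAt (fun t : ℝ => F (y + t • w)) 0 t := fun t ht => by
      have h1 := (hF.differentiableAt (hU.mem_nhds (hmem hy ht))).hasFDerivAt
      have h2 : HasDerivAt (fun t : ℝ => y + t • w) w t := by
        simpa using ((hasDerivAt_id t).smul_const w).const_add y
      have := h1.comp_hasDerivAt t h2
      rwa [h _ (hmem hy ht)] at this
    have := Metric.isOpen_ball.is_const_of_deriv_eq_zero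
      (convex_ball (0 : ℝ) (r / 2 / (‖w‖ + 1))).isPreconnected
      (fun t ht => (hd t ht).differentiableAt.differentiableWithinAt)
      (fun t ht => (hd t ht).deriv) hs (Metric.mem_ball_self hδ)
    simpa using this
  have hz' := Metric.mem_ball_self (x := z) (half_pos hr)
  filter_upwards [Metric.ball_mem_nhds (0 : ℝ) hδ] with s hs
  refine ⟨hmem hz' hs, hconst hz' hs, ?_⟩
  rw [← fderiv_comp_add_right]
  refine Filter.EventuallyEq.fderiv_eq ?_
  filter_upwards [Metric.ball_mem_nhds z (half_pos hr)] with y hy using hconst hy hs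

lemma quadratic_eq_zero {A B C : ℝ} (h : ∀ᶠ s in nhds (0 : ℝ), A * s ^ 2 + B * s + C = 0) :
    A = 0 ∧ B = 0 := by
  obtain ⟨r, hr, h⟩ := Metric.eventually_nhds_iff.1 h
  have hr' : |r| = r := abs_of_pos hr
  have h0 := h (y := 0) (by simpa using hr)
  have h1 := h (y := r / 2) (by rw [dist_zero_right, Real.norm_eq_abs, abs_div, hr']; simp; linarith)
  have h2 := h (y := -(r / 2))
    (by rw [dist_zero_right, Real.norm_eq_abs, abs_neg, abs_div, hr']; simp; linarith)
  constructor
  · refine (mul_eq_zero.1 (?_ : (r ^ 2) * A = 0)).resolve_left (by positivity)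
    linarith
  · refine (mul_eq_zero.1 (?_ : r * B = 0)).resolve_left hr.ne'
    linarith

section

variable {Φ : Space → Space} {U : Set Space}

/-- The partial derivatives of the components of `Φ`. -/
noncomputable def partialDeriv (Φ : Space → Space) (i j : Fin 7) (z : Space) : ℝ :=
  entry (fderiv ℝ Φ z) i j

/-- The second partial derivatives of the components of `Φ`. -/
noncomputable def partialDeriv₂ (Φ : Space → Space) (i j k : Fin 7) (z : Space) : ℝ :=
  fderiv ℝ (partialDeriv Φ i j) z (basisVec k)

lemma IsPointTransformation.hasFDerivAt_coord (hΦ : IsPointTransformation Φ U) (i : Fin 7)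
    {z : Space} (hz : z ∈ U) :
    HasFDerivAt (fun z => coord i (Φ z)) ((coord i).comp (fderiv ℝ Φ z)) z :=
  (coord i).hasFDerivAt.comp z (hΦ.differentiableAt hz).hasFDerivAt

lemma IsPointTransformation.hasFDerivAt_fderiv (hΦ : IsPointTransformation Φ U)
    {z : Space} (hz : z ∈ U) :
    HasFDerivAt (fderiv ℝ Φ) (fderiv ℝ (fderiv ℝ Φ) z) z :=
  ((hΦ.contDiffOn_fderiv.contDiffAt (hΦ.isOpen.mem_nhds hz)).differentiableAt (by simp)).hasFDerivAt

lemma IsPointTransformation.hasFDerivAt_partialDeriv' (hΦ : IsPointTransformation Φ U)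
    (i j : Fin 7) {z : Space} (hz : z ∈ U) :
    HasFDerivAt (partialDeriv Φ i j)
      ((coord i).comp ((fderiv ℝ (fderiv ℝ Φ) z).flip (basisVec j))) z :=
  (coord i).hasFDerivAt.comp z ((hΦ.hasFDerivAt_fderiv hz).clm_apply
    (hasFDerivAt_const (basisVec j) z) |>.congr_fderiv (by ext <;> simp))

lemma IsPointTransformation.hasFDerivAt_partialDeriv (hΦ : IsPointTransformation Φ U)
    (i j : Fin 7) {z : Space} (hz : z ∈ U) :
    HasFDerivAt (partialDeriv Φ i j) (fderiv ℝ (partialDeriv Φ i j) z) z :=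
  (hΦ.hasFDerivAt_partialDeriv' i j hz).differentiableAt.hasFDerivAt

lemma IsPointTransformation.partialDeriv₂_comm (hΦ : IsPointTransformation Φ U) (i j k : Fin 7)
    {z : Space} (hz : z ∈ U) : partialDeriv₂ Φ i j k z = partialDeriv₂ Φ i k j z := by
  rw [partialDeriv₂, partialDeriv₂, (hΦ.hasFDerivAt_partialDeriv' i j hz).fderiv,
    (hΦ.hasFDerivAt_partialDeriv' i k hz).fderiv]
  have := (hΦ.smooth.contDiffAt (hΦ.isOpen.mem_nhds hz)).isSymmSndFDerivAt
    (by rw [minSmoothness_of_isRCLikeNormedField]; exact WithTop.coe_le_coe.2 le_top)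
  simp only [ContinuousLinearMap.comp_apply, ContinuousLinearMap.flip_apply]
  rw [this]

lemma IsPointTransformation.partialDeriv₂_eq_zero (hΦ : IsPointTransformation Φ U) {i j : Fin 7}
    (h : ∀ z ∈ U, partialDeriv Φ i j z = 0) (k : Fin 7) {z : Space} (hz : z ∈ U) :
    partialDeriv₂ Φ i j k z = 0 := by
  have : partialDeriv Φ i j =ᶠ[nhds z] fun _ => 0 := by
    filter_upwards [hΦ.isOpen.mem_nhds hz] with w hw using h w hw
  rw [partialDeriv₂, this.fderiv_eq]
  simp

lemma fderiv_eq_zero_of_basis {F : Space → ℝ} {z : Space}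
    (h : ∀ k, fderiv ℝ F z (basisVec k) = 0) : fderiv ℝ F z = 0 := by
  refine ContinuousLinearMap.ext fun w => ?_
  rw [← sum_coord w, map_sum]
  simp [h]

/-- Equality of the derivatives of functions that coincide on an open set. -/
lemma fderiv_apply_eq {F G : Space → ℝ} {F' G' : Space →L[ℝ] ℝ} (hU : IsOpen U) {z : Space}
    (hz : z ∈ U) (h : ∀ w ∈ U, F w = G w) (hF : HasFDerivAt F F' z) (hG : HasFDerivAt G G' z)
    (w : Space) : F' w = G' w := by
  have : F =ᶠ[nhds z] G := by filter_upwards [hU.mem_nhds hz] with w hw using h w hw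
  rw [hF.unique (hG.congr_of_eventuallyEq this)]

end

/-- The determining equations on `U`. -/
def DeterminingOn (Φ : Space → Space) (U : Set Space) : Prop :=
  ∀ z ∈ U, Determining (fderiv ℝ Φ z : Space →ₗ[ℝ] Space) (z.2.1 0) (z.2.1 1) (z.2.1 2)
    ((Φ z).2.1 0) ((Φ z).2.1 1) ((Φ z).2.1 2)

/-! ### Derivatives of the determining equations -/

section

variable {Φ : Space → Space} {U : Set Space}

local notation "∂" => partialDeriv Φ
local notation "∂²" => partialDeriv₂ Φ

lemma DeterminingOn.partialDeriv_eq_zero (hD : DeterminingOn Φ U) {z : Space} (hz : z ∈ U) :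
    (∀ j, j ≠ 0 → ∂ 0 j z = 0) ∧ (∀ j, j ≠ 1 → j ≠ 2 → ∂ 1 j z = 0) ∧
      (∀ j, j ≠ 1 → j ≠ 2 → ∂ 2 j z = 0) ∧ (∀ j, j ≠ 1 → j ≠ 2 → j ≠ 6 → ∂ 6 j z = 0) := by
  have h := hD z hz
  refine ⟨fun j h0 => ?_, fun j h1 h2 => ?_, fun j h1 h2 => ?_, fun j h1 h2 h6 => ?_⟩
  · by_cases h3 : 3 ≤ j
    · exact h.vertical _ _ (by decide) h3
    · fin_cases j
      exacts [absurd rfl h0, h.tx, h.ty, absurd (by decide) h3, absurd (by decide) h3,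
        absurd (by decide) h3, absurd (by decide) h3]
  · by_cases h3 : 3 ≤ j
    · exact h.vertical _ _ (by decide) h3
    · fin_cases j
      exacts [h.xt, absurd rfl h1, absurd rfl h2, absurd (by decide) h3, absurd (by decide) h3,
        absurd (by decide) h3, absurd (by decide) h3]
  · by_cases h3 : 3 ≤ j
    · exact h.vertical _ _ (by decide) h3
    · fin_cases j
      exacts [h.yt, absurd rfl h1, absurd rfl h2, absurd (by decide) h3, absurd (by decide) h3,
        absurd (by decide) h3, absurd (by decide) h3]
  · fin_cases j
    exacts [h.bt, absurd rfl h1, absurd rfl h2, h.bu, h.bv, h.bh, absurd rfl h6]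

/-- The second derivatives that vanish. -/
lemma DeterminingOn.partialDeriv₂_eq_zero (hD : DeterminingOn Φ U) (hΦ : IsPointTransformation Φ U)
    {z : Space} (hz : z ∈ U) :
    (∀ k, k ≠ 0 → ∂² 0 0 k z = 0) ∧ (∀ j k, k ≠ 1 → k ≠ 2 → ∂² 1 j k z = 0) ∧
      (∀ j k, k ≠ 1 → k ≠ 2 → ∂² 2 j k z = 0) ∧ (∀ j k, k ≠ 1 → k ≠ 2 → k ≠ 6 → ∂² 6 j k z = 0) := by
  refine ⟨fun k h0 => ?_, fun j k h1 h2 => ?_, fun j k h1 h2 => ?_, fun j k h1 h2 h6 => ?_⟩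
  · rw [hΦ.partialDeriv₂_comm _ _ _ hz]
    exact hΦ.partialDeriv₂_eq_zero (fun w hw => (hD.partialDeriv_eq_zero hw).1 k h0) _ hz
  · rw [hΦ.partialDeriv₂_comm _ _ _ hz]
    exact hΦ.partialDeriv₂_eq_zero (fun w hw => (hD.partialDeriv_eq_zero hw).2.1 k h1 h2) _ hz
  · rw [hΦ.partialDeriv₂_comm _ _ _ hz]
    exact hΦ.partialDeriv₂_eq_zero (fun w hw => (hD.partialDeriv_eq_zero hw).2.2.1 k h1 h2) _ hz
  · rw [hΦ.partialDeriv₂_comm _ _ _ hz]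
    exact hΦ.partialDeriv₂_eq_zero
      (fun w hw => (hD.partialDeriv_eq_zero hw).2.2.2 k h1 h2 h6) _ hz

lemma IsPointTransformation.exists_partialDeriv_ne_zero (hΦ : IsPointTransformation Φ U) {z : Space}
    (hz : z ∈ U) (i : Fin 7) : ∃ j, ∂ i j z ≠ 0 := by
  by_contra! h
  obtain ⟨X, hX⟩ := (hΦ.regular z hz).2 (basisVec i)
  have e := congrArg (coord i) hX
  have := coord_apply (fderiv ℝ Φ z : Space →ₗ[ℝ] Space) i X
  rw [ContinuousLinearMap.coe_coe, e, coord_basisVec] at this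
  simp [partialDeriv] at h
  simp [h] at this

lemma DeterminingOn.ne_zero (hD : DeterminingOn Φ U) (hΦ : IsPointTransformation Φ U)
    {z : Space} (hz : z ∈ U) : ∂ 0 0 z ≠ 0 ∧ ∂ 1 1 z ^ 2 + ∂ 2 1 z ^ 2 ≠ 0 := by
  obtain ⟨p0, p1, -, -⟩ := hD.partialDeriv_eq_zero hz
  constructor
  · obtain ⟨j, hj⟩ := hΦ.exists_partialDeriv_ne_zero hz 0
    by_cases h0 : j = 0
    · rwa [h0] at hj
    · exact absurd (p0 j h0) hj
  · intro hs
    obtain ⟨j, hj⟩ := hΦ.exists_partialDeriv_ne_zero hz 1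
    have hc : ∂ 1 1 z ^ 2 + ∂ 2 1 z ^ 2 = ∂ 1 2 z ^ 2 + ∂ 2 2 z ^ 2 := (hD z hz).conformal
    by_cases h1 : j = 1
    · subst h1
      exact hj (by nlinarith [sq_nonneg (∂ 1 1 z), sq_nonneg (∂ 2 1 z)])
    by_cases h2 : j = 2
    · subst h2
      exact hj (by nlinarith [sq_nonneg (∂ 1 2 z), sq_nonneg (∂ 2 2 z)])
    exact hj (p1 j h1 h2)

/-- The derivatives of the expressions for the velocity and the depth. -/
lemma DeterminingOn.derivatives (hD : DeterminingOn Φ U) (hΦ : IsPointTransformation Φ U)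
    {z : Space} (hz : z ∈ U) :
    (∀ k : Fin 7, k < 3 → (Φ z).2.1 0 * ∂² 0 0 k z + ∂ 0 0 z * ∂ 3 k z =
      z.2.1 0 * ∂² 1 1 k z + z.2.1 1 * ∂² 1 2 k z) ∧
    (∀ k : Fin 7, k < 3 → (Φ z).2.1 1 * ∂² 0 0 k z + ∂ 0 0 z * ∂ 4 k z =
      z.2.1 0 * ∂² 2 1 k z + z.2.1 1 * ∂² 2 2 k z) ∧
    (∀ k : Fin 7, (Φ z).2.1 2 * (2 * ∂ 0 0 z * ∂² 0 0 k z) + ∂ 0 0 z ^ 2 * ∂ 5 k z =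
      (∂ 1 1 z ^ 2 + ∂ 2 1 z ^ 2) * (if k = 5 then 1 else 0)
        + z.2.1 2 * (2 * ∂ 1 1 z * ∂² 1 1 k z + 2 * ∂ 2 1 z * ∂² 2 1 k z)) := by
  have hm (i j : Fin 7) := hΦ.hasFDerivAt_partialDeriv i j hz
  have hφ (i : Fin 7) := hΦ.hasFDerivAt_coord i hz
  have hc (i : Fin 7) := (coord i).hasFDerivAt (x := z)
  have b (i j : Fin 7) : coord i (basisVec j) = if i = j then 1 else 0 := coord_basisVec i j
  refine ⟨fun k hk => ?_, fun k hk => ?_, fun k => ?_⟩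
  · have := fderiv_apply_eq hΦ.isOpen hz (fun w hw => (hD w hw).velocity₁) ((hφ 3).mul (hm 0 0))
      (((hm 1 1).mul (hc 3)).add ((hm 1 2).mul (hc 4))) (basisVec k)
    simp only [add_apply, smul_apply, smul_eq_mul,
      ContinuousLinearMap.comp_apply, b] at this
    rw [if_neg (by rintro rfl; exact absurd hk (by decide)),
      if_neg (by rintro rfl; exact absurd hk (by decide))] at this
    simpa [partialDeriv₂, partialDeriv, entry] using this
  · have := fderiv_apply_eq hΦ.isOpen hz (fun w hw => (hD w hw).velocity₂) ((hφ 4).mul (hm 0 0))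
      (((hm 2 1).mul (hc 3)).add ((hm 2 2).mul (hc 4))) (basisVec k)
    simp only [add_apply, smul_apply, smul_eq_mul,
      ContinuousLinearMap.comp_apply, b] at this
    rw [if_neg (by rintro rfl; exact absurd hk (by decide)),
      if_neg (by rintro rfl; exact absurd hk (by decide))] at this
    simpa [partialDeriv₂, partialDeriv, entry] using this
  · have := fderiv_apply_eq hΦ.isOpen hz (fun w hw => (hD w hw).depth) ((hφ 5).mul ((hm 0 0).pow 2))
      ((((hm 1 1).pow 2).add ((hm 2 1).pow 2)).mul (hc 5)) (basisVec k)
    simp only [add_apply, smul_apply, smul_eq_mul,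
      ContinuousLinearMap.comp_apply, b, eq_comm (a := (5 : Fin 7)), nsmul_eq_mul] at this
    simp only [Nat.cast_ofNat, Nat.add_one_sub_one, pow_one] at this
    exact this

/-- The listed first derivatives have zero derivative along `u` and `v`, because the second
derivatives commute. Hence they and their differentials stay constant when `u` or `v` is shifted,
which permits splitting with respect to these variables. -/
lemma eventually_add_smul (hD : DeterminingOn Φ U) (hΦ : IsPointTransformation Φ U) {z : Space}
    (hz : z ∈ U) {l : Fin 7} (hl : l = 3 ∨ l = 4) {i j : Fin 7}
    (hij : (i = 0 ∧ j = 0) ∨ i = 1 ∨ i = 2 ∨ i = 6) :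
    ∀ᶠ s in nhds (0 : ℝ), ∂ i j (z + s • basisVec l) = ∂ i j z ∧
      ∀ k, ∂² i j k (z + s • basisVec l) = ∂² i j k z := by
  have h0 : ∀ z ∈ U, fderiv ℝ (∂ i j) z (basisVec l) = 0 := fun z hz => by
    obtain ⟨p0, p1, p2, p6⟩ := hD.partialDeriv₂_eq_zero hΦ hz
    rcases hij with ⟨rfl, rfl⟩ | rfl | rfl | rfl <;> rcases hl with rfl | rfl
    · exact p0 _ (by decide)
    · exact p0 _ (by decide)
    · exact p1 _ _ (by decide) (by decide)
    · exact p1 _ _ (by decide) (by decide)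
    · exact p2 _ _ (by decide) (by decide)
    · exact p2 _ _ (by decide) (by decide)
    · exact p6 _ _ (by decide) (by decide) (by decide)
    · exact p6 _ _ (by decide) (by decide) (by decide)
  have hd : DifferentiableOn ℝ (∂ i j) U := fun w hw =>
    (hΦ.hasFDerivAt_partialDeriv i j hw).differentiableAt.differentiableWithinAt
  filter_upwards [eventually_const_of_fderiv_eq_zero hΦ.isOpen hd h0 hz] with s hs
  refine ⟨hs.2.1, fun k => ?_⟩
  rw [partialDeriv₂, partialDeriv₂, hs.2.2]

end

/-! ### The classifying equations and their splitting -/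

section

variable {Φ : Space → Space} {U : Set Space}

local notation "∂" => partialDeriv Φ
local notation "∂²" => partialDeriv₂ Φ

/-- The left-hand side of the classifying equations, polynomial in the velocity and the depth. -/
def classifying (τ τ' s a b a₁ a₂ b₂ r₁ r₂ m₁ m₂ u v h : ℝ) : ℝ :=
  s * (-(a * u + b * v) * τ' + τ * (u ^ 2 * a₁ + 2 * u * v * a₂ + v ^ 2 * b₂))
    + τ * (a * (r₁ * h - τ ^ 2 * m₁) + b * (r₂ * h - τ ^ 2 * m₂))

/-- The classifying equations, for the components `x` and `y` of the transformation. -/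
lemma DeterminingOn.classifying_eq_zero (hD : DeterminingOn Φ U) (hΦ : IsPointTransformation Φ U)
    {i : Fin 7} (hi : i = 1 ∨ i = 2) {z : Space} (hz : z ∈ U) :
    classifying (∂ 0 0 z) (∂² 0 0 0 z) (∂ 1 1 z ^ 2 + ∂ 2 1 z ^ 2) (∂ i 1 z) (∂ i 2 z)
      (∂² i 1 1 z) (∂² i 1 2 z) (∂² i 2 2 z)
      (2 * ∂ 1 1 z * ∂² 1 1 1 z + 2 * ∂ 2 1 z * ∂² 2 1 1 z)
      (2 * ∂ 1 1 z * ∂² 1 1 2 z + 2 * ∂ 2 1 z * ∂² 2 1 2 z) (∂ 6 1 z) (∂ 6 2 z)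
      (z.2.1 0) (z.2.1 1) (z.2.1 2) = 0 := by
  obtain ⟨q0, q1, q2, -⟩ := hD.partialDeriv₂_eq_zero hΦ hz
  obtain ⟨du, dv, dh⟩ := hD.derivatives hΦ hz
  have h1 := dh 1
  have h2 := dh 2
  rw [q0 1 (by decide), if_neg (by decide)] at h1
  rw [q0 2 (by decide), if_neg (by decide)] at h2
  rcases hi with rfl | rfl
  · have e0 := du 0 (by decide)
    have e1 := du 1 (by decide)
    have e2 := du 2 (by decide)
    rw [q1 1 0 (by decide) (by decide), q1 2 0 (by decide) (by decide)] at e0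
    rw [q0 1 (by decide), hΦ.partialDeriv₂_comm 1 2 1 hz] at e1
    rw [q0 2 (by decide)] at e2
    have hI : (∂ 1 1 z ^ 2 + ∂ 2 1 z ^ 2) * (∂ 3 0 z + z.2.1 0 * ∂ 3 1 z + z.2.1 1 * ∂ 3 2 z)
      + ∂ 0 0 z * (∂ 1 1 z * (∂ 5 1 z - ∂ 6 1 z) + ∂ 1 2 z * (∂ 5 2 z - ∂ 6 2 z)) = 0 :=
      (hD z hz).inertia₁
    have hv : (Φ z).2.1 0 * ∂ 0 0 z = ∂ 1 1 z * z.2.1 0 + ∂ 1 2 z * z.2.1 1 := (hD z hz).velocity₁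
    rw [classifying]
    -- The factor `∂ 0 0 z ^ 2` clears denominators: the differentiated velocity and depth relations
    -- then eliminate the derivatives of the new velocity and depth from the inertia equation.
    linear_combination ∂ 0 0 z ^ 2 * hI
      - (∂ 1 1 z ^ 2 + ∂ 2 1 z ^ 2) * ∂ 0 0 z * (e0 + z.2.1 0 * e1 + z.2.1 1 * e2)
      - ∂ 0 0 z * (∂ 1 1 z * h1 + ∂ 1 2 z * h2)
      + (∂ 1 1 z ^ 2 + ∂ 2 1 z ^ 2) * ∂² 0 0 0 z * hv
  · have e0 := dv 0 (by decide)
    have e1 := dv 1 (by decide)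
    have e2 := dv 2 (by decide)
    rw [q2 1 0 (by decide) (by decide), q2 2 0 (by decide) (by decide)] at e0
    rw [q0 1 (by decide), hΦ.partialDeriv₂_comm 2 2 1 hz] at e1
    rw [q0 2 (by decide)] at e2
    have hI : (∂ 1 1 z ^ 2 + ∂ 2 1 z ^ 2) * (∂ 4 0 z + z.2.1 0 * ∂ 4 1 z + z.2.1 1 * ∂ 4 2 z)
      + ∂ 0 0 z * (∂ 2 1 z * (∂ 5 1 z - ∂ 6 1 z) + ∂ 2 2 z * (∂ 5 2 z - ∂ 6 2 z)) = 0 :=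
      (hD z hz).inertia₂
    have hv : (Φ z).2.1 1 * ∂ 0 0 z = ∂ 2 1 z * z.2.1 0 + ∂ 2 2 z * z.2.1 1 := (hD z hz).velocity₂
    rw [classifying]
    linear_combination ∂ 0 0 z ^ 2 * hI
      - (∂ 1 1 z ^ 2 + ∂ 2 1 z ^ 2) * ∂ 0 0 z * (e0 + z.2.1 0 * e1 + z.2.1 1 * e2)
      - ∂ 0 0 z * (∂ 2 1 z * h1 + ∂ 2 2 z * h2)
      + (∂ 1 1 z ^ 2 + ∂ 2 1 z ^ 2) * ∂² 0 0 0 z * hv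

/-- The classifying equations hold along the coordinate lines of `u` and `v`. -/
lemma DeterminingOn.classifying_line (hD : DeterminingOn Φ U) (hΦ : IsPointTransformation Φ U)
    {i : Fin 7} (hi : i = 1 ∨ i = 2) {l : Fin 7} (hl : l = 3 ∨ l = 4) {z : Space} (hz : z ∈ U) :
    ∀ᶠ s in nhds (0 : ℝ),
    classifying (∂ 0 0 z) (∂² 0 0 0 z) (∂ 1 1 z ^ 2 + ∂ 2 1 z ^ 2) (∂ i 1 z) (∂ i 2 z)
      (∂² i 1 1 z) (∂² i 1 2 z) (∂² i 2 2 z)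
      (2 * ∂ 1 1 z * ∂² 1 1 1 z + 2 * ∂ 2 1 z * ∂² 2 1 1 z)
      (2 * ∂ 1 1 z * ∂² 1 1 2 z + 2 * ∂ 2 1 z * ∂² 2 1 2 z) (∂ 6 1 z) (∂ 6 2 z)
      ((z + s • basisVec l).2.1 0) ((z + s • basisVec l).2.1 1) ((z + s • basisVec l).2.1 2) = 0 := by
  have hi' : (i = 0 ∧ (1 : Fin 7) = 0) ∨ i = 1 ∨ i = 2 ∨ i = 6 := by tauto
  have hi'' : (i = 0 ∧ (2 : Fin 7) = 0) ∨ i = 1 ∨ i = 2 ∨ i = 6 := by tauto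
  have hU : ∀ᶠ s in nhds (0 : ℝ), z + s • basisVec l ∈ U := by
    have : Continuous fun s : ℝ => z + s • basisVec l := by fun_prop
    exact this.continuousAt.eventually (hΦ.isOpen.mem_nhds (by simpa using hz))
  filter_upwards [hU, eventually_add_smul hD hΦ hz hl (i := 0) (j := 0) (by tauto),
    eventually_add_smul hD hΦ hz hl (i := 1) (j := 1) (by tauto),
    eventually_add_smul hD hΦ hz hl (i := 2) (j := 1) (by tauto),
    eventually_add_smul hD hΦ hz hl (i := 6) (j := 1) (by tauto),
    eventually_add_smul hD hΦ hz hl (i := 6) (j := 2) (by tauto),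
    eventually_add_smul hD hΦ hz hl hi', eventually_add_smul hD hΦ hz hl hi'']
    with s hs h00 h11 h21 h61 h62 hi1 hi2
  have := hD.classifying_eq_zero hΦ hi hs
  rwa [h00.1, h00.2, h11.1, h11.2, h11.2, h21.1, h21.2, h21.2, h61.1, h62.1, hi1.1, hi1.2, hi1.2,
    hi2.1, hi2.2] at this

/-- `classifying` is quadratic in the velocity. Its `u ^ 2` and `v ^ 2` coefficients give the pure
second derivatives; the coefficient linear in `u` is in turn affine in `v`, which separates the
mixed derivative from the second time derivative. -/
lemma DeterminingOn.second_derivatives_eq_zero (hD : DeterminingOn Φ U)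
    (hΦ : IsPointTransformation Φ U) {i : Fin 7} (hi : i = 1 ∨ i = 2) {z : Space} (hz : z ∈ U) :
    ∂² i 1 1 z = 0 ∧ ∂² i 1 2 z = 0 ∧ ∂² i 2 2 z = 0 ∧ ∂ i 1 z * ∂² 0 0 0 z = 0 ∧
      ∂ i 2 z * ∂² 0 0 0 z = 0 := by
  have quad {l : Fin 7} (hl : l = 3 ∨ l = 4) {w : Space} (hw : w ∈ U) :
      (if l = 3 then ∂² i 1 1 w else ∂² i 2 2 w) = 0 ∧
      (if l = 3 then -∂ i 1 w * ∂² 0 0 0 w + ∂ 0 0 w * (2 * w.2.1 0 * ∂² i 1 1 w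
          + 2 * w.2.1 1 * ∂² i 1 2 w)
        else -∂ i 2 w * ∂² 0 0 0 w + ∂ 0 0 w * (2 * w.2.1 1 * ∂² i 2 2 w
          + 2 * w.2.1 0 * ∂² i 1 2 w)) = 0 := by
    obtain ⟨n0, n1⟩ := hD.ne_zero hΦ hw
    have hline := hD.classifying_line hΦ hi hl hw
    have h0 := hD.classifying_eq_zero hΦ hi hw
    rcases hl with rfl | rfl
    · obtain ⟨hA, hB⟩ := quadratic_eq_zero
        (A := (∂ 1 1 w ^ 2 + ∂ 2 1 w ^ 2) * (∂ 0 0 w * ∂² i 1 1 w))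
        (B := (∂ 1 1 w ^ 2 + ∂ 2 1 w ^ 2) * (-∂ i 1 w * ∂² 0 0 0 w + ∂ 0 0 w *
          (2 * w.2.1 0 * ∂² i 1 1 w + 2 * w.2.1 1 * ∂² i 1 2 w))) (C := 0) (by
          filter_upwards [hline] with s hs
          simp [classifying, basisVec] at hs h0
          linear_combination hs - h0)
      simp only [if_true]
      exact ⟨(mul_eq_zero.1 ((mul_eq_zero.1 hA).resolve_left n1)).resolve_left n0,
        (mul_eq_zero.1 hB).resolve_left n1⟩
    · obtain ⟨hA, hB⟩ := quadratic_eq_zero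
        (A := (∂ 1 1 w ^ 2 + ∂ 2 1 w ^ 2) * (∂ 0 0 w * ∂² i 2 2 w))
        (B := (∂ 1 1 w ^ 2 + ∂ 2 1 w ^ 2) * (-∂ i 2 w * ∂² 0 0 0 w + ∂ 0 0 w *
          (2 * w.2.1 1 * ∂² i 2 2 w + 2 * w.2.1 0 * ∂² i 1 2 w))) (C := 0) (by
          filter_upwards [hline] with s hs
          simp [classifying, basisVec] at hs h0
          linear_combination hs - h0)
      rw [if_neg (by decide), if_neg (by decide)]
      exact ⟨(mul_eq_zero.1 ((mul_eq_zero.1 hA).resolve_left n1)).resolve_left n0,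
        (mul_eq_zero.1 hB).resolve_left n1⟩
  have q3 {w : Space} (hw : w ∈ U) := quad (Or.inl rfl) hw
  have q4 {w : Space} (hw : w ∈ U) := quad (Or.inr rfl) hw
  simp only [if_true] at q3
  simp only [show (4 : Fin 7) = 3 ↔ False by decide, if_false] at q4
  obtain ⟨n0, -⟩ := hD.ne_zero hΦ hz
  -- Compare the coefficient linear in `u` at `z` and at points shifted along `v`.
  have hmix : ∂² i 1 2 z = 0 := by
    have hU : ∀ᶠ s in nhds (0 : ℝ), z + s • basisVec 4 ∈ U := by
      have : Continuous fun s : ℝ => z + s • basisVec 4 := by fun_prop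
      exact this.continuousAt.eventually (hΦ.isOpen.mem_nhds (by simpa using hz))
    have hi' : (i = 0 ∧ (1 : Fin 7) = 0) ∨ i = 1 ∨ i = 2 ∨ i = 6 := by tauto
    obtain ⟨-, hB⟩ := quadratic_eq_zero (A := 0) (B := ∂ 0 0 z * (2 * ∂² i 1 2 z)) (C := 0) (by
      filter_upwards [hU, eventually_add_smul hD hΦ hz (Or.inr rfl) (i := 0) (j := 0) (by tauto),
        eventually_add_smul hD hΦ hz (Or.inr rfl) hi'] with s hs h00 hi1
      have e0 := (q3 hz).2
      have e1 := (q3 hs).2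
      rw [(q3 hz).1] at e0
      rw [(q3 hs).1, h00.1, h00.2, hi1.1, hi1.2] at e1
      simp [basisVec] at e1
      linear_combination e1 - e0)
    simpa [n0] using hB
  have e3 := (q3 hz).2
  have e4 := (q4 hz).2
  rw [(q3 hz).1, hmix] at e3
  rw [(q4 hz).1, hmix] at e4
  exact ⟨(q3 hz).1, hmix, (q4 hz).1, by linarith, by linarith⟩

end

/-! ### Integration to the explicit affine form -/

section

variable {Φ : Space → Space} {U : Set Space}

local notation "∂" => partialDeriv Φ
local notation "∂²" => partialDeriv₂ Φ

/-- By Lagrange's identity, orthogonality and conformality make the square of the determinant equal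
to that of the conformal factor. -/
lemma DeterminingOn.det_ne_zero (hD : DeterminingOn Φ U) (hΦ : IsPointTransformation Φ U)
    {z : Space} (hz : z ∈ U) : ∂ 1 1 z * ∂ 2 2 z - ∂ 1 2 z * ∂ 2 1 z ≠ 0 := by
  intro h0
  have ho : ∂ 1 1 z * ∂ 1 2 z + ∂ 2 1 z * ∂ 2 2 z = 0 := (hD z hz).orthogonal
  have hc : ∂ 1 1 z ^ 2 + ∂ 2 1 z ^ 2 = ∂ 1 2 z ^ 2 + ∂ 2 2 z ^ 2 := (hD z hz).conformal
  refine pow_ne_zero 2 (hD.ne_zero hΦ hz).2 ?_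
  linear_combination (∂ 1 1 z * ∂ 2 2 z - ∂ 1 2 z * ∂ 2 1 z) * h0
    + (∂ 1 1 z * ∂ 1 2 z + ∂ 2 1 z * ∂ 2 2 z) * ho + (∂ 1 1 z ^ 2 + ∂ 2 1 z ^ 2) * hc

lemma DeterminingOn.time_eq_zero (hD : DeterminingOn Φ U) (hΦ : IsPointTransformation Φ U)
    {z : Space} (hz : z ∈ U) : ∂² 0 0 0 z = 0 := by
  obtain ⟨-, -, -, h1, -⟩ := hD.second_derivatives_eq_zero hΦ (Or.inl rfl) hz
  obtain ⟨-, -, -, h2, -⟩ := hD.second_derivatives_eq_zero hΦ (Or.inr rfl) hz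
  refine (mul_eq_zero.1 (?_ : (∂ 1 1 z ^ 2 + ∂ 2 1 z ^ 2) * _ = 0)).resolve_left
    (hD.ne_zero hΦ hz).2
  linear_combination ∂ 1 1 z * h1 + ∂ 2 1 z * h2

/-- With all second derivatives gone, the classifying equations reduce to the Jacobian matrix of the
new `x, y` applied to `(∂ 6 1 z, ∂ 6 2 z)`, and this matrix is invertible. -/
lemma DeterminingOn.bottom_eq_zero (hD : DeterminingOn Φ U) (hΦ : IsPointTransformation Φ U)
    {z : Space} (hz : z ∈ U) : ∂ 6 1 z = 0 ∧ ∂ 6 2 z = 0 := by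
  obtain ⟨a₁, a₂, a₃, -, -⟩ := hD.second_derivatives_eq_zero hΦ (Or.inl rfl) hz
  obtain ⟨b₁, b₂, b₃, -, -⟩ := hD.second_derivatives_eq_zero hΦ (Or.inr rfl) hz
  have n := (hD.ne_zero hΦ hz).1
  have hd := hD.det_ne_zero hΦ hz
  have e (i : Fin 7) (hi : i = 1 ∨ i = 2) : ∂ i 1 z * ∂ 6 1 z + ∂ i 2 z * ∂ 6 2 z = 0 := by
    obtain ⟨c₁, c₂, c₃, -, -⟩ := hD.second_derivatives_eq_zero hΦ hi hz
    have := hD.classifying_eq_zero hΦ hi hz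
    rw [hD.time_eq_zero hΦ hz, c₁, c₂, c₃, a₁, a₂, b₁, b₂, classifying] at this
    refine (mul_eq_zero.1 (?_ : ∂ 0 0 z ^ 3 * _ = 0)).resolve_left (pow_ne_zero 3 n)
    linear_combination -this
  have e1 := e 1 (Or.inl rfl)
  have e2 := e 2 (Or.inr rfl)
  constructor
  · refine (mul_eq_zero.1 (?_ : (∂ 1 1 z * ∂ 2 2 z - ∂ 1 2 z * ∂ 2 1 z) * _ = 0)).resolve_left hd
    linear_combination ∂ 2 2 z * e1 - ∂ 1 2 z * e2
  · refine (mul_eq_zero.1 (?_ : (∂ 1 1 z * ∂ 2 2 z - ∂ 1 2 z * ∂ 2 1 z) * _ = 0)).resolve_left hd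
    linear_combination ∂ 1 1 z * e2 - ∂ 2 1 z * e1

/-- A component with constant partial derivatives is affine. -/
lemma IsPointTransformation.exists_affine (hΦ : IsPointTransformation Φ U) (hU : IsPreconnected U)
    (i : Fin 7) (c : Fin 7 → ℝ) (h : ∀ z ∈ U, ∀ j, ∂ i j z = c j) :
    ∃ d, ∀ z ∈ U, coord i (Φ z) = ∑ j, c j * coord j z + d := by
  have hd {z : Space} (hz : z ∈ U) : HasFDerivAt
      (fun z => coord i (Φ z) - (∑ j, c j • coord j : Space →L[ℝ] ℝ) z) (0 : Space →L[ℝ] ℝ) z := by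
    refine ((hΦ.hasFDerivAt_coord i hz).sub
      (∑ j, c j • coord j : Space →L[ℝ] ℝ).hasFDerivAt).congr_fderiv ?_
    refine ContinuousLinearMap.ext fun w => ?_
    have := coord_apply (fderiv ℝ Φ z : Space →ₗ[ℝ] Space) i w
    simp only [ContinuousLinearMap.coe_coe] at this
    simp only [sub_apply, ContinuousLinearMap.comp_apply, this,
      sum_apply, smul_apply, smul_eq_mul,
      zero_apply, sub_eq_zero]
    exact Finset.sum_congr rfl fun j _ => by rw [← h z hz j]; rfl
  obtain ⟨d, e⟩ := hΦ.isOpen.exists_is_const_of_fderiv_eq_zero (𝕜 := ℝ) hU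
    (fun z hz => (hd hz).differentiableAt.differentiableWithinAt) (fun z hz => (hd hz).fderiv)
  refine ⟨d, fun z hz => ?_⟩
  have := e z hz
  simp only [sum_apply, smul_apply, smul_eq_mul] at this
  linarith

lemma IsPointTransformation.partialDeriv_eq (hΦ : IsPointTransformation Φ U) (hU : IsPreconnected U)
    (i j : Fin 7) (h : ∀ z ∈ U, ∀ k, ∂² i j k z = 0) {z w : Space} (hz : z ∈ U) (hw : w ∈ U) :
    ∂ i j z = ∂ i j w :=
  hΦ.isOpen.is_const_of_fderiv_eq_zero (𝕜 := ℝ) hU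
    (fun _ hz => (hΦ.hasFDerivAt_partialDeriv i j hz).differentiableAt.differentiableWithinAt)
    (fun z hz => fderiv_eq_zero_of_basis (h z hz)) hz hw

lemma DeterminingOn.isExplicit (hD : DeterminingOn Φ U) (hΦ : IsPointTransformation Φ U)
    (hU : IsConnected U) : IsExplicit Φ U := by
  obtain ⟨z₀, hz₀⟩ := hU.nonempty
  have hp := hU.isPreconnected
  have spatial {i : Fin 7} (hi : i = 1 ∨ i = 2) {j : Fin 7} (hj : j = 1 ∨ j = 2) :
      ∀ z ∈ U, ∀ k, ∂² i j k z = 0 := fun z hz k => by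
    obtain ⟨-, q1, q2, -⟩ := hD.partialDeriv₂_eq_zero hΦ hz
    obtain ⟨a₁, a₂, a₃, -, -⟩ := hD.second_derivatives_eq_zero hΦ hi hz
    by_cases h1 : k = 1
    · subst h1
      rcases hj with rfl | rfl
      · exact a₁
      · rwa [hΦ.partialDeriv₂_comm _ _ _ hz]
    by_cases h2 : k = 2
    · subst h2
      rcases hj with rfl | rfl
      · exact a₂
      · exact a₃
    rcases hi with rfl | rfl
    · exact q1 j k h1 h2
    · exact q2 j k h1 h2
  have c₀ {z : Space} (hz : z ∈ U) : ∂ 0 0 z = ∂ 0 0 z₀ := hΦ.partialDeriv_eq hp 0 0 (fun z hz k => by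
    by_cases h0 : k = 0
    · subst h0
      exact hD.time_eq_zero hΦ hz
    · exact (hD.partialDeriv₂_eq_zero hΦ hz).1 k h0) hz hz₀
  have c {i : Fin 7} (hi : i = 1 ∨ i = 2) {j : Fin 7} (hj : j = 1 ∨ j = 2) {z : Space} (hz : z ∈ U) :
      ∂ i j z = ∂ i j z₀ := hΦ.partialDeriv_eq hp i j (spatial hi hj) hz hz₀
  obtain ⟨n, ns⟩ := hD.ne_zero hΦ hz₀
  -- The `h`-derivative of the depth relation determines `∂ 5 5 z`, which equals `∂ 6 6 z` by
  -- `bottom`.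
  have c66 {z : Space} (hz : z ∈ U) :
      ∂ 6 6 z = (∂ 1 1 z₀ ^ 2 + ∂ 2 1 z₀ ^ 2) / ∂ 0 0 z₀ ^ 2 := by
    obtain ⟨-, q1, q2, -⟩ := hD.partialDeriv₂_eq_zero hΦ hz
    have h5 := (hD.derivatives hΦ hz).2.2 5
    rw [(hD.partialDeriv₂_eq_zero hΦ hz).1 5 (by decide), q1 1 5 (by decide) (by decide),
      q2 1 5 (by decide) (by decide), if_pos rfl, c (Or.inl rfl) (Or.inl rfl) hz,
      c (Or.inr rfl) (Or.inl rfl) hz, c₀ hz,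
      show ∂ 5 5 z = ∂ 6 6 z from (hD z hz).bottom] at h5
    rw [eq_div_iff (pow_ne_zero 2 n)]
    linear_combination h5
  obtain ⟨d₀, e₀⟩ := hΦ.exists_affine hp 0 ![∂ 0 0 z₀, 0, 0, 0, 0, 0, 0] (fun z hz j => by
    have := (hD.partialDeriv_eq_zero hz).1
    fin_cases j
    exacts [c₀ hz, this _ (by decide), this _ (by decide), this _ (by decide), this _ (by decide),
      this _ (by decide), this _ (by decide)])
  obtain ⟨d₁, e₁⟩ := hΦ.exists_affine hp 1 ![0, ∂ 1 1 z₀, ∂ 1 2 z₀, 0, 0, 0, 0] (fun z hz j => by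
    have := (hD.partialDeriv_eq_zero hz).2.1
    fin_cases j
    exacts [this _ (by decide) (by decide), c (Or.inl rfl) (Or.inl rfl) hz,
      c (Or.inl rfl) (Or.inr rfl) hz, this _ (by decide) (by decide), this _ (by decide) (by decide),
      this _ (by decide) (by decide), this _ (by decide) (by decide)])
  obtain ⟨d₂, e₂⟩ := hΦ.exists_affine hp 2 ![0, ∂ 2 1 z₀, ∂ 2 2 z₀, 0, 0, 0, 0] (fun z hz j => by
    have := (hD.partialDeriv_eq_zero hz).2.2.1
    fin_cases j
    exacts [this _ (by decide) (by decide), c (Or.inr rfl) (Or.inl rfl) hz,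
      c (Or.inr rfl) (Or.inr rfl) hz, this _ (by decide) (by decide), this _ (by decide) (by decide),
      this _ (by decide) (by decide), this _ (by decide) (by decide)])
  obtain ⟨d₆, e₆⟩ := hΦ.exists_affine hp 6
    ![0, 0, 0, 0, 0, 0, (∂ 1 1 z₀ ^ 2 + ∂ 2 1 z₀ ^ 2) / ∂ 0 0 z₀ ^ 2] (fun z hz j => by
    have := (hD.partialDeriv_eq_zero hz).2.2.2
    fin_cases j
    exacts [this _ (by decide) (by decide) (by decide), (hD.bottom_eq_zero hΦ hz).1,
      (hD.bottom_eq_zero hΦ hz).2, this _ (by decide) (by decide) (by decide),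
      this _ (by decide) (by decide) (by decide), this _ (by decide) (by decide) (by decide), c66 hz])
  have ho : ∂ 1 1 z₀ * ∂ 1 2 z₀ + ∂ 2 1 z₀ * ∂ 2 2 z₀ = 0 := (hD z₀ hz₀).orthogonal
  have hc : ∂ 1 1 z₀ ^ 2 + ∂ 2 1 z₀ ^ 2 = ∂ 1 2 z₀ ^ 2 + ∂ 2 2 z₀ ^ 2 := (hD z₀ hz₀).conformal
  have v₁ {z : Space} (hz : z ∈ U) :
      (Φ z).2.1 0 * ∂ 0 0 z₀ = ∂ 1 1 z₀ * z.2.1 0 + ∂ 1 2 z₀ * z.2.1 1 := by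
    have : (Φ z).2.1 0 * ∂ 0 0 z = ∂ 1 1 z * z.2.1 0 + ∂ 1 2 z * z.2.1 1 := (hD z hz).velocity₁
    rwa [c₀ hz, c (Or.inl rfl) (Or.inl rfl) hz, c (Or.inl rfl) (Or.inr rfl) hz] at this
  have v₂ {z : Space} (hz : z ∈ U) :
      (Φ z).2.1 1 * ∂ 0 0 z₀ = ∂ 2 1 z₀ * z.2.1 0 + ∂ 2 2 z₀ * z.2.1 1 := by
    have : (Φ z).2.1 1 * ∂ 0 0 z = ∂ 2 1 z * z.2.1 0 + ∂ 2 2 z * z.2.1 1 := (hD z hz).velocity₂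
    rwa [c₀ hz, c (Or.inr rfl) (Or.inl rfl) hz, c (Or.inr rfl) (Or.inr rfl) hz] at this
  have v₃ {z : Space} (hz : z ∈ U) :
      (Φ z).2.1 2 * ∂ 0 0 z₀ ^ 2 = (∂ 1 1 z₀ ^ 2 + ∂ 2 1 z₀ ^ 2) * z.2.1 2 := by
    have : (Φ z).2.1 2 * ∂ 0 0 z ^ 2 = (∂ 1 1 z ^ 2 + ∂ 2 1 z ^ 2) * z.2.1 2 := (hD z hz).depth
    rwa [c₀ hz, c (Or.inl rfl) (Or.inl rfl) hz, c (Or.inr rfl) (Or.inl rfl) hz] at this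
  generalize ∂ 0 0 z₀ = τ at *
  generalize ∂ 1 1 z₀ = a at *
  generalize ∂ 1 2 z₀ = b at *
  generalize ∂ 2 1 z₀ = e at *
  generalize ∂ 2 2 z₀ = d at *
  -- A conformal matrix is determined by its first column up to orientation; `ε` is the determinant
  -- divided by the conformal factor.
  obtain ⟨ε, hε, rfl, rfl⟩ : ∃ ε : ℝ, (ε = 1 ∨ ε = -1) ∧ b = -(ε * e) ∧ d = ε * a := by
    refine ⟨(a * d - b * e) / (a ^ 2 + e ^ 2), ?_, ?_, ?_⟩
    · rw [← sq_eq_one_iff, div_pow, div_eq_one_iff_eq (pow_ne_zero 2 ns)]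
      linear_combination (-(a * b + e * d)) * ho - (a ^ 2 + e ^ 2) * hc
    · rw [div_mul_eq_mul_div, ← neg_div, eq_div_iff ns]
      linear_combination a * ho
    · rw [div_mul_eq_mul_div, eq_div_iff ns]
      linear_combination e * ho
  refine ⟨ε, τ, d₀, a, e, d₁, d₂, d₆, hε, mul_ne_zero n ns, fun z hz => ext_coord fun i => ?_⟩
  have f₀ := e₀ z hz
  have f₁ := e₁ z hz
  have f₂ := e₂ z hz
  have f₆ := e₆ z hz
  rw [Fin.sum_univ_seven] at f₀ f₁ f₂ f₆
  fin_cases i <;> simp [explicitMap]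
  · simpa using f₀
  · simpa [sub_eq_add_neg] using f₁
  · simpa using f₂
  · field_simp
    linear_combination v₁ hz
  · field_simp
    linear_combination v₂ hz
  · field_simp
    linear_combination v₃ hz
  · simpa using f₆

end

/-! ### Point symmetries and equivalence transformations preserve jets -/

/-- The jet of the extended system at `z` with the `x`- and `y`-derivatives `p`, `q`. -/
noncomputable def jetMap (z : Space) (p q : Dep × ℝ) : Indep →ₗ[ℝ] Dep × ℝ :=
  ofColumns (timeDeriv (z.2.1 0) (z.2.1 1) (z.2.1 2) p q) p q

@[simp] lemma jetMap_single_zero (z : Space) (p q : Dep × ℝ) :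
    jetMap z p q (Pi.single 0 1) = timeDeriv (z.2.1 0) (z.2.1 1) (z.2.1 2) p q := by
  simp [jetMap, ofColumns_apply]

@[simp] lemma jetMap_single_one (z : Space) (p q : Dep × ℝ) :
    jetMap z p q (Pi.single 1 1) = p := by
  simp [jetMap, ofColumns_apply]

@[simp] lemma jetMap_single_two (z : Space) (p q : Dep × ℝ) :
    jetMap z p q (Pi.single 2 1) = q := by
  simp [jetMap, ofColumns_apply]

lemma jetMap_mem (z : Space) (p q : Dep × ℝ) :
    ((z, jetMap z p q) : Jet Indep (Dep × ℝ)) ∈ extendedSystem := by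
  rw [mem_extendedSystem_iff]
  simp

lemma jetMap_snd (z : Space) (p q : Dep × ℝ) (ξ : Indep) :
    (jetMap z p q ξ).2 = p.2 * ξ 1 + q.2 * ξ 2 := by
  simp [jetMap, ofColumns_apply, timeDeriv, mul_comm]

lemma onJet_eq (f : Space →ₗ[ℝ] Space →ₗ[ℝ] Space →ₗ[ℝ] ℝ) (T : Space →ₗ[ℝ] Space)
    (z : Space) (p q : Dep × ℝ) :
    onJet f T z p q = f (T (Pi.single 0 1, jetMap z p q (Pi.single 0 1)))
      (T (Pi.single 1 1, jetMap z p q (Pi.single 1 1)))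
      (T (Pi.single 2 1, jetMap z p q (Pi.single 2 1))) := by
  simp [onJet]

lemma onJet_vol_ne_zero_iff (T : Space →ₗ[ℝ] Space) (z : Space) (p q : Dep × ℝ) :
    onJet vol T z p q ≠ 0 ↔ Function.Bijective fun ξ => (T (ξ, jetMap z p q ξ)).1 := by
  rw [onJet_eq, vol_ne_zero_iff]

lemma eq_jetMap {z : Space} {P : Indep →ₗ[ℝ] Dep × ℝ}
    (hP : ((z, P) : Jet Indep (Dep × ℝ)) ∈ extendedSystem) :
    P = jetMap z (P (Pi.single 1 1)) (P (Pi.single 2 1)) := by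
  rw [mem_extendedSystem_iff] at hP
  refine LinearMap.ext fun ξ => ?_
  rw [map_indep, hP, jetMap, ofColumns_apply]

/-- The image vectors lie on the graph of `Q`, and the forms vanish on the graphs of jets of the
system. -/
lemma onJet_form_eq_zero {T : Space →ₗ[ℝ] Space} {z z' : Space} {p q : Dep × ℝ}
    {Q : Indep →ₗ[ℝ] Dep × ℝ} (hQ : ((z', Q) : Jet Indep (Dep × ℝ)) ∈ extendedSystem)
    (h : ∀ ξ, (T (ξ, jetMap z p q ξ)).2 = Q (T (ξ, jetMap z p q ξ)).1) (k : Fin 4) :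
    onJet (formAt z' k) T z p q = 0 := by
  have e (ξ : Indep) : T (ξ, jetMap z p q ξ) =
      ((T (ξ, jetMap z p q ξ)).1, Q (T (ξ, jetMap z p q ξ)).1) := Prod.ext rfl (h ξ)
  have := form_graph_eq_zero hQ k (T (Pi.single 0 1, jetMap z p q (Pi.single 0 1))).1
    (T (Pi.single 1 1, jetMap z p q (Pi.single 1 1))).1
    (T (Pi.single 2 1, jetMap z p q (Pi.single 2 1))).1
  rw [← e, ← e, ← e] at this
  rw [onJet_eq]
  exact this

section

variable {Φ : Space → Space} {U : Set Space}

lemma IsPointSymmetry.preservesJets (h : IsPointSymmetry extendedSystem Φ U) :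
    PreservesJets Φ U where
  mul_form z hz p q k := by
    by_cases hv : onJet vol (fderiv ℝ Φ z : Space →ₗ[ℝ] Space) z p q = 0
    · rw [hv, zero_mul]
    · rw [← ne_eq, onJet_vol_ne_zero_iff] at hv
      obtain ⟨Q, hQ, e⟩ := exists_map_graph_eq _ _ hv
      rw [onJet_form_eq_zero (((h.2.mem_iff z hz _ _ hQ).1 (jetMap_mem z p q))) e, mul_zero]
  generic V hV hVo hVn := by
    obtain ⟨z, hz, P, Q, hP, hQ⟩ := h.2.generic V hV hVo hVn
    refine ⟨z, hz, P (Pi.single 1 1), P (Pi.single 2 1), ?_⟩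
    rw [onJet_vol_ne_zero_iff, ← eq_jetMap hP]
    exact bijective_of_map_graph_eq _ _ _ hQ

/-- The linear functional `ξ ↦ m ξ_x + n ξ_y`. -/
noncomputable def gradient (m n : ℝ) : Indep →L[ℝ] ℝ :=
  m • ContinuousLinearMap.proj 1 + n • ContinuousLinearMap.proj 2

lemma hasFDerivAt_lift_affine (x₀ y₀ c m n : ℝ) (z : Indep × Dep) :
    HasFDerivAt (lift fun a => c + m * (a.1 - x₀) + n * (a.2 - y₀))
      ((ContinuousLinearMap.fst ℝ Indep Dep).prod ((ContinuousLinearMap.snd ℝ Indep Dep).prod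
        ((gradient m n).comp (ContinuousLinearMap.fst ℝ Indep Dep)))) z := by
  have h : HasFDerivAt (fun z : Indep × Dep => gradient m n z.1 + (c - m * x₀ - n * y₀))
      ((gradient m n).comp (ContinuousLinearMap.fst ℝ Indep Dep)) z :=
    ((gradient m n).comp (ContinuousLinearMap.fst ℝ Indep Dep)).hasFDerivAt.add_const _
  have e : (lift fun a => c + m * (a.1 - x₀) + n * (a.2 - y₀)) =
      fun z : Indep × Dep => (z.1, (z.2, gradient m n z.1 + (c - m * x₀ - n * y₀))) := by
    funext z
    simp only [lift, horizontal, gradient, Prod.mk.injEq, true_and]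
    simp
    ring
  rw [e]
  exact hasFDerivAt_fst.prodMk (hasFDerivAt_snd.prodMk h)

lemma fderiv_affine (x₀ y₀ c m n : ℝ) (a w : ℝ × ℝ) :
    fderiv ℝ (fun a : ℝ × ℝ => c + m * (a.1 - x₀) + n * (a.2 - y₀)) a w = m * w.1 + n * w.2 := by
  have h : HasFDerivAt (fun a : ℝ × ℝ => c + m * (a.1 - x₀) + n * (a.2 - y₀))
      (m • ContinuousLinearMap.fst ℝ ℝ ℝ + n • ContinuousLinearMap.snd ℝ ℝ ℝ) a :=
    (((hasFDerivAt_fst.sub_const x₀).const_mul m).const_add c).add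
      ((hasFDerivAt_snd.sub_const y₀).const_mul n)
  rw [h.fderiv]
  simp

/-- The linear map `horizontal`. -/
noncomputable def horizontalL : Indep →L[ℝ] ℝ × ℝ :=
  (ContinuousLinearMap.proj 1).prod (ContinuousLinearMap.proj 2)

/-- For an affine `b` with gradient `(p.2, q.2)`, jets of the system with this `b` are the jets of
the extended system with these topography derivatives. The definition supplies only some point of
each open set, so the product condition is obtained for fixed `p`, `q` at an unspecified point of
`V`. -/
lemma IsGeneralizedEquivalence.exists_jet (h : IsGeneralizedEquivalence Φ U) (p q : Dep × ℝ)
    {V : Set Space} (hV : V ⊆ U) (hVo : IsOpen V) (hVn : V.Nonempty) :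
    ∃ z ∈ V, (∀ k, onJet vol (fderiv ℝ Φ z) z p q
      * onJet (formAt (Φ z) k) (fderiv ℝ Φ z) z p q = 0) ∧
      ∃ p' q', onJet vol (fderiv ℝ Φ z) z p' q' ≠ 0 := by
  obtain ⟨hΦ, h⟩ := h
  obtain ⟨z₀, hz₀⟩ := hVn
  -- The constant term makes the graph of `b` pass through `z₀`, so that the preimage of `V` under
  -- `lift b` is nonempty.
  set b : ℝ × ℝ → ℝ := fun a => z₀.2.2 + p.2 * (a.1 - z₀.1 1) + q.2 * (a.2 - z₀.1 2) with hb
  have hlift (z : Indep × Dep) := hasFDerivAt_lift_affine (z₀.1 1) (z₀.1 2) z₀.2.2 p.2 q.2 z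
  rw [← hb] at hlift
  have hbs : ContDiff ℝ ∞ b := by fun_prop
  have hcont : Continuous (lift b) :=
    continuous_iff_continuousAt.2 fun z => (hlift z).continuousAt
  obtain ⟨V', hV', hV'n, b', Ω', hΩ', hb', hcomp, hpt, hmap⟩ := h b Set.univ isOpen_univ
    hbs.contDiffOn (lift b ⁻¹' V) (hVo.preimage hcont)
    ⟨(z₀.1, z₀.2.1), by simpa [lift, horizontal, hb] using hz₀⟩
    (fun z hz => ⟨Set.mem_univ _, hV hz⟩)
  obtain ⟨z₁, hz₁, p₁, q₁, hp₁, hq₁⟩ := hmap.generic V' subset_rfl hpt.isOpen hV'n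
  have hzV : lift b z₁ ∈ V := hV' hz₁
  set T := fderiv ℝ Φ (lift b z₁) with hT
  have hΦl : HasFDerivAt (fun z => Φ (lift b z)) _ z₁ :=
    (hΦ.differentiableAt (hV hzV)).hasFDerivAt.comp z₁ (hlift z₁)
  have hS (ξ : Indep) (w : Dep) : fderiv ℝ (specialize Φ b) z₁ (ξ, w) =
      ((T (ξ, (w, gradient p.2 q.2 ξ))).1, (T (ξ, (w, gradient p.2 q.2 ξ))).2.1) := by
    have : HasFDerivAt (specialize Φ b) _ z₁ := hΦl.fst.prodMk hΦl.snd.fst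
    rw [this.fderiv]
    rfl
  have hB (ξ : Indep) (w : Dep) : (T (ξ, (w, gradient p.2 q.2 ξ))).2.2 =
      fderiv ℝ b' (horizontal (specialize Φ b z₁).1)
        (horizontal (T (ξ, (w, gradient p.2 q.2 ξ))).1) := by
    have h1 : HasFDerivAt (fun z => (Φ (lift b z)).2.2) _ z₁ := hΦl.snd.snd
    have hd : DifferentiableAt ℝ b' (horizontal (specialize Φ b z₁).1) :=
      (hb'.contDiffAt (hΩ'.mem_nhds (hcomp z₁ hz₁).1)).differentiableAt (by simp)
    have h0 : HasFDerivAt (fun z => horizontal (specialize Φ b z).1) (horizontalL.comp _) z₁ :=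
      HasFDerivAt.comp (g := horizontalL) (f := fun z => (Φ (lift b z)).1) z₁
        horizontalL.hasFDerivAt hΦl.fst
    have h2 : HasFDerivAt (fun z => b' (horizontal (specialize Φ b z).1)) _ z₁ :=
      hd.hasFDerivAt.comp z₁ h0
    have h3 : (fun z => (Φ (lift b z)).2.2) =ᶠ[nhds z₁]
        fun z => b' (horizontal (specialize Φ b z).1) := by
      filter_upwards [hpt.isOpen.mem_nhds hz₁] with z hz using (hcomp z hz).2
    have := congrArg (fun l : Indep × Dep →L[ℝ] ℝ => l (ξ, w))
      (h1.unique (h2.congr_of_eventuallyEq h3))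
    exact this
  have hgrad (ξ : Indep) (p' q' : Dep) : (jetMap (lift b z₁) (p', p.2) (q', q.2) ξ).2 =
      gradient p.2 q.2 ξ := by
    rw [jetMap_snd]
    simp [gradient]
  refine ⟨lift b z₁, hzV, fun k => ?_, ?_⟩
  · by_cases hv : onJet vol (T : Space →ₗ[ℝ] Space) (lift b z₁) p q = 0
    · rw [hv, zero_mul]
    rw [← ne_eq, onJet_vol_ne_zero_iff] at hv
    set P := jetMap (lift b z₁) p q with hP
    have hP2 (ξ : Indep) : (ξ, ((P ξ).1, gradient p.2 q.2 ξ)) = ((ξ, P ξ) : Space) := by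
      rw [← hgrad ξ p.1 q.1]
    have hw (ξ : Indep) : fderiv ℝ (specialize Φ b) z₁ (ξ, (P ξ).1) =
        ((T (ξ, P ξ)).1, (T (ξ, P ξ)).2.1) := by rw [hS, hP2]
    obtain ⟨Q, hQ, e⟩ := exists_map_graph_eq
      (fderiv ℝ (specialize Φ b) z₁ : Indep × Dep →ₗ[ℝ] Indep × Dep)
      (LinearMap.fst ℝ Dep ℝ ∘ₗ P) (by
        simp only [LinearMap.comp_apply, LinearMap.fst_apply, ContinuousLinearMap.coe_coe, hw]
        exact hv)
    have hmem := (hmap.mem_iff z₁ hz₁ _ Q hQ).1 (by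
      rw [mem_system_iff]
      refine ⟨Set.mem_univ _, ?_⟩
      simp [hP, hb, fderiv_affine, lift])
    rw [mem_system_iff] at hmem
    -- Complete the transformed jet by the differential of `b'`. As `b'` does not depend on the new
    -- time, the equation `b_t = 0` holds; `hB` places the image of the jet on the graph of `Q'`.
    let Q' : Indep →ₗ[ℝ] Dep × ℝ := Q.prod
      ((fderiv ℝ b' (horizontal (specialize Φ b z₁).1) : ℝ × ℝ →ₗ[ℝ] ℝ) ∘ₗ
        (horizontalL : Indep →ₗ[ℝ] ℝ × ℝ))
    have hQ' : ((Φ (lift b z₁), Q') : Jet Indep (Dep × ℝ)) ∈ extendedSystem := by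
      rw [mem_extendedSystem_iff]
      refine Prod.ext ?_ ?_
      · have := hmem.2
        simp [Q', horizontalL]
        exact this
      · have e0 : horizontalL (Pi.single 0 1) = 0 := by ext <;> simp [horizontalL]
        change fderiv ℝ b' (horizontal (specialize Φ b z₁).1) (horizontalL (Pi.single 0 1)) = 0
        rw [e0, map_zero]
    rw [onJet_form_eq_zero hQ' (fun ξ => ?_), mul_zero]
    refine Prod.ext ?_ ?_
    · have := e ξ
      simp only [LinearMap.comp_apply, LinearMap.fst_apply, ContinuousLinearMap.coe_coe, hw] at this
      exact this
    · have := hB ξ (P ξ).1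
      rw [hP2] at this
      exact this
  · have hb₁ := bijective_of_map_graph_eq _ _ _ hq₁
    rw [mem_system_iff] at hp₁
    refine ⟨(p₁ (Pi.single 1 1), p.2), (p₁ (Pi.single 2 1), q.2), ?_⟩
    rw [onJet_vol_ne_zero_iff]
    have hp (ξ : Indep) : jetMap (lift b z₁) (p₁ (Pi.single 1 1), p.2) (p₁ (Pi.single 2 1), q.2) ξ =
        (p₁ ξ, gradient p.2 q.2 ξ) := by
      refine Prod.ext ?_ (hgrad _ _ _)
      have := hp₁.2
      simp only [hb, fderiv_affine, mul_one, mul_zero, add_zero, zero_add] at this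
      rw [map_indep p₁ ξ, this, jetMap, ofColumns_apply]
      rfl
    simp only [hp, ContinuousLinearMap.coe_coe]
    simpa only [ContinuousLinearMap.coe_coe, hS] using hb₁

lemma IsGeneralizedEquivalence.preservesJets (h : IsGeneralizedEquivalence Φ U) :
    PreservesJets Φ U where
  mul_form z hz p q k :=
    eq_zero_of_dense h.1.isOpen ((h.1.continuousOn_vol p q).mul (h.1.continuousOn_form p q k))
      (fun V hV hVo hVn => by
        obtain ⟨z, hz, e, -⟩ := h.exists_jet p q hV hVo hVn
        exact ⟨z, hz, e k⟩) z hz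
  generic V hV hVo hVn := by
    -- A constant topography already provides a jet at which the prolongation is defined.
    obtain ⟨z, hz, -, e⟩ := h.exists_jet 0 0 hV hVo hVn
    exact ⟨z, hz, e⟩

lemma PreservesJets.isExplicit (hΦ : IsPointTransformation Φ U) (hU : IsConnected U)
    (h : PreservesJets Φ U) : IsExplicit Φ U :=
  DeterminingOn.isExplicit (fun _ hz => h.determining hΦ hz) hΦ hU

end

/-! ### Transformations of the explicit form -/

section Affine

variable {E : Type*} [NormedAddCommGroup E] [NormedSpace ℝ E] {φ : E → E} {L : E →L[ℝ] E} {c : E}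
  {U : Set E}

lemma fderiv_of_eqOn_affine (hU : IsOpen U) (h : Set.EqOn φ (fun z => L z + c) U) {z : E}
    (hz : z ∈ U) : fderiv ℝ φ z = L := by
  have h1 : HasFDerivAt (fun z => L z + c) L z := L.hasFDerivAt.add_const c
  refine (h1.congr_of_eventuallyEq ?_).fderiv
  filter_upwards [hU.mem_nhds hz] with w hw using h hw

lemma isPointTransformation_of_eqOn_affine [FiniteDimensional ℝ E] (hU : IsOpen U)
    (hL : Function.Injective L) (h : Set.EqOn φ (fun z => L z + c) U) :
    IsPointTransformation φ U where
  isOpen := hU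
  smooth := (L.contDiff.add contDiff_const).contDiffOn.congr h
  injOn z hz w hw e := by
    rw [h hz, h hw] at e
    exact hL (add_right_cancel e)
  regular z hz := by
    rw [fderiv_of_eqOn_affine hU h hz]
    exact ⟨hL, LinearMap.injective_iff_surjective (f := (L : E →ₗ[ℝ] E)).1 hL⟩

end Affine

lemma Prolongs.apply_eq {X W : Type*} [NormedAddCommGroup X] [NormedSpace ℝ X]
    [NormedAddCommGroup W] [NormedSpace ℝ W] {φ : X × W → X × W} {z : X × W} {p q : X →ₗ[ℝ] W}
    (h : Prolongs φ z p q) (ξ : X) : (fderiv ℝ φ z (ξ, p ξ)).2 = q (fderiv ℝ φ z (ξ, p ξ)).1 := by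
  have : fderiv ℝ φ z (ξ, p ξ) ∈ Submodule.map (fderiv ℝ φ z : X × W →ₗ[ℝ] X × W) p.graph :=
    ⟨(ξ, p ξ), rfl, rfl⟩
  rw [h, LinearMap.mem_graph_iff] at this
  exact this

section Linear

variable (ε δ₁ δ₃ δ₄ : ℝ)

/-- The linear part of the explicit transformations on the independent variables. -/
noncomputable def linIndep : Indep →L[ℝ] Indep :=
  LinearMap.toContinuousLinearMap
    (ofColumns ![δ₁, 0, 0] ![0, δ₃, δ₄] ![0, -(ε * δ₄), ε * δ₃])

/-- The linear part of the explicit transformations on the dependent variables. -/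
noncomputable def linDep : Dep →L[ℝ] Dep :=
  LinearMap.toContinuousLinearMap
    (ofColumns ![δ₃ / δ₁, δ₄ / δ₁, 0] ![-(ε * (δ₄ / δ₁)), ε * (δ₃ / δ₁), 0]
      ![0, 0, (δ₃ ^ 2 + δ₄ ^ 2) / δ₁ ^ 2])

/-- The linear part of the explicit transformations on the dependent variables and the arbitrary
element. -/
noncomputable def linDepProd : Dep × ℝ →L[ℝ] Dep × ℝ :=
  (linDep ε δ₁ δ₃ δ₄).prodMap
    (((δ₃ ^ 2 + δ₄ ^ 2) / δ₁ ^ 2) • ContinuousLinearMap.id ℝ ℝ)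

lemma linIndep_apply (ξ : Indep) : linIndep ε δ₁ δ₃ δ₄ ξ =
    ![δ₁ * ξ 0, δ₃ * ξ 1 - ε * δ₄ * ξ 2, δ₄ * ξ 1 + ε * δ₃ * ξ 2] := by
  ext i
  fin_cases i <;> simp [linIndep, ofColumns_apply] <;> ring

lemma linDep_apply (w : Dep) : linDep ε δ₁ δ₃ δ₄ w =
    ![δ₃ / δ₁ * w 0 - ε * (δ₄ / δ₁) * w 1, δ₄ / δ₁ * w 0 + ε * (δ₃ / δ₁) * w 1,
      (δ₃ ^ 2 + δ₄ ^ 2) / δ₁ ^ 2 * w 2] := by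
  ext i
  fin_cases i <;> simp [linDep, ofColumns_apply] <;> ring

lemma linDepProd_apply (w : Dep × ℝ) : linDepProd ε δ₁ δ₃ δ₄ w =
    (linDep ε δ₁ δ₃ δ₄ w.1, (δ₃ ^ 2 + δ₄ ^ 2) / δ₁ ^ 2 * w.2) := rfl

lemma explicitMap_eq (δ₂ δ₅ δ₆ δ₇ : ℝ) (z : Space) :
    explicitMap ε δ₁ δ₂ δ₃ δ₄ δ₅ δ₆ δ₇ z =
      (linIndep ε δ₁ δ₃ δ₄).prodMap (linDepProd ε δ₁ δ₃ δ₄) z + (![δ₂, δ₅, δ₆], (0, δ₇)) := by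
  refine ext_coord fun i => ?_
  fin_cases i <;>
    simp [explicitMap, linIndep_apply, linDepProd_apply, linDep_apply]

variable {ε δ₁ δ₃ δ₄} (hε : ε = 1 ∨ ε = -1) (hδ : δ₁ * (δ₃ ^ 2 + δ₄ ^ 2) ≠ 0)

include hε hδ

lemma linIndep_injective : Function.Injective (linIndep ε δ₁ δ₃ δ₄) := by
  rw [injective_iff_map_eq_zero]
  intro ξ h
  obtain ⟨h1, hs⟩ := mul_ne_zero_iff.1 hδ
  have hε2 : ε ^ 2 = 1 := by rcases hε with rfl | rfl <;> norm_num
  rw [linIndep_apply] at h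
  have e0 := congrFun h 0
  have e1 := congrFun h 1
  have e2 := congrFun h 2
  simp at e0 e1 e2
  ext i
  fin_cases i
  · exact e0.resolve_left h1
  · refine (mul_eq_zero.1 (?_ : (δ₃ ^ 2 + δ₄ ^ 2) * ξ 1 = 0)).resolve_left hs
    linear_combination δ₃ * e1 + δ₄ * e2
  · refine (mul_eq_zero.1 (?_ : (δ₃ ^ 2 + δ₄ ^ 2) * ξ 2 = 0)).resolve_left hs
    linear_combination ε * (δ₃ * e2 - δ₄ * e1) - (δ₃ ^ 2 + δ₄ ^ 2) * ξ 2 * hε2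

lemma linDep_injective : Function.Injective (linDep ε δ₁ δ₃ δ₄) := by
  rw [injective_iff_map_eq_zero]
  intro w h
  obtain ⟨h1, hs⟩ := mul_ne_zero_iff.1 hδ
  have hε2 : ε ^ 2 = 1 := by rcases hε with rfl | rfl <;> norm_num
  rw [linDep_apply] at h
  have e0 := congrFun h 0
  have e1 := congrFun h 1
  have e2 := congrFun h 2
  simp [h1, hs] at e0 e1 e2
  field_simp at e0 e1
  ext i
  fin_cases i
  · refine (mul_eq_zero.1 (?_ : (δ₃ ^ 2 + δ₄ ^ 2) * w 0 = 0)).resolve_left hs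
    linear_combination δ₃ * e0 + δ₄ * e1
  · refine (mul_eq_zero.1 (?_ : (δ₃ ^ 2 + δ₄ ^ 2) * w 1 = 0)).resolve_left hs
    linear_combination ε * (δ₃ * e1 - δ₄ * e0) - (δ₃ ^ 2 + δ₄ ^ 2) * w 1 * hε2
  · exact e2

lemma linDepProd_injective : Function.Injective (linDepProd ε δ₁ δ₃ δ₄) := by
  obtain ⟨h1, hs⟩ := mul_ne_zero_iff.1 hδ
  refine (linDep_injective hε hδ).prodMap fun a b h => ?_
  exact mul_left_cancel₀ (div_ne_zero hs (pow_ne_zero 2 h1)) h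

lemma linIndep_bijective : Function.Bijective (linIndep ε δ₁ δ₃ δ₄) :=
  ⟨linIndep_injective hε hδ, LinearMap.injective_iff_surjective
    (f := (linIndep ε δ₁ δ₃ δ₄ : Indep →ₗ[ℝ] Indep)).1 (linIndep_injective hε hδ)⟩

/-- `hp` and `hp'` are the transformation rules for the `x`- and `y`-derivatives. The conclusion is
the rule for the `t`-derivative, so the equations solved for it are preserved. -/
lemma linDepProd_timeDeriv {p p' q q' : Dep × ℝ}
    (hp : linDepProd ε δ₁ δ₃ δ₄ p = δ₃ • q + δ₄ • q')
    (hp' : linDepProd ε δ₁ δ₃ δ₄ p' = -(ε * δ₄) • q + (ε * δ₃) • q') (w : Dep) :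
    linDepProd ε δ₁ δ₃ δ₄ (timeDeriv (w 0) (w 1) (w 2) p p') =
      δ₁ • timeDeriv (linDep ε δ₁ δ₃ δ₄ w 0) (linDep ε δ₁ δ₃ δ₄ w 1) (linDep ε δ₁ δ₃ δ₄ w 2)
        q q' := by
  obtain ⟨h1, hs⟩ := mul_ne_zero_iff.1 hδ
  have key {p q : Dep × ℝ} (h : linDepProd ε δ₁ δ₃ δ₄ p = q) :
      p.1 0 = δ₁ / (δ₃ ^ 2 + δ₄ ^ 2) * (δ₃ * q.1 0 + δ₄ * q.1 1) ∧
      p.1 1 = ε * δ₁ / (δ₃ ^ 2 + δ₄ ^ 2) * (δ₃ * q.1 1 - δ₄ * q.1 0) ∧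
      p.1 2 = δ₁ ^ 2 / (δ₃ ^ 2 + δ₄ ^ 2) * q.1 2 ∧
      p.2 = δ₁ ^ 2 / (δ₃ ^ 2 + δ₄ ^ 2) * q.2 := by
    subst h
    simp only [linDepProd_apply, linDep_apply, Matrix.cons_val]
    rcases hε with rfl | rfl <;> refine ⟨?_, ?_, ?_, ?_⟩ <;> field_simp <;> ring
  obtain ⟨a0, a1, a2, a3⟩ := key hp
  obtain ⟨b0, b1, b2, b3⟩ := key hp'
  simp only [Prod.fst_add, Prod.snd_add, Prod.smul_fst, Prod.smul_snd, Pi.add_apply,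
    Pi.smul_apply, smul_eq_mul] at a0 a1 a2 a3 b0 b1 b2 b3
  rw [linDepProd_apply, linDep_apply, linDep_apply]
  refine Prod.ext (funext fun i => ?_) ?_
  · fin_cases i
    all_goals
      simp only [timeDeriv, a0, a1, a2, a3, b0, b1, b2, b3]
      rcases hε with rfl | rfl <;> simp <;> field_simp <;> ring
  · simp [timeDeriv]

end Linear

/-! ### Sufficiency of the explicit form, and the equivalences -/

section

variable {Φ : Space → Space} {U : Set Space}

lemma IsExplicit.isPointSymmetry (hU : IsOpen U) (h : IsExplicit Φ U) :
    IsPointSymmetry extendedSystem Φ U := by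
  obtain ⟨ε, δ₁, δ₂, δ₃, δ₄, δ₅, δ₆, δ₇, hε, hδ, h⟩ := h
  have h1 : δ₁ ≠ 0 := left_ne_zero_of_mul hδ
  have hΦ : Set.EqOn Φ (fun z => (linIndep ε δ₁ δ₃ δ₄).prodMap (linDepProd ε δ₁ δ₃ δ₄) z
      + (![δ₂, δ₅, δ₆], (0, δ₇))) U := fun z hz => by rw [h hz, explicitMap_eq]
  have hinj := linDepProd_injective hε hδ
  have hT {z : Space} (hz : z ∈ U) (ξ : Indep) (w : Dep × ℝ) : fderiv ℝ Φ z (ξ, w) =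
      (linIndep ε δ₁ δ₃ δ₄ ξ, linDepProd ε δ₁ δ₃ δ₄ w) := by
    rw [fderiv_of_eqOn_affine hU hΦ hz]
    rfl
  refine ⟨isPointTransformation_of_eqOn_affine hU
    ((linIndep_injective hε hδ).prodMap hinj) hΦ, ⟨fun z hz p q hpq => ?_, fun V hV hVo hVn => ?_⟩⟩
  · have e (ξ : Indep) : linDepProd ε δ₁ δ₃ δ₄ (p ξ) = q (linIndep ε δ₁ δ₃ δ₄ ξ) := by
      have := hpq.apply_eq ξ
      rwa [hT hz] at this
    have e0 := e (Pi.single 0 1)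
    have e1 := e (Pi.single 1 1)
    have e2 := e (Pi.single 2 1)
    rw [map_indep q, linIndep_apply] at e0 e1 e2
    simp at e0 e1 e2
    rw [← neg_smul] at e2
    have key := linDepProd_timeDeriv hε hδ e1 e2 z.2.1
    have hz2 : (Φ z).2.1 = linDep ε δ₁ δ₃ δ₄ z.2.1 := by
      rw [hΦ hz]
      exact add_zero _
    rw [mem_extendedSystem_iff, mem_extendedSystem_iff, hz2, ← hinj.eq_iff, key, e0,
      smul_right_inj h1]
  · obtain ⟨z, hz⟩ := hVn
    have hb : Function.Bijective fun ξ =>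
        ((fderiv ℝ Φ z : Space →ₗ[ℝ] Space) (ξ, jetMap z 0 0 ξ)).1 := by
      simpa only [ContinuousLinearMap.coe_coe, hT (hV hz)] using linIndep_bijective hε hδ
    obtain ⟨q, hq, -⟩ := exists_map_graph_eq _ _ hb
    exact ⟨z, hz, _, q, jetMap_mem z 0 0, hq⟩

lemma IsExplicit.isGeneralizedEquivalence (hU : IsOpen U) (h : IsExplicit Φ U) :
    IsGeneralizedEquivalence Φ U := by
  refine ⟨(h.isPointSymmetry hU).1, fun b Ω hΩ hb V hV hVn hVU => ?_⟩
  obtain ⟨ε, δ₁, δ₂, δ₃, δ₄, δ₅, δ₆, δ₇, hε, hδ, h⟩ := h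
  obtain ⟨h1, hs⟩ := mul_ne_zero_iff.1 hδ
  set κ := (δ₃ ^ 2 + δ₄ ^ 2) / δ₁ ^ 2 with hκ
  -- `ρ` inverts the spatial linear part and `σ` the affine one, so the new topography must be `κ *
  -- b (σ a) + δ₇`. It is defined on all of `σ ⁻¹' Ω`, hence `V' = V` will do.
  let ρ : ℝ × ℝ →L[ℝ] ℝ × ℝ :=
    ((δ₃ / (δ₃ ^ 2 + δ₄ ^ 2)) • ContinuousLinearMap.fst ℝ ℝ ℝ
      + (δ₄ / (δ₃ ^ 2 + δ₄ ^ 2)) • ContinuousLinearMap.snd ℝ ℝ ℝ).prod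
    ((-(ε * δ₄ / (δ₃ ^ 2 + δ₄ ^ 2))) • ContinuousLinearMap.fst ℝ ℝ ℝ
      + (ε * δ₃ / (δ₃ ^ 2 + δ₄ ^ 2)) • ContinuousLinearMap.snd ℝ ℝ ℝ)
  have hρ (x y : ℝ) : ρ (x, y) = ((δ₃ * x + δ₄ * y) / (δ₃ ^ 2 + δ₄ ^ 2),
      ε * (δ₃ * y - δ₄ * x) / (δ₃ ^ 2 + δ₄ ^ 2)) := by
    refine Prod.ext ?_ ?_ <;> simp [ρ] <;> ring
  let σ : ℝ × ℝ → ℝ × ℝ := fun a => ρ (a - (δ₅, δ₆))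
  have hσ : ContDiff ℝ ∞ σ := ρ.contDiff.comp (contDiff_id.sub contDiff_const)
  let b' : ℝ × ℝ → ℝ := fun a => κ * b (σ a) + δ₇
  have hφ : Set.EqOn (specialize Φ b) (fun z =>
      (linIndep ε δ₁ δ₃ δ₄).prodMap (linDep ε δ₁ δ₃ δ₄) z + (![δ₂, δ₅, δ₆], 0)) V := by
    intro z hz
    rw [specialize, h (hVU z hz).2, explicitMap_eq]
    rfl
  have hfst {z : Indep × Dep} (hz : z ∈ V) : horizontal (specialize Φ b z).1 =
      (δ₃ * z.1 1 - ε * δ₄ * z.1 2 + δ₅, δ₄ * z.1 1 + ε * δ₃ * z.1 2 + δ₆) := by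
    rw [hφ hz]
    simp [horizontal, linIndep_apply]
  have hσz {z : Indep × Dep} (hz : z ∈ V) :
      σ (horizontal (specialize Φ b z).1) = horizontal z.1 := by
    rw [hfst hz]
    simp only [σ, Prod.mk_sub_mk, hρ, add_sub_cancel_right, horizontal]
    rcases hε with rfl | rfl <;> refine Prod.ext ?_ ?_ <;> field_simp <;> ring
  have hT {z : Indep × Dep} (hz : z ∈ V) (ξ : Indep) (w : Dep) : fderiv ℝ (specialize Φ b) z (ξ, w)
      = (linIndep ε δ₁ δ₃ δ₄ ξ, linDep ε δ₁ δ₃ δ₄ w) := by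
    rw [fderiv_of_eqOn_affine hV hφ hz]
    rfl
  have hb'd {z : Indep × Dep} (hz : z ∈ V) (w : ℝ × ℝ) :
      fderiv ℝ b' (horizontal (specialize Φ b z).1) w = κ * fderiv ℝ b (horizontal z.1) (ρ w) := by
    have hd : HasFDerivAt b (fderiv ℝ b (horizontal z.1))
        (σ (horizontal (specialize Φ b z).1)) := by
      rw [hσz hz]
      exact ((hb.contDiffAt (hΩ.mem_nhds (hVU z hz).1)).differentiableAt (by simp)).hasFDerivAt
    have hd' : HasFDerivAt σ ρ (horizontal (specialize Φ b z).1) :=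
      ρ.hasFDerivAt.comp _ ((hasFDerivAt_id _).sub_const _)
    have : HasFDerivAt b' _ (horizontal (specialize Φ b z).1) :=
      ((hd.comp _ hd').const_mul κ).add_const δ₇
    rw [this.fderiv]
    simp
  have hlin (l : ℝ × ℝ →L[ℝ] ℝ) (x y : ℝ) : l (x, y) = x * l (1, 0) + y * l (0, 1) := by
    have : ((x, y) : ℝ × ℝ) = x • (1, 0) + y • (0, 1) := by simp
    rw [this, map_add, map_smul, map_smul, smul_eq_mul, smul_eq_mul]
  have hb'' {z : Indep × Dep} (hz : z ∈ V) :
      κ * fderiv ℝ b (horizontal z.1) (1, 0) =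
        δ₃ * fderiv ℝ b' (horizontal (specialize Φ b z).1) (1, 0)
          + δ₄ * fderiv ℝ b' (horizontal (specialize Φ b z).1) (0, 1) ∧
      κ * fderiv ℝ b (horizontal z.1) (0, 1) =
        -(ε * δ₄) * fderiv ℝ b' (horizontal (specialize Φ b z).1) (1, 0)
          + ε * δ₃ * fderiv ℝ b' (horizontal (specialize Φ b z).1) (0, 1) := by
    rw [hb'd hz, hb'd hz, hρ, hρ, hlin _ (_ / _), hlin _ ((δ₃ * 0 + δ₄ * 1) / _)]
    rcases hε with rfl | rfl <;> refine ⟨?_, ?_⟩ <;> field_simp <;> ring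
  refine ⟨V, subset_rfl, hVn, b', σ ⁻¹' Ω, hΩ.preimage hσ.continuous, ?_, fun z hz => ⟨?_, ?_⟩,
    isPointTransformation_of_eqOn_affine hV ((linIndep_injective hε hδ).prodMap
      (linDep_injective hε hδ)) hφ, fun z hz p q hpq => ?_, fun W hW hWo hWn => ?_⟩
  · exact (contDiffOn_const.mul (hb.comp hσ.contDiffOn fun _ h => h)).add contDiffOn_const
  · rw [Set.mem_preimage, hσz hz]
    exact (hVU z hz).1
  · simp only [b', hσz hz]
    rw [h (hVU z hz).2]
    rfl
  · have e (ξ : Indep) : linDep ε δ₁ δ₃ δ₄ (p ξ) = q (linIndep ε δ₁ δ₃ δ₄ ξ) := by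
      have := hpq.apply_eq ξ
      rwa [hT hz] at this
    have e0 := e (Pi.single 0 1)
    have e1 := e (Pi.single 1 1)
    have e2 := e (Pi.single 2 1)
    rw [map_indep q, linIndep_apply] at e0 e1 e2
    simp at e0 e1 e2
    rw [← neg_smul] at e2
    have key := linDepProd_timeDeriv hε hδ
      (p := (p (Pi.single 1 1), fderiv ℝ b (horizontal z.1) (1, 0)))
      (p' := (p (Pi.single 2 1), fderiv ℝ b (horizontal z.1) (0, 1)))
      (q := (q (Pi.single 1 1), fderiv ℝ b' (horizontal (specialize Φ b z).1) (1, 0)))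
      (q' := (q (Pi.single 2 1), fderiv ℝ b' (horizontal (specialize Φ b z).1) (0, 1)))
      (Prod.ext e1 (hb'' hz).1) (Prod.ext e2 (hb'' hz).2) z.2
    have hz2 : (specialize Φ b z).2 = linDep ε δ₁ δ₃ δ₄ z.2 := by
      rw [hφ hz]
      exact add_zero _
    have key1 := congrArg Prod.fst key
    rw [linDepProd_apply, Prod.smul_fst] at key1
    simp only at key1
    rw [mem_system_iff, mem_system_iff, hz2, Set.mem_preimage, hσz hz,
      ← (linDep_injective hε hδ).eq_iff, key1, e0, smul_right_inj h1]
  · obtain ⟨z, hz⟩ := hWn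
    let p : Indep →ₗ[ℝ] Dep := ofColumns (timeDeriv (z.2 0) (z.2 1) (z.2 2)
      (0, fderiv ℝ b (horizontal z.1) (1, 0)) (0, fderiv ℝ b (horizontal z.1) (0, 1))).1 0 0
    have hbij : Function.Bijective fun ξ =>
        ((fderiv ℝ (specialize Φ b) z : Indep × Dep →ₗ[ℝ] Indep × Dep) (ξ, p ξ)).1 := by
      simpa only [ContinuousLinearMap.coe_coe, hT (hW hz)] using linIndep_bijective hε hδ
    obtain ⟨q, hq, -⟩ := exists_map_graph_eq _ _ hbij
    refine ⟨z, hz, p, q, ?_, hq⟩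
    rw [mem_system_iff]
    refine ⟨(hVU z (hW hz)).1, ?_⟩
    simp [p, ofColumns_apply]

lemma IsExplicit.isUsualEquivalence (hU : IsOpen U) (h : IsExplicit Φ U) :
    IsUsualEquivalence Φ U := by
  refine ⟨h.isGeneralizedEquivalence hU, ?_⟩
  obtain ⟨ε, δ₁, δ₂, δ₃, δ₄, δ₅, δ₆, δ₇, -, -, h⟩ := h
  refine ⟨fun w => ((explicitMap ε δ₁ δ₂ δ₃ δ₄ δ₅ δ₆ δ₇ (w.1, (w.2, 0))).1,
    (explicitMap ε δ₁ δ₂ δ₃ δ₄ δ₅ δ₆ δ₇ (w.1, (w.2, 0))).2.1), fun z hz => ?_⟩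
  rw [h hz]
  rfl

lemma isGeneralizedEquivalence_iff_isExplicit (hUo : IsOpen U) (hU : IsConnected U) :
    IsGeneralizedEquivalence Φ U ↔ IsExplicit Φ U :=
  ⟨fun h => h.preservesJets.isExplicit h.1 hU, fun h => h.isGeneralizedEquivalence hUo⟩

lemma isUsualEquivalence_iff_isExplicit (hUo : IsOpen U) (hU : IsConnected U) :
    IsUsualEquivalence Φ U ↔ IsExplicit Φ U :=
  ⟨fun h => (isGeneralizedEquivalence_iff_isExplicit hUo hU).1 h.1,
    fun h => h.isUsualEquivalence hUo⟩

lemma isPointSymmetry_iff_isExplicit (hUo : IsOpen U) (hU : IsConnected U) :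
    IsPointSymmetry extendedSystem Φ U ↔ IsExplicit Φ U :=
  ⟨fun h => h.preservesJets.isExplicit h.1 hU, fun h => h.isPointSymmetry hUo⟩

end

/-! ### The group of explicit transformations -/

lemma IsExplicit.comp {Φ Ψ : Space → Space} (hΦ : IsExplicit Φ Set.univ)
    (hΨ : IsExplicit Ψ Set.univ) : IsExplicit (Φ ∘ Ψ) Set.univ := by
  obtain ⟨e, a₁, a₂, a₃, a₄, a₅, a₆, a₇, he, ha, h⟩ := hΦ
  obtain ⟨f, b₁, b₂, b₃, b₄, b₅, b₆, b₇, hf, hb, h'⟩ := hΨ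
  obtain ⟨ha1, has⟩ := mul_ne_zero_iff.1 ha
  obtain ⟨hb1, hbs⟩ := mul_ne_zero_iff.1 hb
  -- In complex notation the spatial part is `x + i y ↦ (δ₃ + i δ₄) (x + i ε y) + (δ₅ + i δ₆)`;
  -- these are the parameters of the composition.
  refine ⟨e * f, a₁ * b₁, a₁ * b₂ + a₂, a₃ * b₃ - e * a₄ * b₄, a₄ * b₃ + e * a₃ * b₄,
    a₃ * b₅ - e * a₄ * b₆ + a₅, a₄ * b₅ + e * a₃ * b₆ + a₆,
    (a₃ ^ 2 + a₄ ^ 2) / a₁ ^ 2 * b₇ + a₇, ?_, ?_, fun z _ => ?_⟩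
  · rcases he with rfl | rfl <;> rcases hf with rfl | rfl <;> norm_num
  · have : a₁ * b₁ * ((a₃ * b₃ - e * a₄ * b₄) ^ 2 + (a₄ * b₃ + e * a₃ * b₄) ^ 2) =
        (a₁ * (a₃ ^ 2 + a₄ ^ 2)) * (b₁ * (b₃ ^ 2 + b₄ ^ 2)) := by
      rcases he with rfl | rfl <;> ring
    rw [this]
    exact mul_ne_zero ha hb
  · rw [Function.comp_apply, h' trivial, h trivial]
    refine ext_coord fun i => ?_
    fin_cases i
    all_goals
      simp only [explicitMap, coord_zero, coord_one, coord_two, coord_three, coord_four,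
        coord_five, coord_six, Fin.zero_eta, Fin.mk_one, Fin.reduceFinMk, Matrix.cons_val]
      rcases he with rfl | rfl <;> field_simp <;> ring

lemma IsExplicit.symm {Φ : Equiv.Perm Space} (hΦ : IsExplicit Φ Set.univ) :
    IsExplicit Φ.symm Set.univ := by
  obtain ⟨e, a₁, a₂, a₃, a₄, a₅, a₆, a₇, he, ha, h⟩ := hΦ
  obtain ⟨ha1, has⟩ := mul_ne_zero_iff.1 ha
  have hs : (a₃ / (a₃ ^ 2 + a₄ ^ 2)) ^ 2 + (-(e * a₄ / (a₃ ^ 2 + a₄ ^ 2))) ^ 2 =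
      (a₃ ^ 2 + a₄ ^ 2)⁻¹ := by
    rcases he with rfl | rfl <;> field_simp
  -- The multiplier is the reciprocal of `a₃ + i a₄`, conjugated when `e = -1`; the other parameters
  -- undo the scalings and shifts.
  refine ⟨e, a₁⁻¹, -(a₂ / a₁), a₃ / (a₃ ^ 2 + a₄ ^ 2), -(e * a₄ / (a₃ ^ 2 + a₄ ^ 2)),
    -((a₃ * a₅ + a₄ * a₆) / (a₃ ^ 2 + a₄ ^ 2)), -(e * (a₃ * a₆ - a₄ * a₅) / (a₃ ^ 2 + a₄ ^ 2)),
    -(a₁ ^ 2 * a₇ / (a₃ ^ 2 + a₄ ^ 2)), he, ?_, fun w _ => ?_⟩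
  · rw [hs]
    exact mul_ne_zero (inv_ne_zero ha1) (inv_ne_zero has)
  · obtain ⟨z, rfl⟩ := Φ.surjective w
    rw [Equiv.symm_apply_apply, h trivial]
    refine ext_coord fun i => ?_
    fin_cases i
    all_goals
      simp only [explicitMap, coord_zero, coord_one, coord_two, coord_three, coord_four,
        coord_five, coord_six, Fin.zero_eta, Fin.mk_one, Fin.reduceFinMk, Matrix.cons_val, hs]
      rcases he with rfl | rfl <;> field_simp <;> ring

/-- The group of the bijections of the space that have the explicit form. -/
def explicitGroup : Subgroup (Equiv.Perm Space) where
  carrier := {Φ | IsExplicit Φ Set.univ}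
  mul_mem' hΦ hΨ := hΦ.comp hΨ
  one_mem' := by
    refine ⟨1, 1, 0, 1, 0, 0, 0, 0, Or.inl rfl, by norm_num, fun z _ => ext_coord fun i => ?_⟩
    fin_cases i <;> simp [explicitMap]
  inv_mem' hΦ := hΦ.symm

end ShallowWater

theorem mainTheorem2 :
    (∀ (U : Set ShallowWater.Space), IsOpen U → IsConnected U →
      ∀ Φ : ShallowWater.Space → ShallowWater.Space,
        (ShallowWater.IsGeneralizedEquivalence Φ U ↔ ShallowWater.IsUsualEquivalence Φ U) ∧
        (ShallowWater.IsGeneralizedEquivalence Φ U ↔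
          ShallowWater.IsPointSymmetry ShallowWater.extendedSystem Φ U) ∧
        (ShallowWater.IsGeneralizedEquivalence Φ U ↔ ShallowWater.IsExplicit Φ U)) ∧
    (∃ G : Subgroup (Equiv.Perm ShallowWater.Space), ∀ Φ : Equiv.Perm ShallowWater.Space,
      (Φ ∈ G ↔ ShallowWater.IsGeneralizedEquivalence Φ Set.univ) ∧
      (Φ ∈ G ↔ ShallowWater.IsUsualEquivalence Φ Set.univ) ∧
      (Φ ∈ G ↔ ShallowWater.IsPointSymmetry ShallowWater.extendedSystem Φ Set.univ) ∧
      (Φ ∈ G ↔ ShallowWater.IsExplicit Φ Set.univ)) := by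
  refine ⟨fun U hUo hU Φ => ?_, ShallowWater.explicitGroup, fun Φ => ?_⟩
  · rw [ShallowWater.isGeneralizedEquivalence_iff_isExplicit hUo hU,
      ShallowWater.isUsualEquivalence_iff_isExplicit hUo hU,
      ShallowWater.isPointSymmetry_iff_isExplicit hUo hU]
    exact ⟨Iff.rfl, Iff.rfl, Iff.rfl⟩
  · rw [ShallowWater.isGeneralizedEquivalence_iff_isExplicit isOpen_univ isConnected_univ,
      ShallowWater.isUsualEquivalence_iff_isExplicit isOpen_univ isConnected_univ,
      ShallowWater.isPointSymmetry_iff_isExplicit isOpen_univ isConnected_univ]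
    exact ⟨Iff.rfl, Iff.rfl, Iff.rfl, Iff.rfl⟩
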